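/- Let $m\ge 1$ and let $M$ be a connected smooth manifold of dimension $2m+1$ with a strictly pseudoconvex integrable CR structure $(H(M),J)$ and a pseudo-Hermitian structure $\theta$: $\theta$ is a nowhere vanishing $1$-form with $H(M)=\ker\theta$, $J$ is an integrable complex structure on $H(M)$ (for sections $X,Y$ of $H(M)$, $[JX,Y]+[X,JY]$ is a section of $H(M)$ and $[X,Y]-[JX,JY]+J([JX,Y]+[X,JY])=0$), and $g_\theta(X,Y)=\tfrac12 d\theta(X,JY)$ is positive definite on $H(M)$. Let $T$ be the characteristic vector field ($\theta(T)=1$, $T\lrcorner d\theta=0$) and $X^H=X-\theta(X)T$. Let $\nabla^W$ be the Webster-Tanaka connection: for $X,Y$ in $H(M)$, $\nabla^W_XY$ is the section of $H(M)$ given by the Koszul formula for $g_\theta$ (with $\pi_\theta[\cdot,\cdot]$, the $H(M)$-part of the bracket along $T$, in place of the bracket), $\nabla^W_TX=\tfrac12([T,X]-J[T,JX])$, and $\nabla^WT=0$. Let $\tau(X)=\nabla^W_TX-\nabla^W_XT-[T,X]$ be the Webster torsion on $H(M)$, $R^W(X,Y)=\nabla^W_X\nabla^W_Y-\nabla^W_Y\nabla^W_X-\nabla^W_{[X,Y]}$,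 and, for a $g_\theta$-orthonormal basis $e_1,\dots,e_{2m}$ of $H(M)$, let $$\mathrm{Ric}^W(X)=\sum_l R^W(X,e_l)e_l,\qquad \rho_\theta(X,Y)=\tfrac12\sum_l g_\theta(R^W(Je_l,e_l)X^H,Y^H),\qquad \operatorname{div}\tau=\sum_l(\nabla^W_{e_l}\tau)e_l .$$ For a $2$-form $\omega$ with $T\lrcorner\omega=0$ put $(d^W\omega)(X,Y,Z)=(d\omega)(X^H,Y^H,Z^H)$. Then $\rho_\theta$ is a smooth $2$-form with $T\lrcorner\rho_\theta=0$, and $$d^W\rho_\theta=-(J\,\mathrm{Ric}^W(T))^\flat\wedge d\theta ,$$ where $V^\flat=g_\theta(V,\cdot)$ (extended by $0$ on $T$) and $(\alpha\wedge\beta)(X,Y,Z)=\alpha(X)\beta(Y,Z)-\alpha(Y)\beta(X,Z)+\alpha(Z)\beta(X,Y)$. Consequently, if $\operatorname{div}\tau=0$, then $d^W\rho_\theta=0$; and if $m\ge 2$, then $d^W\rho_\theta=0$ if and only if $\operatorname{div}\tau=0$. -/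

import Mathlib

open Bundle VectorField
open scoped Manifold ContDiff Topology

noncomputable section

namespace CR

variable {m : ℕ} {M : Type*} [TopologicalSpace M]
  [ChartedSpace (EuclideanSpace ℝ (Fin (2 * m + 1))) M]

variable (m M) in
/-- Vector fields on a manifold of dimension `2m+1` (no regularity included). -/
abbrev VField : Type _ := (x : M) → TangentSpace (𝓡 (2 * m + 1)) x

variable (m M) in
/-- `1`-forms (no regularity included). -/
abbrev OneForm : Type _ := (x : M) → TangentSpace (𝓡 (2 * m + 1)) x →L[ℝ] ℝ

variable (m M) in
/-- Covariant `2`-tensors, as bare functions. -/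
abbrev TwoTensor : Type _ :=
  (x : M) → TangentSpace (𝓡 (2 * m + 1)) x → TangentSpace (𝓡 (2 * m + 1)) x → ℝ

/-- The derivative `X(f)` of a function along a vector field. -/
def dirDeriv (X : VField m M) (f : M → ℝ) (x : M) : ℝ :=
  mvfderiv (𝓡 (2 * m + 1)) f x (X x)

/-- The Lie bracket `[X, Y]`. -/
abbrev bracket (X Y : VField m M) : VField m M := mlieBracket (𝓡 (2 * m + 1)) X Y

/-- The exterior differential of a `1`-form,
`dα(X, Y) = X(α(Y)) - Y(α(X)) - α([X, Y])`. -/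
def extDerivOne (α : OneForm m M) (X Y : VField m M) (x : M) : ℝ :=
  dirDeriv X (fun y ↦ α y (Y y)) x - dirDeriv Y (fun y ↦ α y (X y)) x - α x (bracket X Y x)

lemma extDerivOne_swap (α : OneForm m M) (X Y : VField m M) (x : M) :
    extDerivOne α X Y x = - extDerivOne α Y X x := by
  simp only [extDerivOne, bracket, mlieBracket_swap_apply (V := X) (W := Y), map_neg]
  ring

/-- The exterior differential of a `2`-form,
`dβ(X, Y, Z) = X(β(Y, Z)) - Y(β(X, Z)) + Z(β(X, Y)) - β([X, Y], Z) + β([X, Z], Y) - β([Y, Z], X)`.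
-/
def extDerivTwo (β : TwoTensor m M) (X Y Z : VField m M) (x : M) : ℝ :=
  dirDeriv X (fun y ↦ β y (Y y) (Z y)) x - dirDeriv Y (fun y ↦ β y (X y) (Z y)) x
    + dirDeriv Z (fun y ↦ β y (X y) (Y y)) x
    - β x (bracket X Y x) (Z x) + β x (bracket X Z x) (Y x) - β x (bracket Y Z x) (X x)

/-- The wedge product of a `1`-form and a `2`-form at a point,
`(α ∧ β)(u, v, w) = α(u) β(v, w) - α(v) β(u, w) + α(w) β(u, v)`. -/
def wedge {x : M} (α : TangentSpace (𝓡 (2 * m + 1)) x → ℝ)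
    (β : TangentSpace (𝓡 (2 * m + 1)) x → TangentSpace (𝓡 (2 * m + 1)) x → ℝ)
    (u v w : TangentSpace (𝓡 (2 * m + 1)) x) : ℝ :=
  α u * β v w - α v * β u w + α w * β u v

lemma finrank_tangent (x : M) : Module.finrank ℝ (TangentSpace (𝓡 (2 * m + 1)) x) = 2 * m + 1 :=
  finrank_euclideanSpace_fin

lemma finite_tangent (x : M) : FiniteDimensional ℝ (TangentSpace (𝓡 (2 * m + 1)) x) :=
  Module.finite_of_finrank_pos (by rw [finrank_tangent]; omega)

variable [IsManifold (𝓡 (2 * m + 1)) ∞ M]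

/-- The vector field `X` is smooth at (that is, near) the point `x`. -/
def SmoothAt (X : VField m M) (x : M) : Prop :=
  ContMDiffAt (𝓡 (2 * m + 1)) (𝓡 (2 * m + 1)).tangent ∞
    (fun y ↦ (⟨y, X y⟩ : TangentBundle (𝓡 (2 * m + 1)) M)) x

/-- A vector field, smooth near `x`, which extends the tangent vector `v` at `x`. It is used to
evaluate tensors, which depend only on the values of vector fields at `x`. -/
def ext {x : M} (v : TangentSpace (𝓡 (2 * m + 1)) x) : VField m M :=
  FiberBundle.extend (EuclideanSpace ℝ (Fin (2 * m + 1))) v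

@[simp] lemma ext_self {x : M} (v : TangentSpace (𝓡 (2 * m + 1)) x) : ext v x = v := by
  simp [ext]

lemma smoothAt_ext {x : M} (v : TangentSpace (𝓡 (2 * m + 1)) x) : SmoothAt (ext v) x :=
  FiberBundle.contMDiffAt_extend _ _ v

/-- The value at `x` of the exterior differential of a `1`-form, as a `2`-tensor. -/
def extDerivOneAt (α : OneForm m M) : TwoTensor m M :=
  fun x u v ↦ extDerivOne α (ext u) (ext v) x

/-- Smoothness of a `1`-form, as a section of the cotangent bundle. -/
def SmoothOneForm (α : OneForm m M) : Prop :=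
  ContMDiff (𝓡 (2 * m + 1))
    ((𝓡 (2 * m + 1)).prod 𝓘(ℝ, EuclideanSpace ℝ (Fin (2 * m + 1)) →L[ℝ] ℝ)) ∞
    (fun x ↦ TotalSpace.mk' (EuclideanSpace ℝ (Fin (2 * m + 1)) →L[ℝ] ℝ)
      (E := fun x : M ↦ (TangentSpace (𝓡 (2 * m + 1)) x →L[ℝ] Bundle.Trivial M ℝ x)) x (α x))

lemma SmoothOneForm.mdifferentiableAt {α : OneForm m M} (h : SmoothOneForm α) {Y : VField m M}
    {x : M} (hY : MDifferentiableAt (𝓡 (2 * m + 1)) (𝓡 (2 * m + 1)).tangent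
      (fun y ↦ (⟨y, Y y⟩ : TangentBundle (𝓡 (2 * m + 1)) M)) x) :
    MDifferentiableAt (𝓡 (2 * m + 1)) 𝓘(ℝ) (fun y ↦ α y (Y y)) x := by
  have h1 := (h x).mdifferentiableAt (by simp)
  have := MDifferentiableAt.clm_bundle_apply (E₂ := Bundle.Trivial M ℝ) (b := fun y : M ↦ y)
    (v := Y) (ϕ := α) h1 hY
  simp only [mdifferentiableAt_totalSpace] at this
  exact this.2

lemma tensorialAt_left {α : OneForm m M} (h : SmoothOneForm α) (Y : VField m M) {x : M} :
    TensorialAt (𝓡 (2 * m + 1)) (EuclideanSpace ℝ (Fin (2 * m + 1)))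
      (fun X : VField m M ↦ extDerivOne α X Y x) x where
  smul {f X} hf hX := by
    have e : (fun y ↦ α y ((f • X) y)) = fun y ↦ f y * α y (X y) := by ext y; simp
    simp only [extDerivOne, dirDeriv, e, mvfderiv_fun_mul hf (h.mdifferentiableAt hX), bracket,
      mlieBracket_smul_left hf hX]
    simp
    ring
  add {X X'} hX hX' := by
    have e : (fun y ↦ α y ((X + X') y)) = fun y ↦ α y (X y) + α y (X' y) := by ext y; simp
    simp only [extDerivOne, dirDeriv, e, bracket, mlieBracket_add_left hX hX',
      mvfderiv_fun_add (h.mdifferentiableAt hX) (h.mdifferentiableAt hX')]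
    simp
    ring

lemma tensorialAt_right {α : OneForm m M} (h : SmoothOneForm α) (X : VField m M) {x : M} :
    TensorialAt (𝓡 (2 * m + 1)) (EuclideanSpace ℝ (Fin (2 * m + 1)))
      (fun Y : VField m M ↦ extDerivOne α X Y x) x where
  smul {f Y} hf hY := by
    rw [extDerivOne_swap, (tensorialAt_left h X).smul hf hY, extDerivOne_swap α Y X, smul_neg,
      neg_neg]
  add {Y Y'} hY hY' := by
    rw [extDerivOne_swap, (tensorialAt_left h X).add hY hY', extDerivOne_swap α Y X,
      extDerivOne_swap α Y' X]
    ring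

/-- `dα` at `x` as a bilinear form. -/
def extDerivOneHom {α : OneForm m M} (h : SmoothOneForm α) (x : M) :
    TangentSpace (𝓡 (2 * m + 1)) x →L[ℝ] TangentSpace (𝓡 (2 * m + 1)) x →L[ℝ] ℝ :=
  TensorialAt.mkHom₂ (fun X Y : VField m M ↦ extDerivOne α X Y x) x
    (fun Y _ ↦ tensorialAt_left h Y) (fun X _ ↦ tensorialAt_right h X)

lemma extDerivOneHom_apply {α : OneForm m M} (h : SmoothOneForm α) (x : M)
    (u v : TangentSpace (𝓡 (2 * m + 1)) x) : extDerivOneHom h x u v = extDerivOneAt α x u v :=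
  rfl

lemma extDerivOneAt_field {α : OneForm m M} (h : SmoothOneForm α) {x : M} {X Y : VField m M}
    (hX : SmoothAt X x) (hY : SmoothAt Y x) :
    extDerivOneAt α x (X x) (Y x) = extDerivOne α X Y x :=
  TensorialAt.mkHom₂_apply (Φ := fun X Y : VField m M ↦ extDerivOne α X Y x)
    (fun Y _ ↦ tensorialAt_left h Y) (fun X _ ↦ tensorialAt_right h X)
    (hX.mdifferentiableAt (by simp)) (hY.mdifferentiableAt (by simp))

lemma extDerivOneAt_swap (α : OneForm m M) (x : M) (u v : TangentSpace (𝓡 (2 * m + 1)) x) :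
    extDerivOneAt α x u v = - extDerivOneAt α x v u :=
  extDerivOne_swap ..

/-- The vector field `X` is smooth near `x` and is a section of `ker θ` near `x`. -/
def SmoothHorizontalAt (θ : OneForm m M) (X : VField m M) (x : M) : Prop :=
  SmoothAt X x ∧ ∀ᶠ y in 𝓝 x, θ y (X y) = 0

variable (m M) in
/-- A strictly pseudoconvex (integrable) CR manifold of dimension `2m+1` with a pseudo-Hermitian
structure `θ`. The CR structure consists of the bundle `H(M) = ker θ` and of the complex structure
`J` on `H(M)`; `J` is given as the restriction to `H(M)` of a smooth field of endomorphisms of the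
tangent spaces, whose values outside `H(M)` are irrelevant (and never used). -/
structure PseudoHermitian where
  /-- the contact form -/
  θ : OneForm m M
  /-- the complex structure on `ker θ` -/
  J : (x : M) → TangentSpace (𝓡 (2 * m + 1)) x →L[ℝ] TangentSpace (𝓡 (2 * m + 1)) x
  smooth_θ : SmoothOneForm θ
  smooth_J : ContMDiff (𝓡 (2 * m + 1)) ((𝓡 (2 * m + 1)).prod
      𝓘(ℝ, EuclideanSpace ℝ (Fin (2 * m + 1)) →L[ℝ] EuclideanSpace ℝ (Fin (2 * m + 1)))) ∞
    (fun x ↦ TotalSpace.mk'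
      (EuclideanSpace ℝ (Fin (2 * m + 1)) →L[ℝ] EuclideanSpace ℝ (Fin (2 * m + 1)))
      (E := fun x : M ↦
        (TangentSpace (𝓡 (2 * m + 1)) x →L[ℝ] TangentSpace (𝓡 (2 * m + 1)) x)) x (J x))
  θ_ne_zero : ∀ x, θ x ≠ 0
  J_mem : ∀ x v, θ x v = 0 → θ x (J x v) = 0
  J_sq : ∀ x v, θ x v = 0 → J x (J x v) = -v
  /-- partial integrability: `[JX, Y] + [X, JY]` is a section of `H(M)` -/
  partially_integrable : ∀ (x : M) (X Y : VField m M),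
    SmoothHorizontalAt θ X x → SmoothHorizontalAt θ Y x →
    θ x (bracket (fun y ↦ J y (X y)) Y x + bracket X (fun y ↦ J y (Y y)) x) = 0
  /-- integrability: the Nijenhuis tensor vanishes -/
  integrable : ∀ (x : M) (X Y : VField m M),
    SmoothHorizontalAt θ X x → SmoothHorizontalAt θ Y x →
    bracket X Y x - bracket (fun y ↦ J y (X y)) (fun y ↦ J y (Y y)) x
      + J x (bracket (fun y ↦ J y (X y)) Y x + bracket X (fun y ↦ J y (Y y)) x) = 0
  /-- `g_θ(X, Y) = (1/2) dθ(X, JY)` is positive definite on `H(M)` -/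
  pos_def : ∀ x v, θ x v = 0 → v ≠ 0 → 0 < (1 / 2 : ℝ) * extDerivOneAt θ x v (J x v)

namespace PseudoHermitian

variable (S : PseudoHermitian m M)

/-- `v` is horizontal, that is, `v ∈ H(M) = ker θ`. -/
def hor (x : M) : Submodule ℝ (TangentSpace (𝓡 (2 * m + 1)) x) := LinearMap.ker (S.θ x).toLinearMap

@[simp] lemma mem_hor {x : M} {v : TangentSpace (𝓡 (2 * m + 1)) x} :
    v ∈ S.hor x ↔ S.θ x v = 0 := Iff.rfl

lemma finrank_hor (x : M) : Module.finrank ℝ (S.hor x) = 2 * m := by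
  have := finite_tangent (m := m) x
  have h1 : (S.θ x).toLinearMap ≠ 0 := fun h ↦ S.θ_ne_zero x (by ext v; exact congrArg (· v) h)
  have h2 := Module.Dual.finrank_ker_add_one_of_ne_zero (f := (S.θ x).toLinearMap) h1
  have h3 := finrank_tangent (m := m) x
  unfold hor
  omega

/-- Existence and uniqueness of the characteristic vector at each point. -/
lemma existsUnique_reeb (x : M) : ∃! T : TangentSpace (𝓡 (2 * m + 1)) x,
    S.θ x T = 1 ∧ ∀ v, extDerivOneAt S.θ x T v = 0 := by
  set B := extDerivOneHom S.smooth_θ x with hB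
  have hBa : ∀ u v, B u v = extDerivOneAt S.θ x u v := fun u v ↦ rfl
  have hpos : ∀ v, S.θ x v = 0 → (∀ w, S.θ x w = 0 → B v w = 0) → v = 0 := by
    intro v hv h
    by_contra hne
    have := S.pos_def x v hv hne
    rw [← hBa, h _ (S.J_mem x v hv)] at this
    simp at this
  have := finite_tangent (m := m) x
  have hfin := finrank_tangent (m := m) x
  let A : TangentSpace (𝓡 (2 * m + 1)) x →ₗ[ℝ] Module.Dual ℝ (S.hor x) :=
    { toFun := fun v ↦ (B v).toLinearMap ∘ₗ (S.hor x).subtype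
      map_add' := by intro u v; ext w; simp
      map_smul' := by intro c v; ext w; simp }
  have hker : LinearMap.ker A ≠ ⊥ := by
    apply LinearMap.ker_ne_bot_of_finrank_lt
    rw [Subspace.dual_finrank_eq, S.finrank_hor x]
    omega
  obtain ⟨v, hv, hv0⟩ := (Submodule.ne_bot_iff _).1 hker
  have hv' : ∀ w, S.θ x w = 0 → B v w = 0 := fun w hw ↦
    congrArg (fun f : Module.Dual ℝ (S.hor x) ↦ f ⟨w, hw⟩) hv
  have hθ : S.θ x v ≠ 0 := fun h ↦ hv0 (hpos v h hv')
  have hself : ∀ u, B u u = 0 := fun u ↦ by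
    have := extDerivOneAt_swap S.θ x u u
    rw [hBa]; linarith
  refine ⟨(S.θ x v)⁻¹ • v, ⟨by simp [hθ], fun w ↦ ?_⟩, ?_⟩
  · rw [← hBa]
    have h1 : B v (w - (S.θ x w / S.θ x v) • v) = 0 := hv' _ (by simp [hθ])
    rw [map_sub, map_smul, hself] at h1
    rw [map_smul]
    simp only [smul_zero, sub_zero] at h1
    simp [h1]
  · rintro T ⟨hT1, hT2⟩
    have h0 : T - (S.θ x v)⁻¹ • v = 0 := by
      apply hpos
      · simp [hT1, hθ]
      · intro w hw
        rw [map_sub, map_smul]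
        simp [hv' w hw, hBa T w, hT2 w]
    exact sub_eq_zero.1 h0

/-- The characteristic vector field `T`: `θ(T) = 1` and `T ⌟ dθ = 0`. -/
def T : VField m M := fun x ↦ (S.existsUnique_reeb x).choose

lemma T_spec (x : M) : S.θ x (S.T x) = 1 ∧ ∀ v, extDerivOneAt S.θ x (S.T x) v = 0 :=
  (S.existsUnique_reeb x).choose_spec.1

/-- The projection `π_θ : TM → H(M)` along `T`, at a point. -/
def proj (x : M) (v : TangentSpace (𝓡 (2 * m + 1)) x) : TangentSpace (𝓡 (2 * m + 1)) x :=
  v - S.θ x v • S.T x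

/-- The horizontal part `X^H = π_θ(X)` of a vector field. -/
def hpart (X : VField m M) : VField m M := fun x ↦ S.proj x (X x)

/-- The vector field `J(X^H)`; for a horizontal vector field this is `JX`. -/
def Jf (X : VField m M) : VField m M := fun x ↦ S.J x (S.proj x (X x))

/-- The `2`-form `dθ`. -/
def dθ : TwoTensor m M := extDerivOneAt S.θ

/-- The metric `g_θ(X, Y) = (1/2) dθ(X, JY)` on `H(M)`, extended by zero on `T`. -/
def g : TwoTensor m M := fun x u v ↦ (1 / 2 : ℝ) * S.dθ x u (S.J x (S.proj x v))

lemma smooth_Japply {X : VField m M} {x : M} (hX : SmoothAt X x) :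
    SmoothAt (fun y ↦ S.J y (X y)) x :=
  ContMDiffAt.clm_bundle_apply (b := fun y : M ↦ y) (v := X) (ϕ := S.J) (S.smooth_J x) hX

lemma smooth_θapply {X : VField m M} {x : M} (hX : SmoothAt X x) :
    ContMDiffAt (𝓡 (2 * m + 1)) 𝓘(ℝ) ∞ (fun y ↦ S.θ y (X y)) x := by
  have := ContMDiffAt.clm_bundle_apply (E₂ := Bundle.Trivial M ℝ) (b := fun y : M ↦ y)
    (v := X) (ϕ := S.θ) (S.smooth_θ x) hX
  simp only [contMDiffAt_totalSpace] at this
  exact this.2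

lemma exists_horizontal_ext {x : M} {u : TangentSpace (𝓡 (2 * m + 1)) x} (hu : S.θ x u = 0) :
    ∃ U : VField m M, SmoothHorizontalAt S.θ U x ∧ U x = u := by
  have hA := smoothAt_ext (S.T x)
  have hU := smoothAt_ext u
  have hAx : S.θ x (ext (S.T x) x) ≠ 0 := by simp [(S.T_spec x).1]
  have hc := S.smooth_θapply hA
  refine ⟨fun y ↦ ext u y + (-(S.θ y (ext u y) / S.θ y (ext (S.T x) y))) • ext (S.T x) y,
    ⟨?_, ?_⟩, by simp [hu]⟩
  · apply ContMDiffAt.add_section hU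
    exact ContMDiffAt.smul_section (((S.smooth_θapply hU).div₀ hc hAx).neg) hA
  · filter_upwards [hc.continuousAt.eventually_ne hAx] with y hy
    simp [hy]

lemma extDerivOne_horizontal {X Y : VField m M} {x : M} (hX : SmoothHorizontalAt S.θ X x)
    (hY : SmoothHorizontalAt S.θ Y x) :
    extDerivOne S.θ X Y x = - S.θ x (bracket X Y x) := by
  have h0 : ∀ Z : VField m M, SmoothHorizontalAt S.θ Z x →
      mvfderiv (𝓡 (2 * m + 1)) (fun y ↦ S.θ y (Z y)) x = 0 := by
    intro Z hZ
    have : (fun y ↦ S.θ y (Z y)) =ᶠ[𝓝 x] fun _ ↦ (0 : ℝ) := hZ.2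
    rw [mvfderiv, this.mfderiv_eq, mfderiv_const]
    rfl
  simp [extDerivOne, dirDeriv, h0 X hX, h0 Y hY]

lemma SmoothHorizontalAt_J {X : VField m M} {x : M} (hX : SmoothHorizontalAt S.θ X x) :
    SmoothHorizontalAt S.θ (fun y ↦ S.J y (X y)) x :=
  ⟨S.smooth_Japply hX.1, by filter_upwards [hX.2] with y hy using S.J_mem y _ hy⟩

lemma dθ_J_J {x : M} {u v : TangentSpace (𝓡 (2 * m + 1)) x} (hu : S.θ x u = 0)
    (hv : S.θ x v = 0) : S.dθ x (S.J x u) (S.J x v) = S.dθ x u v := by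
  obtain ⟨U, hU, rfl⟩ := S.exists_horizontal_ext hu
  obtain ⟨V, hV, rfl⟩ := S.exists_horizontal_ext hv
  have hJU := S.SmoothHorizontalAt_J hU
  have hJV := S.SmoothHorizontalAt_J hV
  have e1 := extDerivOneAt_field S.smooth_θ hU.1 hV.1
  have e2 := extDerivOneAt_field S.smooth_θ hJU.1 hJV.1
  have h := S.partially_integrable x U _ hU hJV
  have e3 : bracket U (fun y ↦ S.J y (S.J y (V y))) x = - bracket U V x := by
    have hc : (fun y ↦ S.J y (S.J y (V y))) =ᶠ[𝓝 x] (-1 : ℝ) • V := by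
      filter_upwards [hV.2] with y hy
      rw [S.J_sq y _ hy, Pi.smul_apply, neg_smul, one_smul]
    have h1 := Filter.EventuallyEq.mlieBracket_vectorField_eq (I := 𝓡 (2 * m + 1))
      (Filter.EventuallyEq.refl (𝓝 x) U) hc
    rw [mlieBracket_const_smul_right (hV.1.mdifferentiableAt (by simp)), neg_smul, one_smul] at h1
    exact h1
  rw [dθ, e1, e2, S.extDerivOne_horizontal hU hV, S.extDerivOne_horizontal hJU hJV]
  rw [e3, map_add, map_neg] at h
  linarith

lemma proj_of_hor {x : M} {v : TangentSpace (𝓡 (2 * m + 1)) x} (hv : S.θ x v = 0) :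
    S.proj x v = v := by simp [proj, hv]

lemma g_symm {x : M} {u v : TangentSpace (𝓡 (2 * m + 1)) x} (hu : S.θ x u = 0)
    (hv : S.θ x v = 0) : S.g x u v = S.g x v u := by
  have h := S.dθ_J_J hu (S.J_mem x v hv)
  have h1 : S.dθ x (S.J x u) (S.J x (S.J x v)) = S.dθ x v (S.J x u) := by
    rw [S.J_sq x v hv, dθ, extDerivOneAt_swap, ← extDerivOneHom_apply S.smooth_θ,
      ← extDerivOneHom_apply S.smooth_θ]
    simp
  simp only [g, S.proj_of_hor hu, S.proj_of_hor hv]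
  rw [← h, h1]

/-- Orthonormal bases of `(H(M), g_θ)` at a point. -/
def IsOrthonormalBasis (x : M) (e : Fin (2 * m) → TangentSpace (𝓡 (2 * m + 1)) x) : Prop :=
  (∀ l, S.θ x (e l) = 0) ∧ ∀ k l, S.g x (e k) (e l) = if k = l then 1 else 0

lemma exists_isOrthonormalBasis (x : M) : ∃ e, S.IsOrthonormalBasis x e := by
  have := finite_tangent (m := m) x
  let c : InnerProductSpace.Core ℝ (S.hor x) :=
    { inner := fun u v ↦ S.g x u v
      conj_inner_symm := fun u v ↦ by simpa using S.g_symm v.2 u.2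
      re_inner_nonneg := fun u ↦ by
        by_cases hu : (u : TangentSpace (𝓡 (2 * m + 1)) x) = 0
        · simp [g, dθ, hu, proj, ← extDerivOneHom_apply S.smooth_θ]
        · have := S.pos_def x u u.2 hu
          simpa [g, S.proj_of_hor u.2, dθ] using this.le
      add_left := fun u v w ↦ by
        simp [g, dθ, ← extDerivOneHom_apply S.smooth_θ, mul_add]
      smul_left := fun u v r ↦ by
        simp [g, dθ, ← extDerivOneHom_apply S.smooth_θ]
        ring
      definite := fun u hu ↦ by
        by_contra hne
        have := S.pos_def x u u.2 (fun h ↦ hne (Subtype.ext h))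
        simp only [g, S.proj_of_hor u.2, dθ] at hu
        linarith }
  let i1 : NormedAddCommGroup (S.hor x) := c.toNormedAddCommGroup
  let i2 : InnerProductSpace ℝ (S.hor x) := InnerProductSpace.ofCore c.toCore
  let b := (stdOrthonormalBasis ℝ (S.hor x)).reindex (finCongr (S.finrank_hor x))
  refine ⟨fun l ↦ (b l : TangentSpace (𝓡 (2 * m + 1)) x), fun l ↦ (b l).2, fun k l ↦ ?_⟩
  exact b.inner_eq_ite k l

/-- An orthonormal basis `e_1, …, e_{2m}` of `(H(M), g_θ)` at the point `x`. -/
def frame (x : M) : Fin (2 * m) → TangentSpace (𝓡 (2 * m + 1)) x :=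
  (S.exists_isOrthonormalBasis x).choose

lemma frame_spec (x : M) : S.IsOrthonormalBasis x (S.frame x) :=
  (S.exists_isOrthonormalBasis x).choose_spec

/-- The right-hand side of the Koszul formula, for horizontal vector fields `X, Y, Z`. -/
def koszul (X Y Z : VField m M) (x : M) : ℝ :=
  dirDeriv X (fun y ↦ S.g y (Y y) (Z y)) x + dirDeriv Y (fun y ↦ S.g y (X y) (Z y)) x
    - dirDeriv Z (fun y ↦ S.g y (X y) (Y y)) x
    + S.g x (S.hpart (bracket X Y) x) (Z x) - S.g x (S.hpart (bracket X Z) x) (Y x)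
    - S.g x (S.hpart (bracket Y Z) x) (X x)

/-- The partial connection on `H(M)`: for horizontal `X, Y`, the horizontal vector field `∇_X Y`
with `2 g_θ(∇_X Y, Z) = koszul X Y Z` for all horizontal `Z`, written in the orthonormal basis
`e_l`. In general this is `∇_{X^H} Y^H`. -/
def nablaH (X Y : VField m M) : VField m M := fun x ↦
  ∑ l, ((1 / 2 : ℝ) * S.koszul (S.hpart X) (S.hpart Y) (S.hpart (ext (S.frame x l))) x) •
    S.frame x l

/-- `∇_T Y = (1/2) ([T, Y] - J [T, JY])` for horizontal `Y`, applied to `Y^H` in general. -/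
def nablaT (Y : VField m M) : VField m M := fun x ↦
  (1 / 2 : ℝ) • (bracket S.T (S.hpart Y) x - S.J x (bracket S.T (S.Jf Y) x))

/-- The Webster-Tanaka connection on `TM`. With `X = X^H + θ(X) T`, `Y = Y^H + θ(Y) T` and
`∇T = 0` it is `∇_X Y = ∇_{X^H} Y^H + θ(X) ∇_T Y^H + X(θ(Y)) T`. -/
def nabla (X Y : VField m M) : VField m M := fun x ↦
  S.nablaH X Y x + S.θ x (X x) • S.nablaT Y x + dirDeriv X (fun y ↦ S.θ y (Y y)) x • S.T x

/-- The torsion `Tor(X, Y) = ∇_X Y - ∇_Y X - [X, Y]`. -/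
def torsion (X Y : VField m M) : VField m M := fun x ↦
  S.nabla X Y x - S.nabla Y X x - bracket X Y x

/-- The Webster torsion `τ(X) = Tor(T, X)` of a horizontal vector field (of `X^H` in general). -/
def tau (X : VField m M) : VField m M := S.torsion S.T (S.hpart X)

/-- The covariant derivative `(∇_X τ)(Y) = ∇_X (τ(Y)) - τ(∇_X Y)`. -/
def nablaTau (X Y : VField m M) : VField m M := fun x ↦
  S.nabla X (S.tau Y) x - S.tau (S.nabla X Y) x

/-- The divergence `∑_l (∇_{e_l} τ)(e_l)` of the torsion. -/
def divTau : VField m M := fun x ↦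
  ∑ l, S.nablaTau (S.hpart (ext (S.frame x l))) (S.hpart (ext (S.frame x l))) x

/-- The curvature `R(X, Y) Z = ∇_X ∇_Y Z - ∇_Y ∇_X Z - ∇_{[X, Y]} Z`. -/
def curvature (X Y Z : VField m M) : VField m M := fun x ↦
  S.nabla X (S.nabla Y Z) x - S.nabla Y (S.nabla X Z) x - S.nabla (bracket X Y) Z x

/-- The curvature tensor at a point, `R(u, v) w`. -/
def curvatureAt (x : M) (u v w : TangentSpace (𝓡 (2 * m + 1)) x) : TangentSpace (𝓡 (2 * m + 1)) x :=
  S.curvature (ext u) (ext v) (ext w) x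

/-- The Webster Ricci endomorphism `Ric(v) = ∑_l R(v, e_l) e_l`. -/
def ricci (x : M) (v : TangentSpace (𝓡 (2 * m + 1)) x) : TangentSpace (𝓡 (2 * m + 1)) x :=
  ∑ l, S.curvatureAt x v (S.frame x l) (S.frame x l)

/-- The pseudo-Hermitian Ricci form `ρ_θ(u, v) = (1/2) ∑_l g_θ(R(J e_l, e_l) u, v)` for horizontal
`u, v`, extended to a form on `M` by `T ⌟ ρ_θ = 0`. -/
def ricciForm : TwoTensor m M := fun x u v ↦
  (1 / 2 : ℝ) * ∑ l, S.g x
    (S.curvatureAt x (S.J x (S.frame x l)) (S.frame x l) (S.proj x u)) (S.proj x v)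

/-- The horizontal exterior differential of a `2`-form,
`(d^W β)(X, Y, Z) = dβ(X^H, Y^H, Z^H)`. -/
def dW (β : TwoTensor m M) (X Y Z : VField m M) (x : M) : ℝ :=
  extDerivTwo β (S.hpart X) (S.hpart Y) (S.hpart Z) x

/-- `d^W β = 0`. -/
def IsDWClosed (β : TwoTensor m M) : Prop :=
  ∀ (x : M) (X Y Z : VField m M), SmoothAt X x → SmoothAt Y x → SmoothAt Z x →
    S.dW β X Y Z x = 0

/-- `β` is a smooth horizontal `2`-form: bilinear, alternating, smooth, and `T ⌟ β = 0`. -/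
structure IsHorizontalTwoForm (β : TwoTensor m M) : Prop where
  add_left : ∀ x u u' v, β x (u + u') v = β x u v + β x u' v
  smul_left : ∀ x (c : ℝ) u v, β x (c • u) v = c * β x u v
  swap : ∀ x u v, β x u v = - β x v u
  smooth : ∀ (x : M) (X Y : VField m M), SmoothAt X x → SmoothAt Y x →
    ContMDiffAt (𝓡 (2 * m + 1)) 𝓘(ℝ) ∞ (fun y ↦ β y (X y) (Y y)) x
  T_contract : ∀ x v, β x (S.T x) v = 0

end PseudoHermitian

end CR

end

noncomputable section

open TopologicalSpace

namespace CR

/-! ### Algebra of vector fields: exterior derivatives, metric, dual frames -/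

section

/-! Let `ψ(X, Y) = ½ tr (R(X, Y) ∘ J)`, the trace being taken over `ker θ` (`traceForm`). The
Webster-Tanaka connection makes `g`, `J` and `T` parallel. Since `J` is parallel and traces commute
with covariant derivatives, `dψ` is a trace of the second Bianchi expression composed with `J`,
hence `dψ = 0` (`dTwo_traceForm`).

The first Bianchi identity relates `ρ` to `ψ`. On horizontal vectors its torsion terms cancel,
because `τ` is symmetric and `τ ∘ J` is trace-free, so `ρ = ψ` there (`ricciForm_eq_traceForm`).
With `T` in one slot it reads `R(T, X)Z - R(T, Z)X = (∇_Z τ)X - (∇_X τ)Z`. One trace of this gives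
`Ric(T) = div τ` (`ricci_T`); the same trace with `J` inserted gives `ψ(T, X) = g(J Ric(T), X)`
(`traceForm_T`). Therefore `ρ = ψ - θ ∧ (J Ric(T))^♭`. As `θ` vanishes on horizontal vectors, only
`dθ ∧ (J Ric(T))^♭` survives in the horizontal part of `dρ` (`dTwo_ricciForm`). For the converse
when `m ≥ 2`, wedging with `dθ` is injective on horizontal `1`-forms (`eq_zero_of_wedge_eq_zero`).

The computation is pure algebra, done for a module `L` of vector fields over a commutative ring `A`
of functions, with a frame of `ker θ` and its dual frame. Dual frames replace orthonormal ones, so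
that inverting a Gram matrix suffices. The manifold enters in two ways: such frames exist near each
point (`exists_localFrame`), and the pointwise definitions agree with the algebraic ones. The latter
use extensions `ext` and orthonormal bases chosen point by point with no regularity; this is
harmless because linear operations depend only on values at the point (`apply_congr`) and traces do
not depend on the frame (`frame_sum`). -/

/-- The algebraic structure of the vector fields `L` over the functions `A`: vector fields act on
functions by derivations, and they carry a Lie bracket satisfying the Leibniz rule. -/
structure VectorFieldAlgebra (A L : Type*) [CommRing A] [AddCommGroup L] [Module A L] where
  half : A
  half_add_half : half + half = 1
  D : L →ₗ[A] Derivation ℤ A A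
  br : L →+ L →+ L
  br_swap : ∀ X Y, br X Y = - br Y X
  br_smul : ∀ (a : A) X Y, br X (a • Y) = a • br X Y + D X a • Y
  jacobi : ∀ X Y Z, br X (br Y Z) = br (br X Y) Z + br Y (br X Z)
  D_br : ∀ X Y a, D (br X Y) a = D X (D Y a) - D Y (D X a)

/-- The action on functions is a Lie algebra morphism: this follows from the Jacobi identity as soon
as there is a nowhere vanishing vector field. -/
lemma derivation_bracket_of_jacobi {A L : Type*} [CommRing A] [AddCommGroup L] [Module A L]
    (D : L →ₗ[A] Derivation ℤ A A) (br : L →+ L →+ L)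
    (br_smul : ∀ (a : A) X Y, br X (a • Y) = a • br X Y + D X a • Y)
    (jacobi : ∀ X Y Z, br X (br Y Z) = br (br X Y) Z + br Y (br X Z))
    (θ : L →ₗ[A] A) (T : L) (hT : θ T = 1) (X Y : L) (a : A) :
    D (br X Y) a = D X (D Y a) - D Y (D X a) := by
  -- The Leibniz terms of Jacobi at `a • T` leave the commutator of derivations as a coefficient of
  -- `T`, which `θ` then reads off.
  have h := jacobi X Y (a • T)
  have h0 := jacobi X Y T
  simp only [br_smul, map_add] at h
  have h1 : D (br X Y) a • T = (D X (D Y a) - D Y (D X a)) • T := by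
    linear_combination (norm := module) a • h0 - h
  simpa [hT] using congrArg θ h1

namespace VectorFieldAlgebra

variable {A L : Type*} [CommRing A] [AddCommGroup L] [Module A L] (V : VectorFieldAlgebra A L)

lemma br_smul_left (a : A) (X Y : L) : V.br (a • X) Y = a • V.br X Y - V.D Y a • X := by
  rw [V.br_swap, V.br_smul, V.br_swap Y X]
  module

/-- `half` is an abstract element of `A`, not a real constant, so this comes from differentiating
`half + half = 1` and dividing by two. -/
lemma D_half (X : L) : V.D X V.half = 0 := by
  have h : V.D X (V.half + V.half) = 0 := by rw [V.half_add_half]; simp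
  rw [map_add] at h
  linear_combination V.half * h - V.D X V.half * V.half_add_half

/-- The exterior differential of a `1`-form. -/
def dOne (α : L →ₗ[A] A) : L →ₗ[A] L →ₗ[A] A :=
  LinearMap.mk₂ A (fun X Y ↦ V.D X (α Y) - V.D Y (α X) - α (V.br X Y))
    (fun X X' Y ↦ by simp; ring)
    (fun a X Y ↦ by simp [br_smul_left]; ring)
    (fun X Y Y' ↦ by simp; ring)
    (fun a X Y ↦ by simp [br_smul]; ring)

lemma dOne_apply (α : L →ₗ[A] A) (X Y : L) :
    V.dOne α X Y = V.D X (α Y) - V.D Y (α X) - α (V.br X Y) := rfl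

lemma dOne_swap (α : L →ₗ[A] A) (X Y : L) : V.dOne α X Y = - V.dOne α Y X := by
  simp only [dOne_apply, V.br_swap Y X, map_neg]
  ring

/-- The exterior differential of a `2`-form. -/
def dTwo (β : L → L → A) (X Y Z : L) : A :=
  V.D X (β Y Z) - V.D Y (β X Z) + V.D Z (β X Y) - β (V.br X Y) Z + β (V.br X Z) Y - β (V.br Y Z) X

/-- `d ∘ d = 0`: `D_br` cancels the second derivatives, and what remains is `α` of the Jacobi
identity. -/
lemma dTwo_dOne (α : L →ₗ[A] A) (X Y Z : L) : V.dTwo (fun X Y ↦ V.dOne α X Y) X Y Z = 0 := by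
  have h := congrArg α (V.jacobi X Y Z)
  rw [V.br_swap (V.br X Y) Z, V.br_swap Y (V.br X Z)] at h
  simp only [map_add, map_neg] at h
  simp only [dTwo, dOne_apply, map_sub, V.D_br, V.br_swap (V.br X Y) Z, V.br_swap (V.br X Z) Y,
    V.br_swap (V.br Y Z) X, map_neg]
  rw [V.br_swap Y (V.br X Z)] at *
  simp only [map_neg] at *
  linear_combination -h

/-- The interior product with `T` of a wedge product `θ ∧ α` enters `d(θ ∧ α)` on `ker θ` only
through `dθ ∧ α`. -/
lemma dTwo_wedge (θ α : L →ₗ[A] A) {X Y Z : L} (hX : θ X = 0) (hY : θ Y = 0) (hZ : θ Z = 0) :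
    V.dTwo (fun X Y ↦ θ X * α Y - θ Y * α X) X Y Z =
      α X * V.dOne θ Y Z - α Y * V.dOne θ X Z + α Z * V.dOne θ X Y := by
  simp only [dTwo, dOne_apply, hX, hY, hZ, zero_mul, sub_zero, map_zero]
  ring

end VectorFieldAlgebra

/-- The algebraic structure of the smooth vector fields on an open subset of a pseudo-Hermitian
manifold: `J` is the complex structure of `ker θ`, extended by `J T = 0`, and `e`, `f` are a frame
of `ker θ` and its dual frame. -/
structure PseudoHermitianAlgebra (A L : Type*) [CommRing A] [AddCommGroup L] [Module A L]
    (ι : Type*) [Fintype ι] [DecidableEq ι] extends VectorFieldAlgebra A L where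
  θ : L →ₗ[A] A
  T : L
  J : L →ₗ[A] L
  θ_T : θ T = 1
  θ_J : ∀ X, θ (J X) = 0
  J_T : J T = 0
  J_J : ∀ X, J (J X) = θ X • T - X
  dθ_T : ∀ X, toVectorFieldAlgebra.dOne θ T X = 0
  dθ_J_J : ∀ X Y, toVectorFieldAlgebra.dOne θ (J X) (J Y) = toVectorFieldAlgebra.dOne θ X Y
  integrable : ∀ X Y, θ X = 0 → θ Y = 0 →
    br X Y - br (J X) (J Y) + J (br (J X) Y + br X (J Y)) = 0
  e : ι → L
  f : ι → L
  θ_e : ∀ i, θ (e i) = 0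
  θ_f : ∀ i, θ (f i) = 0
  -- This is `g (e i) (f k) = δ`, and the next field expands the horizontal part in the frame; both
  -- are written out because `g` and `P` are defined from this structure.
  dual : ∀ i k, half * toVectorFieldAlgebra.dOne θ (e i) (J (f k)) = if i = k then 1 else 0
  expand : ∀ X, X - θ X • T = ∑ i, (half * toVectorFieldAlgebra.dOne θ X (J (f i))) • e i

namespace PseudoHermitianAlgebra

variable {A L : Type*} [CommRing A] [AddCommGroup L] [Module A L] {ι : Type*} [Fintype ι]
  [DecidableEq ι] (S : PseudoHermitianAlgebra A L ι)

/-- The differential of the contact form. -/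
def dθ : L →ₗ[A] L →ₗ[A] A := S.dOne S.θ

lemma dθ_apply (X Y : L) : S.dθ X Y = S.D X (S.θ Y) - S.D Y (S.θ X) - S.θ (S.br X Y) := rfl

lemma dθ_swap (X Y : L) : S.dθ X Y = - S.dθ Y X := S.dOne_swap _ _ _

@[simp] lemma dθ_T_left (X : L) : S.dθ S.T X = 0 := S.dθ_T X

@[simp] lemma dθ_T_right (X : L) : S.dθ X S.T = 0 := by rw [dθ_swap]; simp

lemma dθ_JJ (X Y : L) : S.dθ (S.J X) (S.J Y) = S.dθ X Y := S.dθ_J_J X Y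

/-- The metric `g_θ`, extended by zero on `T`. -/
def g : L →ₗ[A] L →ₗ[A] A := S.half • (S.dθ.compl₂ S.J)

lemma g_apply (X Y : L) : S.g X Y = S.half * S.dθ X (S.J Y) := by simp [g]

@[simp] lemma g_T_left (X : L) : S.g S.T X = 0 := by simp [g_apply]

@[simp] lemma g_T_right (X : L) : S.g X S.T = 0 := by simp [g_apply, S.J_T]

/-- Invariance of `dθ` under `J`, together with `J² = -1` on `ker θ`, turns skewness of `dθ` into
symmetry of `g`. -/
lemma g_symm (X Y : L) : S.g X Y = S.g Y X := by
  rw [g_apply, g_apply, ← S.dθ_JJ X, S.J_J, dθ_swap]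
  simp

lemma g_J_left (X Y : L) : S.g (S.J X) Y = - S.g X (S.J Y) := by
  rw [g_apply, g_apply, S.dθ_JJ, S.J_J]
  simp

lemma g_J_J (X Y : L) : S.g (S.J X) (S.J Y) = S.g X Y := by
  rw [g_J_left, S.J_J]; simp

lemma dθ_eq (X Y : L) : S.dθ X Y = S.g (S.J X) Y + S.g (S.J X) Y := by
  rw [g_apply, S.dθ_JJ]
  linear_combination -S.dθ X Y * S.half_add_half

/-- The projection to `ker θ` along `T`. -/
def P : L →ₗ[A] L := LinearMap.id - S.θ.smulRight S.T

lemma P_apply (X : L) : S.P X = X - S.θ X • S.T := rfl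

@[simp] lemma θ_P (X : L) : S.θ (S.P X) = 0 := by simp [P_apply, S.θ_T]

lemma P_of_hor {X : L} (hX : S.θ X = 0) : S.P X = X := by simp [P_apply, hX]

@[simp] lemma P_T : S.P S.T = 0 := by simp [P_apply, S.θ_T]

@[simp] lemma J_P (X : L) : S.J (S.P X) = S.J X := by simp [P_apply, S.J_T]

@[simp] lemma P_J (X : L) : S.P (S.J X) = S.J X := S.P_of_hor (S.θ_J X)

@[simp] lemma P_P (X : L) : S.P (S.P X) = S.P X := S.P_of_hor (S.θ_P X)

@[simp] lemma g_P_left (X Y : L) : S.g (S.P X) Y = S.g X Y := by simp [P_apply]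

@[simp] lemma g_P_right (X Y : L) : S.g X (S.P Y) = S.g X Y := by simp [P_apply]

lemma J_J_hor {X : L} (hX : S.θ X = 0) : S.J (S.J X) = -X := by simp [S.J_J, hX]

lemma eq_P_add (X : L) : X = S.P X + S.θ X • S.T := by simp [P_apply]

lemma g_e_f (i k : ι) : S.g (S.e i) (S.f k) = if i = k then 1 else 0 := by
  rw [g_apply]
  exact S.dual i k

lemma P_expand (X : L) : S.P X = ∑ i, S.g X (S.f i) • S.e i := by
  simp only [g_apply]
  exact S.expand X

/-- Nondegeneracy of `g` over the ring `A`: positivity makes no sense there, and the frame expansion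
takes its place. Identities between vector fields are reduced to scalar ones through this lemma. -/
lemma hor_ext {X Y : L} (h : S.θ X = S.θ Y) (hg : ∀ Z, S.g X Z = S.g Y Z) : X = Y := by
  rw [S.eq_P_add X, S.eq_P_add Y, P_expand, P_expand, h]
  simp [hg]

lemma P_expand' (X : L) : S.P X = ∑ i, S.g X (S.e i) • S.f i := by
  refine S.hor_ext (by simp [S.θ_f]) fun Z ↦ ?_
  rw [g_P_left, ← S.g_P_right X Z, P_expand]
  simp only [map_sum, map_smul, LinearMap.sum_apply, LinearMap.smul_apply, smul_eq_mul]
  exact Finset.sum_congr rfl fun i _ ↦ by rw [S.g_symm Z]; ring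

lemma sum_g_mul (φ : L →ₗ[A] A) (X : L) : ∑ i, S.g X (S.f i) * φ (S.e i) = φ (S.P X) := by
  simp [P_expand]

lemma sum_g_mul' (φ : L →ₗ[A] A) (X : L) : ∑ i, S.g X (S.e i) * φ (S.f i) = φ (S.P X) := by
  simp [P_expand']

/-- The two frames may be exchanged in a trace. -/
lemma sum_swap (B : L →ₗ[A] L →ₗ[A] A) : ∑ i, B (S.f i) (S.e i) = ∑ i, B (S.e i) (S.f i) := by
  have h1 (i) : B (S.e i) (S.f i) = ∑ k, S.g (S.f i) (S.f k) * B (S.e i) (S.e k) := by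
    rw [S.sum_g_mul (B (S.e i)), S.P_of_hor (S.θ_f i)]
  have h2 (i) : B (S.f i) (S.e i) = ∑ k, S.g (S.f i) (S.f k) * B (S.e k) (S.e i) := by
    have := S.sum_g_mul (B.flip (S.e i)) (S.f i)
    rw [S.P_of_hor (S.θ_f i)] at this
    exact this.symm
  simp only [h1, h2]
  rw [Finset.sum_comm]
  exact Finset.sum_congr rfl fun i _ ↦ Finset.sum_congr rfl fun k _ ↦ by rw [S.g_symm]

/-- `J` may be moved from one frame to the other in a trace. -/
lemma sum_J (B : L →ₗ[A] L →ₗ[A] A) :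
    ∑ i, B (S.J (S.e i)) (S.f i) = - ∑ i, B (S.e i) (S.J (S.f i)) := by
  have h1 (i) : B (S.J (S.e i)) (S.f i) = ∑ k, S.g (S.J (S.e i)) (S.f k) * B (S.e k) (S.f i) := by
    have := S.sum_g_mul (B.flip (S.f i)) (S.J (S.e i))
    rw [P_J] at this
    exact this.symm
  have h2 (i) : B (S.e i) (S.J (S.f i)) = ∑ k, S.g (S.J (S.f i)) (S.e k) * B (S.e i) (S.f k) := by
    rw [S.sum_g_mul' (B (S.e i)), P_J]
  simp only [h1, h2]
  rw [Finset.sum_comm, ← Finset.sum_neg_distrib]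
  refine Finset.sum_congr rfl fun i _ ↦ ?_
  rw [← Finset.sum_neg_distrib]
  exact Finset.sum_congr rfl fun k _ ↦ by rw [S.g_J_left, S.g_symm]; ring

end PseudoHermitianAlgebra

end

/-! ### The Webster-Tanaka connection and the derivative along `T` -/

section
namespace PseudoHermitianAlgebra

variable {A L : Type*} [CommRing A] [AddCommGroup L] [Module A L] {ι : Type*} [Fintype ι]
  [DecidableEq ι] (S : PseudoHermitianAlgebra A L ι)

lemma half_mul_add (a : A) : S.half * (a + a) = a := by
  linear_combination a * S.half_add_half

lemma eq_of_add_self (S : PseudoHermitianAlgebra A L ι) {a b : A} (h : a + a = b + b) : a = b := by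
  rw [← S.half_mul_add a, h, S.half_mul_add]

lemma half_smul_add (X : L) : S.half • (X + X) = X := by
  rw [smul_add, ← add_smul, S.half_add_half, one_smul]

/-- The bracket with `T` preserves `ker θ`. -/
lemma θ_br_T {X : L} (hX : S.θ X = 0) : S.θ (S.br S.T X) = 0 := by
  have := S.dθ_T_left X
  simpa [dθ_apply, hX, S.θ_T] using this

lemma dθ_hor {X Y : L} (hX : S.θ X = 0) (hY : S.θ Y = 0) : S.dθ X Y = - S.θ (S.br X Y) := by
  simp [dθ_apply, hX, hY]

/-- The right-hand side of the Koszul formula. -/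
def koszul (X Y Z : L) : A :=
  S.D X (S.g Y Z) + S.D Y (S.g X Z) - S.D Z (S.g X Y) + S.g (S.br X Y) Z - S.g (S.br X Z) Y
    - S.g (S.br Y Z) X

lemma koszul_add_left (X X' Y Z : L) :
    S.koszul (X + X') Y Z = S.koszul X Y Z + S.koszul X' Y Z := by
  simp [koszul]; ring

lemma koszul_smul_left (a : A) (X Y Z : L) : S.koszul (a • X) Y Z = a * S.koszul X Y Z := by
  simp [koszul, S.br_smul_left]; ring

lemma koszul_add_mid (X Y Y' Z : L) :
    S.koszul X (Y + Y') Z = S.koszul X Y Z + S.koszul X Y' Z := by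
  simp [koszul]; ring

lemma koszul_smul_mid (a : A) (X Y Z : L) :
    S.koszul X (a • Y) Z = a * S.koszul X Y Z + (S.D X a * S.g Y Z + S.D X a * S.g Y Z) := by
  simp [koszul, S.br_smul_left, S.br_smul, S.g_symm Y X]; ring

/-- The Koszul formula is linear in its last argument. -/
def koszulHom (X Y : L) : L →ₗ[A] A where
  toFun Z := S.koszul X Y Z
  map_add' Z Z' := by simp [koszul]; ring
  map_smul' a Z := by simp [koszul, S.br_smul, S.g_symm Z Y, S.g_symm Z X]; ring

lemma koszulHom_apply (X Y Z : L) : S.koszulHom X Y Z = S.koszul X Y Z := rfl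

/-- The horizontal part `∇_{X^H} Y^H` of the connection. -/
def nablaH (X Y : L) : L := ∑ i, (S.half * S.koszul (S.P X) (S.P Y) (S.f i)) • S.e i

lemma θ_nablaH (X Y : L) : S.θ (S.nablaH X Y) = 0 := by simp [nablaH, S.θ_e]

/-- The definition imposes the Koszul formula on the dual frame only; linearity of `koszul` in its
last argument extends it to every `Z`. -/
lemma g_nablaH (X Y Z : L) :
    S.g (S.nablaH X Y) Z = S.half * S.koszul (S.P X) (S.P Y) (S.P Z) := by
  rw [← koszulHom_apply, S.P_expand' Z]
  simp only [nablaH, map_sum, map_smul, LinearMap.sum_apply, LinearMap.smul_apply, smul_eq_mul,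
    Finset.mul_sum, koszulHom_apply]
  exact Finset.sum_congr rfl fun i _ ↦ by rw [S.g_symm Z]; ring

/-- The derivative `∇_T Y^H`. -/
def nablaT (Y : L) : L := S.half • (S.br S.T (S.P Y) - S.J (S.br S.T (S.J Y)))

lemma θ_nablaT (Y : L) : S.θ (S.nablaT Y) = 0 := by
  simp [nablaT, S.θ_J, S.θ_br_T]

lemma nablaT_add (Y Y' : L) : S.nablaT (Y + Y') = S.nablaT Y + S.nablaT Y' := by
  simp [nablaT]; module

lemma nablaT_smul (a : A) (Y : L) :
    S.nablaT (a • Y) = a • S.nablaT Y + S.D S.T a • S.P Y := by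
  simp only [nablaT, map_smul, S.br_smul, map_add, S.J_J, P_apply]
  linear_combination (norm := module) S.half_smul_add (S.D S.T a • (Y - S.θ Y • S.T))

/-- The Webster-Tanaka connection. -/
def nabla : L →ₗ[A] L →+ L where
  toFun X :=
    { toFun := fun Y ↦ S.nablaH X Y + S.θ X • S.nablaT Y + S.D X (S.θ Y) • S.T
      map_zero' := by simp [nablaH, nablaT, koszul]
      map_add' := fun Y Y' ↦ by
        simp [nablaH, koszul_add_mid, nablaT_add, mul_add, add_smul, Finset.sum_add_distrib]
        module }
  map_add' X X' := by
    ext Y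
    simp [nablaH, koszul_add_left, mul_add, add_smul, Finset.sum_add_distrib]
    module
  map_smul' a X := by
    ext Y
    simp [nablaH, koszul_smul_left, smul_smul, Finset.smul_sum, mul_left_comm]

lemma nabla_apply (X Y : L) :
    S.nabla X Y = S.nablaH X Y + S.θ X • S.nablaT Y + S.D X (S.θ Y) • S.T := rfl

lemma θ_nabla (X Y : L) : S.θ (S.nabla X Y) = S.D X (S.θ Y) := by
  simp [nabla_apply, θ_nablaH, θ_nablaT, S.θ_T]

lemma θ_nabla_hor (X : L) {Y : L} (hY : S.θ Y = 0) : S.θ (S.nabla X Y) = 0 := by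
  rw [θ_nabla, hY, map_zero]

lemma g_nabla (X Y Z : L) : S.g (S.nabla X Y) Z =
    S.half * S.koszul (S.P X) (S.P Y) (S.P Z) + S.θ X * S.g (S.nablaT Y) Z := by
  simp [nabla_apply, g_nablaH]

@[simp] lemma nabla_T_right (X : L) : S.nabla X S.T = 0 := by
  simp [nabla_apply, nablaH, nablaT, koszul, S.J_T, S.θ_T]

lemma nabla_smul (X : L) (a : A) (Y : L) :
    S.nabla X (a • Y) = a • S.nabla X Y + S.D X a • Y := by
  refine S.hor_ext ?_ fun Z ↦ ?_
  · simp [θ_nabla, mul_comm]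
  · simp only [g_nabla, map_smul, koszul_smul_mid, nablaT_smul, map_add, LinearMap.add_apply,
      LinearMap.smul_apply, smul_eq_mul, g_P_left, g_P_right]
    -- The Koszul part yields the derivative of `a` along `P X`, and `nablaT` yields the one along
    -- `T`; together they form the Leibniz term.
    have h : S.D X a = S.D (S.P X) a + S.θ X * S.D S.T a := by
      conv_lhs => rw [S.eq_P_add X]
      simp
    rw [h]
    linear_combination (S.D (S.P X) a * S.g Y Z) * S.half_add_half

lemma nabla_hor {X Y : L} (hX : S.θ X = 0) (hY : S.θ Y = 0) (Z : L) :
    S.g (S.nabla X Y) Z = S.half * S.koszul X Y (S.P Z) := by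
  rw [g_nabla, hX, S.P_of_hor hX, S.P_of_hor hY]; ring

lemma nabla_T_hor {Y : L} (hY : S.θ Y = 0) :
    S.nabla S.T Y = S.half • (S.br S.T Y - S.J (S.br S.T (S.J Y))) := by
  simp [nabla_apply, nablaH, koszul, S.θ_T, hY, nablaT, S.P_of_hor hY]

/-- On `ker θ`, `∇_T = ½ (L_T - J L_T J)` is the part of the Lie derivative `L_T` that commutes with
`J`. The component along `T` is killed by `J`, so `Y` may be arbitrary. -/
lemma nabla_T_J (Y : L) : S.nabla S.T (S.J Y) = S.J (S.nabla S.T Y) := by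
  have h : S.nabla S.T Y = S.nabla S.T (S.P Y) + S.D S.T (S.θ Y) • S.T := by
    conv_lhs => rw [S.eq_P_add Y]
    simp only [map_add, nabla_smul]; simp
  rw [h, S.nabla_T_hor (S.θ_J Y), S.nabla_T_hor (S.θ_P Y), S.J_J, J_P]
  simp only [map_add, map_smul, map_sub, S.J_T, S.J_J, S.br_smul, S.θ_br_T (S.θ_J Y), P_apply]
  simp
  module

/-- The flow of `T` preserves `dθ`. -/
lemma D_T_dθ (X Y : L) :
    S.D S.T (S.dθ X Y) = S.dθ (S.br S.T X) Y + S.dθ X (S.br S.T Y) := by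
  -- Cartan's formula for `L_T dθ`, from `d(dθ) = 0` and `T ⌟ dθ = 0`.
  have h := S.dTwo_dOne S.θ S.T X Y
  change S.D S.T (S.dθ X Y) - S.D X (S.dθ S.T Y) + S.D Y (S.dθ S.T X) - S.dθ (S.br S.T X) Y
    + S.dθ (S.br S.T Y) X - S.dθ (S.br X Y) S.T = 0 at h
  simp only [dθ_T_left, dθ_T_right, map_zero] at h
  rw [S.dθ_swap X (S.br S.T Y)]
  linear_combination h

lemma dθ_J_right (X Y : L) : S.dθ X (S.J Y) = - S.dθ (S.J X) Y := by
  rw [← S.dθ_JJ X, S.J_J, map_sub, map_smul]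
  simp

/-- `L_T` preserves `dθ`, and so does its conjugate `-J L_T J` because `dθ` is `J`-invariant; `∇_T`
is their average. -/
lemma nabla_T_dθ {X Y : L} (hX : S.θ X = 0) (hY : S.θ Y = 0) :
    S.D S.T (S.dθ X Y) = S.dθ (S.nabla S.T X) Y + S.dθ X (S.nabla S.T Y) := by
  have h1 := S.D_T_dθ X Y
  have h3 : S.dθ (S.J X) (S.br S.T (S.J Y)) = - S.dθ X (S.J (S.br S.T (S.J Y))) := by
    rw [dθ_J_right, neg_neg]
  have h2' : S.D S.T (S.dθ X Y) = - S.dθ (S.J (S.br S.T (S.J X))) Y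
      - S.dθ X (S.J (S.br S.T (S.J Y))) := by
    have h2 := S.D_T_dθ (S.J X) (S.J Y)
    rw [S.dθ_JJ, dθ_J_right, h3] at h2
    linear_combination h2
  rw [S.nabla_T_hor hX, S.nabla_T_hor hY]
  simp only [map_smul, map_sub, LinearMap.smul_apply, LinearMap.sub_apply, smul_eq_mul]
  linear_combination S.half * h1 + S.half * h2' - S.D S.T (S.dθ X Y) * S.half_add_half

end PseudoHermitianAlgebra

end

/-! ### Parallel tensors, torsion and the Bianchi identities -/

section
namespace PseudoHermitianAlgebra

variable {A L : Type*} [CommRing A] [AddCommGroup L] [Module A L] {ι : Type*} [Fintype ι]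
  [DecidableEq ι] (S : PseudoHermitianAlgebra A L ι)

/-- Polarization of the compatibility of a connection and a metric along `ker θ`. -/
lemma koszul_add_swap (X Y Z : L) :
    S.koszul X Y Z + S.koszul X Z Y = S.D X (S.g Y Z) + S.D X (S.g Y Z) := by
  simp only [koszul, S.br_swap Z Y, map_neg, LinearMap.neg_apply, S.g_symm Z Y]
  ring

lemma nabla_P_right (X Y : L) : S.nabla X (S.P Y) = S.P (S.nabla X Y) := by
  refine S.hor_ext ?_ fun Z ↦ ?_
  · simp [θ_nabla]
  · simp [P_apply, nabla_smul]

lemma nabla_split (X Y : L) :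
    S.nabla X Y = S.nabla (S.P X) Y + S.θ X • S.nabla S.T Y := by
  conv_lhs => rw [S.eq_P_add X]
  simp

lemma D_split (X : L) (a : A) : S.D X a = S.D (S.P X) a + S.θ X * S.D S.T a := by
  conv_lhs => rw [S.eq_P_add X]
  simp

lemma nabla_T_g {Y Z : L} (hY : S.θ Y = 0) :
    S.D S.T (S.g Y Z) = S.g (S.nabla S.T Y) Z + S.g Y (S.nabla S.T Z) := by
  simp only [g_apply]
  rw [Derivation.leibniz, S.D_half, S.nabla_T_dθ hY (S.θ_J Z), nabla_T_J]
  simp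
  ring

/-- The metric is parallel. -/
lemma D_g (X Y Z : L) : S.D X (S.g Y Z) = S.g (S.nabla X Y) Z + S.g Y (S.nabla X Z) := by
  have hT : S.D S.T (S.g Y Z) = S.g (S.nabla S.T Y) Z + S.g Y (S.nabla S.T Z) := by
    have := S.nabla_T_g (Z := S.P Z) (S.θ_P Y)
    simpa only [nabla_P_right, g_P_left, g_P_right] using this
  have hP : S.D (S.P X) (S.g Y Z) = S.g (S.nabla (S.P X) Y) Z + S.g Y (S.nabla (S.P X) Z) := by
    have h := S.koszul_add_swap (S.P X) (S.P Y) (S.P Z)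
    rw [S.g_symm Y (S.nabla _ _), g_nabla, g_nabla, θ_P, P_P]
    simp only [g_P_left, g_P_right] at h
    linear_combination -S.half * h - S.D (S.P X) (S.g Y Z) * S.half_add_half
  rw [S.D_split, S.nabla_split X Y, S.nabla_split X Z, hT, hP]
  simp
  ring

/-- `J` is parallel along `ker θ`: this is where integrability enters. -/
lemma nabla_J_hor {X Y : L} (hX : S.θ X = 0) (hY : S.θ Y = 0) :
    S.nabla X (S.J Y) = S.J (S.nabla X Y) := by
  refine S.hor_ext (by simp [θ_nabla, S.θ_J]) fun Z ↦ ?_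
  rw [S.g_J_left, S.nabla_hor hX (S.θ_J Y), S.nabla_hor hX hY, P_J, ← S.J_P Z]
  generalize hW : S.P Z = W
  have hW : S.θ W = 0 := by rw [← hW, θ_P]
  have hd (X Y : L) : S.dθ X Y = - (S.g X (S.J Y) + S.g X (S.J Y)) := by
    rw [S.dθ_eq, S.g_J_left]; ring
  -- Closedness of `dθ`, expressed through the fundamental form `g(·, J ·)`, which is `-½ dθ`.
  have c (X Y Z : L) : S.D X (S.g Y (S.J Z)) - S.D Y (S.g X (S.J Z)) + S.D Z (S.g X (S.J Y))
      - S.g (S.br X Y) (S.J Z) + S.g (S.br X Z) (S.J Y) - S.g (S.br Y Z) (S.J X) = 0 := by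
    have h := S.dTwo_dOne S.θ X Y Z
    change S.D X (S.dθ Y Z) - S.D Y (S.dθ X Z) + S.D Z (S.dθ X Y) - S.dθ (S.br X Y) Z
      + S.dθ (S.br X Z) Y - S.dθ (S.br Y Z) X = 0 at h
    simp only [hd, map_neg, map_add] at h
    apply S.eq_of_add_self
    linear_combination -h
  -- As in Kähler geometry, `g((∇_X J)Y, W)` is a combination of the differential of the fundamental
  -- form at `(X, Y, W)` and at `(X, JY, JW)` and of the Nijenhuis tensor of `(Y, W)` paired with
  -- `JX`. All three vanish.
  have c1 := c X Y W
  have c2 := c X (S.J Y) (S.J W)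
  have hN := congrArg (fun V ↦ S.g V (S.J X)) (S.integrable Y W hY hW)
  simp only [map_add, map_sub, LinearMap.add_apply, LinearMap.sub_apply, S.g_J_left, S.J_J_hor hX,
    S.J_J_hor hY, S.J_J_hor hW, map_neg, map_zero, LinearMap.zero_apply] at hN c2
  simp only [koszul]
  have e1 := S.g_J_left Y W
  rw [e1]
  simp only [map_neg]
  linear_combination S.half * (c2 - c1 - hN)

/-- `J` is parallel. -/
lemma nabla_J (X Y : L) : S.nabla X (S.J Y) = S.J (S.nabla X Y) := by
  have h := S.nabla_J_hor (S.θ_P X) (S.θ_P Y)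
  rw [J_P, nabla_P_right, J_P] at h
  rw [S.nabla_split, S.nabla_split X Y, nabla_T_J, h]
  simp

/-- The Webster torsion. -/
def tau : L →ₗ[A] L where
  toFun X := S.nabla S.T (S.P X) - S.br S.T (S.P X)
  map_add' X Y := by simp; abel
  map_smul' a X := by simp only [map_smul, nabla_smul, S.br_smul, RingHom.id_apply]; module

lemma tau_apply (X : L) : S.tau X = S.nabla S.T (S.P X) - S.br S.T (S.P X) := rfl

lemma tau_hor {X : L} (hX : S.θ X = 0) : S.tau X = S.nabla S.T X - S.br S.T X := by
  rw [tau_apply, S.P_of_hor hX]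

@[simp] lemma θ_tau (X : L) : S.θ (S.tau X) = 0 := by
  simp [tau_apply, θ_nabla, S.θ_br_T]

@[simp] lemma tau_P (X : L) : S.tau (S.P X) = S.tau X := by simp [tau_apply]

@[simp] lemma tau_T : S.tau S.T = 0 := by simp [tau_apply]

/-- On `ker θ`, `τ = ∇_T - L_T` is minus the part of `L_T` that anticommutes with `J`. -/
lemma tau_J (X : L) : S.tau (S.J X) = - S.J (S.tau X) := by
  have h : ∀ {X}, S.θ X = 0 → S.tau (S.J X) = - S.J (S.tau X) := by
    intro X hX
    rw [S.tau_hor hX, S.tau_hor (S.θ_J X), map_sub, ← S.nabla_T_J, S.nabla_T_hor (S.θ_J X),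
      S.J_J_hor hX]
    simp only [map_neg]
    have := S.half_smul_add (S.br S.T (S.J X) + S.J (S.br S.T X))
    linear_combination (norm := module) this
  simpa using h (S.θ_P X)

/-- Both `∇_T` and `L_T` preserve `dθ`, so their difference `τ` is skew for `dθ`; anticommutation
with `J` turns this into symmetry for `g`. -/
lemma g_tau (X Y : L) : S.g (S.tau X) Y = S.g X (S.tau Y) := by
  have h : ∀ {X Y}, S.θ X = 0 → S.θ Y = 0 → S.dθ (S.tau X) Y = - S.dθ X (S.tau Y) := by
    intro X Y hX hY
    rw [S.tau_hor hX, S.tau_hor hY]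
    simp only [map_sub, LinearMap.sub_apply]
    linear_combination S.D_T_dθ X Y - S.nabla_T_dθ hX hY
  have h1 := h (S.θ_P X) (S.θ_J Y)
  rw [tau_P, tau_J, map_neg, neg_neg] at h1
  rw [g_apply, h1, g_apply]
  simp [P_apply]

lemma nabla_T_P (X : L) : S.nabla S.T (S.P X) = S.nablaT X := by
  rw [S.nabla_T_hor (S.θ_P X), nablaT, J_P]

lemma koszul_sub_swap (X Y Z : L) :
    S.koszul X Y Z - S.koszul Y X Z = S.g (S.br X Y) Z + S.g (S.br X Y) Z := by
  simp only [koszul, S.br_swap Y X, map_neg, LinearMap.neg_apply, S.g_symm Y X]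
  ring

/-- All Leibniz terms from differentiating the coefficients `θ X` and `θ Y` are multiples of `T`,
which `g` ignores. -/
lemma g_br_split (X Y Z : L) : S.g (S.br X Y) Z = S.g (S.br (S.P X) (S.P Y)) Z
    + S.θ X * S.g (S.br S.T (S.P Y)) Z - S.θ Y * S.g (S.br S.T (S.P X)) Z := by
  conv_lhs => rw [S.eq_P_add X, S.eq_P_add Y]
  simp only [map_add, AddMonoidHom.add_apply, S.br_smul, S.br_smul_left, S.br_swap (S.P X) S.T,
    map_sub, map_smul, LinearMap.add_apply, LinearMap.sub_apply, LinearMap.smul_apply,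
    smul_eq_mul, g_T_left, map_neg, LinearMap.neg_apply]
  ring_nf
  have : S.br S.T S.T = 0 := by
    rw [← S.half_smul_add (S.br S.T S.T)]
    nth_rw 1 [S.br_swap]
    simp
  simp [this]

/-- The torsion of the Webster-Tanaka connection. -/
lemma torsion (X Y : L) : S.nabla X Y - S.nabla Y X - S.br X Y =
    S.dθ X Y • S.T + S.θ X • S.tau Y - S.θ Y • S.tau X := by
  refine S.hor_ext ?_ fun Z ↦ ?_
  · simp [θ_nabla, dθ_apply, S.θ_T]
  · have h := S.koszul_sub_swap (S.P X) (S.P Y) (S.P Z)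
    rw [g_P_right] at h
    simp only [map_sub, LinearMap.sub_apply, map_add, LinearMap.add_apply, map_smul,
      LinearMap.smul_apply, smul_eq_mul, g_T_left, g_nabla, S.g_br_split X Y, tau_apply,
      nabla_T_P]
    linear_combination S.half * h + S.g (S.br (S.P X) (S.P Y)) Z * S.half_add_half

lemma nabla_sub_swap (X Y : L) : S.nabla X Y - S.nabla Y X = S.br X Y +
    S.dθ X Y • S.T + S.θ X • S.tau Y - S.θ Y • S.tau X := by
  linear_combination (norm := module) S.torsion X Y

/-- The covariant derivative of the torsion. -/
def nablaTau : L →ₗ[A] L →ₗ[A] L :=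
  LinearMap.mk₂ A (fun X Y ↦ S.nabla X (S.tau Y) - S.tau (S.nabla X Y))
    (fun X X' Y ↦ by simp; abel)
    (fun a X Y ↦ by simp; module)
    (fun X Y Y' ↦ by simp; abel)
    (fun a X Y ↦ by simp [nabla_smul]; module)

lemma nablaTau_apply (X Y : L) :
    S.nablaTau X Y = S.nabla X (S.tau Y) - S.tau (S.nabla X Y) := rfl

lemma θ_nablaTau (X Y : L) : S.θ (S.nablaTau X Y) = 0 := by simp [nablaTau_apply, θ_nabla]

lemma nablaTau_J (X Y : L) : S.nablaTau X (S.J Y) = - S.J (S.nablaTau X Y) := by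
  simp only [nablaTau_apply, tau_J, nabla_J, map_neg, map_sub]
  abel

lemma g_nablaTau (X Y Z : L) : S.g (S.nablaTau X Y) Z = S.g Y (S.nablaTau X Z) := by
  have h := S.D_g X (S.tau Y) Z
  rw [g_tau, D_g, ← g_tau] at h
  simp only [nablaTau_apply, map_sub, LinearMap.sub_apply]
  rw [← S.g_tau Y (S.nabla X Z)]
  linear_combination -h

/-- The curvature of the Webster-Tanaka connection. -/
def curvature : L →ₗ[A] L →ₗ[A] L →ₗ[A] L :=
  LinearMap.mk₂ A
    (fun X Y ↦
      { toFun := fun Z ↦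
          S.nabla X (S.nabla Y Z) - S.nabla Y (S.nabla X Z) - S.nabla (S.br X Y) Z
        map_add' := fun Z Z' ↦ by simp; abel
        map_smul' := fun a Z ↦ by
          simp only [nabla_smul, map_add, S.D_br, RingHom.id_apply]
          module })
    (fun X X' Y ↦ by ext; simp; abel)
    (fun a X Y ↦ by ext; simp [S.br_smul_left, nabla_smul]; module)
    (fun X Y Y' ↦ by ext; simp; abel)
    (fun a X Y ↦ by ext; simp [S.br_smul, nabla_smul]; module)

lemma curvature_apply (X Y Z : L) : S.curvature X Y Z =
    S.nabla X (S.nabla Y Z) - S.nabla Y (S.nabla X Z) - S.nabla (S.br X Y) Z := rfl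

lemma curvature_swap (X Y Z : L) : S.curvature X Y Z = - S.curvature Y X Z := by
  simp only [curvature_apply, S.br_swap Y X, map_neg, AddMonoidHom.neg_apply]
  abel

lemma θ_curvature (X Y Z : L) : S.θ (S.curvature X Y Z) = 0 := by
  simp [curvature_apply, θ_nabla, S.D_br]

@[simp] lemma curvature_T (X Y : L) : S.curvature X Y S.T = 0 := by
  simp [curvature_apply]

lemma curvature_J (X Y Z : L) : S.curvature X Y (S.J Z) = S.J (S.curvature X Y Z) := by
  simp [curvature_apply, nabla_J]

/-- Differentiate `g Z W` twice: since `g` is parallel, the commutator of derivatives is the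
derivative along the bracket plus the two curvature terms. -/
lemma g_curvature (X Y Z W : L) :
    S.g (S.curvature X Y Z) W = - S.g Z (S.curvature X Y W) := by
  have h := S.D_br X Y (S.g Z W)
  simp only [D_g, map_add] at h
  simp only [curvature_apply, map_sub, LinearMap.sub_apply]
  linear_combination -h

/-- The torsion tensor. -/
def tor (X Y : L) : L := S.dθ X Y • S.T + S.θ X • S.tau Y - S.θ Y • S.tau X

/-- The first Bianchi identity. -/
lemma bianchi (X Y Z : L) :
    S.curvature X Y Z + S.curvature Y Z X + S.curvature Z X Y =
      S.nabla X (S.tor Y Z) + S.nabla Y (S.tor Z X) + S.nabla Z (S.tor X Y)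
      + S.tor X (S.br Y Z) + S.tor Y (S.br Z X) + S.tor Z (S.br X Y) := by
  -- With the torsion replaced by its definition through `∇` and brackets, all covariant derivatives
  -- cancel and only the Jacobi identity is left.
  have hQ (X Y) : S.tor X Y = S.nabla X Y - S.nabla Y X - S.br X Y := by rw [S.torsion, tor]
  have hj := S.jacobi X Y Z
  rw [S.br_swap (S.br X Y) Z, S.br_swap X Z, map_neg] at hj
  simp only [hQ, curvature_apply, map_sub]
  linear_combination (norm := module) hj

/-- The second Bianchi identity. -/
lemma bianchi_two (X Y Z W : L) :
    (S.nabla X (S.curvature Y Z W) - S.curvature Y Z (S.nabla X W))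
      - (S.nabla Y (S.curvature X Z W) - S.curvature X Z (S.nabla Y W))
      + (S.nabla Z (S.curvature X Y W) - S.curvature X Y (S.nabla Z W))
      - S.curvature (S.br X Y) Z W + S.curvature (S.br X Z) Y W - S.curvature (S.br Y Z) X W
      = 0 := by
  -- In this form, with brackets of the fields rather than a covariant derivative of the tensor `R`,
  -- no torsion appears: second covariant derivatives cancel, leaving Jacobi in the direction of
  -- differentiation.
  have hj := congrArg (fun V ↦ S.nabla V W) (S.jacobi X Y Z)
  rw [S.br_swap X (S.br Y Z), S.br_swap Y (S.br X Z)] at hj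
  simp only [map_add, map_neg, AddMonoidHom.add_apply, AddMonoidHom.neg_apply] at hj
  simp only [curvature_apply, map_sub]
  linear_combination (norm := module) -hj

end PseudoHermitianAlgebra

end

/-! ### Traces of the curvature and the formula for the Ricci form -/

section
namespace PseudoHermitianAlgebra

variable {A L : Type*} [CommRing A] [AddCommGroup L] [Module A L] {ι : Type*} [Fintype ι]
  [DecidableEq ι] (S : PseudoHermitianAlgebra A L ι)

/-- For horizontal arguments the torsion is `dθ(Y, Z) T`, whose covariant derivatives are multiples
of `T` and hence invisible to `g`. The right-hand side comes from the vertical parts of the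
brackets, since `θ [Y, Z] = -dθ(Y, Z)`. -/
lemma bianchi_hor {X Y Z : L} (hX : S.θ X = 0) (hY : S.θ Y = 0) (hZ : S.θ Z = 0) (W : L) :
    S.g (S.curvature X Y Z) W + S.g (S.curvature Y Z X) W + S.g (S.curvature Z X Y) W =
      S.dθ Y Z * S.g (S.tau X) W + S.dθ Z X * S.g (S.tau Y) W + S.dθ X Y * S.g (S.tau Z) W := by
  have h := congrArg (fun V ↦ S.g V W) (S.bianchi X Y Z)
  simp only [tor, hX, hY, hZ, nabla_smul, nabla_T_right, map_add, map_sub, map_smul,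
    LinearMap.add_apply, LinearMap.sub_apply, LinearMap.smul_apply, g_T_left, zero_smul, map_zero,
    LinearMap.zero_apply, smul_eq_mul] at h
  rw [S.dθ_hor hY hZ, S.dθ_hor hZ hX, S.dθ_hor hX hY]
  linear_combination h

/-- Here `R(X, Z)T = 0` and `Tor(T, X) = τ X`. The difference `∇_X Z - ∇_Z X` is `[X, Z]` up to a
multiple of `T`, which `τ` kills, so the torsion terms assemble into `∇τ`. -/
lemma bianchi_T {X Z : L} (hX : S.θ X = 0) (hZ : S.θ Z = 0) :
    S.curvature S.T X Z - S.curvature S.T Z X = S.nablaTau Z X - S.nablaTau X Z := by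
  refine S.hor_ext (by simp [θ_curvature, θ_nablaTau]) fun W ↦ ?_
  have h := congrArg (fun V ↦ S.g V W) (S.bianchi S.T X Z)
  have h2 := congrArg (fun V ↦ S.g (S.tau V) W) (S.nabla_sub_swap X Z)
  rw [S.curvature_swap Z S.T X, S.br_swap Z S.T] at h
  simp only [tor, hX, hZ, nabla_smul, nabla_T_right, map_add, map_sub, map_smul, map_neg,
    LinearMap.add_apply, LinearMap.sub_apply, LinearMap.smul_apply, g_T_left, zero_smul, map_zero,
    LinearMap.zero_apply, LinearMap.neg_apply, smul_eq_mul, S.θ_T, curvature_T, tau_T, one_smul,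
    smul_zero, nablaTau_apply,
    S.θ_br_T hX, S.θ_br_T hZ] at h h2 ⊢
  linear_combination h - h2

/-- An endomorphism anticommuting with `J` is trace-free. -/
lemma trace_eq_zero {φ : L →ₗ[A] L} (hφ : ∀ X, φ (S.J X) = - S.J (φ X)) :
    ∑ i, S.g (φ (S.e i)) (S.f i) = 0 := by
  have h := S.sum_J ((S.g ∘ₗ φ).compl₂ S.J)
  simp only [LinearMap.compl₂_apply, LinearMap.comp_apply, hφ, map_neg, LinearMap.neg_apply,
    g_J_J, S.J_J_hor (S.θ_f _), Finset.sum_neg_distrib, neg_neg] at h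
  apply S.eq_of_add_self
  linear_combination -h

/-- The trace commutes with covariant derivatives. -/
lemma D_trace (φ : L →ₗ[A] L) (X : L) : S.D X (∑ i, S.g (φ (S.e i)) (S.f i)) =
    ∑ i, S.g (S.nabla X (φ (S.e i)) - φ (S.nabla X (S.e i))) (S.f i) := by
  have h1 (i) : S.g (φ (S.e i)) (S.nabla X (S.f i)) =
      ∑ k, S.g (S.nabla X (S.f i)) (S.e k) * S.g (φ (S.e i)) (S.f k) := by
    rw [S.sum_g_mul' (S.g (φ (S.e i))), g_P_right]
  have h2 (i) : S.g (φ (S.nabla X (S.e i))) (S.f i) =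
      ∑ k, S.g (S.nabla X (S.e i)) (S.f k) * S.g (φ (S.e k)) (S.f i) := by
    have := S.sum_g_mul ((S.g ∘ₗ φ).flip (S.f i)) (S.nabla X (S.e i))
    rw [S.P_of_hor (S.θ_nabla_hor X (S.θ_e i))] at this
    exact this.symm
  -- Differentiating the constants `g (e i) (f k)` shows that the connection coefficients of the two
  -- frames are negative transposes of each other, so these contributions cancel.
  have h3 : ∑ i, S.g (φ (S.e i)) (S.nabla X (S.f i)) +
      ∑ i, S.g (φ (S.nabla X (S.e i))) (S.f i) = 0 := by
    simp only [h1, h2]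
    rw [Finset.sum_comm, ← Finset.sum_add_distrib]
    refine Finset.sum_eq_zero fun i _ ↦ ?_
    rw [← Finset.sum_add_distrib]
    refine Finset.sum_eq_zero fun k _ ↦ ?_
    have h := S.D_g X (S.e i) (S.f k)
    rw [g_e_f, S.g_symm (S.e i)] at h
    have h0 : S.D X (if i = k then 1 else 0) = 0 := by split_ifs <;> simp
    rw [h0] at h
    linear_combination -S.g (φ (S.e k)) (S.f i) * h
  simp only [map_sum, D_g, map_sub, LinearMap.sub_apply, Finset.sum_add_distrib,
    Finset.sum_sub_distrib]
  linear_combination h3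

/-- The Ricci endomorphism. -/
def ricci (X : L) : L := ∑ i, S.curvature X (S.e i) (S.f i)

/-- The divergence of the torsion. -/
def divTau : L := ∑ i, S.nablaTau (S.e i) (S.f i)

/-- The Ricci form. -/
def ricciForm (X Y : L) : A := S.half * ∑ i, S.g (S.curvature (S.J (S.e i)) (S.f i) X) Y

/-- The trace of `J` composed with the curvature. -/
def traceForm : L →ₗ[A] L →ₗ[A] A :=
  LinearMap.mk₂ A (fun X Y ↦ S.half * ∑ i, S.g (S.curvature X Y (S.J (S.e i))) (S.f i))
    (fun X X' Y ↦ by simp [Finset.sum_add_distrib, mul_add])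
    (fun a X Y ↦ by simp [← Finset.mul_sum, mul_left_comm])
    (fun X Y Y' ↦ by simp [Finset.sum_add_distrib, mul_add])
    (fun a X Y ↦ by simp [← Finset.mul_sum, mul_left_comm])

lemma traceForm_apply (X Y : L) : S.traceForm X Y =
    S.half * ∑ i, S.g (S.curvature X Y (S.J (S.e i))) (S.f i) := rfl

lemma traceForm_swap (X Y : L) : S.traceForm X Y = - S.traceForm Y X := by
  simp only [traceForm_apply, S.curvature_swap X Y, map_neg, LinearMap.neg_apply,
    Finset.sum_neg_distrib, mul_neg]

lemma D_traceForm (X Y Z : L) : S.D X (S.traceForm Y Z) = S.half * ∑ i,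
    S.g (S.nabla X (S.curvature Y Z (S.J (S.e i)))
      - S.curvature Y Z (S.nabla X (S.J (S.e i)))) (S.f i) := by
  have h := S.D_trace (S.curvature Y Z ∘ₗ S.J) X
  simp only [LinearMap.comp_apply, ← S.nabla_J] at h
  rw [traceForm_apply, Derivation.leibniz, S.D_half, h]
  simp

/-- `traceForm` behaves as the curvature of a determinant line bundle: term by term its differential
is the trace of the second Bianchi identity applied to `J (e i)`. -/
lemma dTwo_traceForm (X Y Z : L) : S.dTwo (fun X Y ↦ S.traceForm X Y) X Y Z = 0 := by
  simp only [VectorFieldAlgebra.dTwo, D_traceForm]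
  simp only [traceForm_apply, ← mul_add, ← mul_sub, ← Finset.sum_add_distrib,
    ← Finset.sum_sub_distrib, ← LinearMap.add_apply, ← LinearMap.sub_apply, ← map_add, ← map_sub,
    S.bianchi_two X Y Z]
  simp

lemma ricciForm_swap (X Y : L) : S.ricciForm X Y = - S.ricciForm Y X := by
  simp only [ricciForm, S.g_curvature _ _ X Y, S.g_symm X, Finset.sum_neg_distrib, mul_neg]

/-- Trace of the horizontal Bianchi identity over `(J e_i, f_i, X)`. Moving `J` across the frames
and exchanging them makes the last two curvature terms equal; two of the torsion terms contribute `2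
g(τX, Y)` each. -/
lemma sum_curvature_left {X : L} (hX : S.θ X = 0) (Y : L) :
    ∑ i, S.g (S.curvature (S.J (S.e i)) (S.f i) X) Y
      + (∑ i, S.g (S.curvature X (S.J (S.e i)) (S.f i)) Y
        + ∑ i, S.g (S.curvature X (S.J (S.e i)) (S.f i)) Y) =
    (∑ i, S.dθ (S.J (S.e i)) (S.f i) + (1 + 1 + 1 + 1)) * S.g (S.tau X) Y := by
  have h := Finset.sum_congr rfl fun i (_ : i ∈ Finset.univ) ↦
    S.bianchi_hor (S.θ_J (S.e i)) (S.θ_f i) hX Y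
  have h1 : ∑ i, S.g (S.curvature (S.f i) X (S.J (S.e i))) Y =
      ∑ i, S.g (S.curvature X (S.J (S.e i)) (S.f i)) Y := by
    have h2 := S.sum_J (((S.curvature X).compr₂ (S.g.flip Y)).flip)
    have h3 := S.sum_swap (((S.curvature X) ∘ₗ S.J).compr₂ (S.g.flip Y))
    simp only [LinearMap.compr₂_apply, LinearMap.flip_apply, LinearMap.comp_apply] at h2 h3
    rw [← h3]
    simp only [S.curvature_swap _ X, map_neg, LinearMap.neg_apply, Finset.sum_neg_distrib]
    rw [h2, neg_neg]
  have h4 : ∑ i, S.dθ (S.f i) X * S.g (S.tau (S.J (S.e i))) Y = (1 + 1) * S.g (S.tau X) Y := by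
    have := S.sum_g_mul (S.g.flip Y ∘ₗ S.tau ∘ₗ S.J) (S.J X)
    simp only [LinearMap.comp_apply, LinearMap.flip_apply, P_J, S.J_J_hor hX,
      map_neg] at this
    simp only [S.dθ_swap _ X, S.dθ_eq X, neg_mul, add_mul, Finset.sum_neg_distrib,
      Finset.sum_add_distrib, this]
    ring
  have h5 : ∑ i, S.dθ X (S.J (S.e i)) * S.g (S.tau (S.f i)) Y = (1 + 1) * S.g (S.tau X) Y := by
    have := S.sum_g_mul' (S.g.flip Y ∘ₗ S.tau) X
    simp only [LinearMap.comp_apply, LinearMap.flip_apply, tau_P] at this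
    simp only [S.dθ_eq X, g_J_J, add_mul, Finset.sum_add_distrib, this]
    ring
  simp only [Finset.sum_add_distrib, h1, h4, h5, ← Finset.sum_mul] at h
  linear_combination h

/-- Trace of the horizontal Bianchi identity over `(X, Y, J e_i)` against `f_i`. The torsion terms
drop out since `τ` is symmetric and `τ ∘ J`, which anticommutes with `J`, is trace-free. -/
lemma sum_curvature_right {X Y : L} (hX : S.θ X = 0) (hY : S.θ Y = 0) :
    ∑ i, S.g (S.curvature X Y (S.J (S.e i))) (S.f i) =
      ∑ i, S.g (S.curvature Y (S.J (S.e i)) (S.f i)) X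
        - ∑ i, S.g (S.curvature X (S.J (S.e i)) (S.f i)) Y := by
  have h := Finset.sum_congr rfl fun i (_ : i ∈ Finset.univ) ↦
    S.bianchi_hor hX hY (S.θ_J (S.e i)) (S.f i)
  have h1 (X Y : L) : ∑ i, S.dθ Y (S.J (S.e i)) * S.g (S.tau X) (S.f i) =
      (1 + 1) * S.g (S.tau X) Y := by
    have := S.sum_g_mul' (S.g (S.tau X)) Y
    simp only [g_P_right] at this
    simp only [S.dθ_eq Y, g_J_J, add_mul, Finset.sum_add_distrib, this]
    ring
  have h2 : ∑ i, S.dθ X Y * S.g (S.tau (S.J (S.e i))) (S.f i) = 0 := by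
    have := S.trace_eq_zero (φ := S.tau ∘ₗ S.J) (fun Z ↦ by simp [tau_J])
    simp only [LinearMap.comp_apply] at this
    rw [← Finset.mul_sum, this, mul_zero]
  have h3 (X Y : L) (i) : S.g (S.curvature Y (S.J (S.e i)) X) (S.f i) =
      - S.g (S.curvature Y (S.J (S.e i)) (S.f i)) X := by rw [g_curvature, g_symm]
  simp only [Finset.sum_add_distrib, h1, h2, S.dθ_swap _ X, S.curvature_swap _ X, h3,
    neg_mul, Finset.sum_neg_distrib, map_neg, LinearMap.neg_apply] at h
  have h4 : S.g (S.tau X) Y = S.g (S.tau Y) X := by rw [g_tau, g_symm]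
  linear_combination h + (1 + 1) * h4

/-- The two traces of the curvature agree on `ker θ`. -/
lemma ricciForm_eq_traceForm {X Y : L} (hX : S.θ X = 0) (hY : S.θ Y = 0) :
    S.ricciForm X Y = S.traceForm X Y := by
  have h1 := S.sum_curvature_left hX Y
  have h2 := S.sum_curvature_left hY X
  have h3 : ∑ i, S.g (S.curvature (S.J (S.e i)) (S.f i) Y) X =
      - ∑ i, S.g (S.curvature (S.J (S.e i)) (S.f i) X) Y := by
    rw [← Finset.sum_neg_distrib]
    exact Finset.sum_congr rfl fun i _ ↦ by rw [g_curvature, g_symm]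
  have h4 : S.g (S.tau X) Y = S.g (S.tau Y) X := by rw [g_tau, g_symm]
  rw [ricciForm, traceForm_apply, S.sum_curvature_right hX hY]
  congr 1
  apply S.eq_of_add_self
  -- Skew-symmetrizing `sum_curvature_left` in `X, Y` removes its right-hand side by symmetry of
  -- `τ`, so the factor `∑ dθ(J e_i, f_i)` never has to be evaluated.
  rw [h3, ← h4] at h2
  linear_combination h1 - h2

/-- The Ricci endomorphism at `T` is the divergence of the torsion. -/
lemma ricci_T : S.ricci S.T = S.divTau := by
  refine S.hor_ext (by simp [ricci, divTau, θ_curvature, θ_nablaTau]) fun Z ↦ ?_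
  rw [← S.g_P_right, ← S.g_P_right S.divTau]
  generalize hX : S.P Z = X
  have hX : S.θ X = 0 := by rw [← hX, θ_P]
  have h := Finset.sum_congr rfl fun i (_ : i ∈ Finset.univ) ↦
    congrArg (fun V ↦ S.g V (S.f i)) (S.bianchi_T hX (S.θ_e i))
  -- A `g`-skew endomorphism is trace-free. The other unwanted trace, that of `∇_X τ`, vanishes
  -- because `∇_X τ` anticommutes with `J`.
  have h1 : ∑ i, S.g (S.curvature S.T X (S.e i)) (S.f i) = 0 := by
    have h2 := S.sum_swap (S.g ∘ₗ S.curvature S.T X)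
    simp only [LinearMap.comp_apply] at h2
    apply S.eq_of_add_self
    nth_rw 1 [← h2]
    simp only [S.g_curvature _ _ (S.f _), S.g_symm (S.f _), Finset.sum_neg_distrib]
    ring
  have h3 := S.trace_eq_zero (S.nablaTau_J X)
  simp only [map_sub, LinearMap.sub_apply, Finset.sum_sub_distrib, h1, h3, S.g_curvature S.T _ X,
    S.g_nablaTau _ X, Finset.sum_neg_distrib] at h
  simp only [ricci, divTau, map_sum, LinearMap.sum_apply, S.g_symm _ X]
  linear_combination h

/-- Trace `bianchi_T` with `Z = J e_i`. The curvature term gives `g(J Ric(T), X)` and the torsion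
term gives `g(J div τ, X)`; these agree by `ricci_T`, and their sum absorbs the factor `½`. -/
lemma traceForm_T {X : L} (hX : S.θ X = 0) :
    S.traceForm S.T X = S.g (S.J (S.ricci S.T)) X := by
  have h := Finset.sum_congr rfl fun i (_ : i ∈ Finset.univ) ↦
    congrArg (fun V ↦ S.g V (S.f i)) (S.bianchi_T hX (S.θ_J (S.e i)))
  have h1 := S.trace_eq_zero (φ := S.nablaTau X ∘ₗ S.J) (fun Z ↦ by simp [nablaTau_J])
  have h2 := S.sum_J ((S.curvature S.T).compr₂ (S.g X))
  have h3 := S.sum_J (S.nablaTau.compr₂ (S.g X))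
  simp only [LinearMap.comp_apply] at h1
  simp only [LinearMap.compr₂_apply, curvature_J, nablaTau_J, map_neg, Finset.sum_neg_distrib,
    neg_neg, ← map_sum] at h2 h3
  simp only [map_sub, LinearMap.sub_apply, Finset.sum_sub_distrib, S.g_curvature S.T _ X,
    S.g_nablaTau _ X, Finset.sum_neg_distrib, h1] at h
  simp only [← map_sum, h2, h3] at h
  rw [traceForm_apply, ← S.half_mul_add (S.g (S.J (S.ricci S.T)) X), S.g_symm _ X]
  congr 1
  nth_rw 2 [ricci_T]
  rw [ricci, divTau, map_sum, map_sum, map_sum, map_sum]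
  simp only [map_sum] at h ⊢
  linear_combination h

/-- The two forms agree on `ker θ` and `ricciForm` is killed by `T`, so they differ exactly by the
`T`-component of `traceForm`, computed in `traceForm_T`. -/
lemma ricciForm_eq (X Y : L) : S.ricciForm X Y = S.traceForm X Y
    - (S.θ X * S.g (S.J (S.ricci S.T)) Y - S.θ Y * S.g (S.J (S.ricci S.T)) X) := by
  have h : S.ricciForm X Y = S.ricciForm (S.P X) (S.P Y) := by
    simp [ricciForm, P_apply]
  have hT : S.traceForm S.T S.T = 0 := by
    apply S.eq_of_add_self
    linear_combination S.traceForm_swap S.T S.T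
  rw [h, S.ricciForm_eq_traceForm (S.θ_P X) (S.θ_P Y), ← S.g_P_right _ Y, ← S.g_P_right _ X,
    ← S.traceForm_T (S.θ_P Y), ← S.traceForm_T (S.θ_P X)]
  have h1 := S.traceForm_swap X S.T
  simp only [P_apply, map_sub, map_smul, LinearMap.sub_apply, LinearMap.smul_apply, smul_eq_mul,
    hT, h1]
  ring

/-- The horizontal exterior derivative of the Ricci form. -/
theorem dTwo_ricciForm {X Y Z : L} (hX : S.θ X = 0) (hY : S.θ Y = 0) (hZ : S.θ Z = 0) :
    S.dTwo S.ricciForm X Y Z = - (S.g (S.J (S.ricci S.T)) X * S.dθ Y Z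
      - S.g (S.J (S.ricci S.T)) Y * S.dθ X Z + S.g (S.J (S.ricci S.T)) Z * S.dθ X Y) := by
  have h1 := S.dTwo_traceForm X Y Z
  have h2 := S.dTwo_wedge S.θ (S.g (S.J (S.ricci S.T))) hX hY hZ
  simp only [VectorFieldAlgebra.dTwo] at h1 h2 ⊢
  simp only [ricciForm_eq, map_sub] at h2 ⊢
  simp only [dθ]
  linear_combination h1 - h2

end PseudoHermitianAlgebra

end

/-! ### Smooth functions and vector fields on an open set -/

section

variable {m : ℕ} {M : Type*} [TopologicalSpace M]
  [ChartedSpace (EuclideanSpace ℝ (Fin (2 * m + 1))) M]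

variable {U : Opens M}

open Classical in
/-- Extension by zero of a function on an open set. -/
def zeroExt (f : U → ℝ) (y : M) : ℝ := if h : y ∈ U then f ⟨y, h⟩ else 0

open Classical in
/-- Extension by zero of a vector field on an open set. -/
def zeroExtField (X : (y : U) → TangentSpace (𝓡 (2 * m + 1)) (y : M)) : VField m M :=
  fun y ↦ if h : y ∈ U then X ⟨y, h⟩ else 0

lemma zeroExt_apply (f : U → ℝ) (y : U) : zeroExt f y = f y := by simp [zeroExt]

lemma zeroExtField_apply (X : (y : U) → TangentSpace (𝓡 (2 * m + 1)) (y : M)) (y : U) :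
    zeroExtField X y = X y := by simp [zeroExtField]

lemma eventually_of_opens {p : M → Prop} (h : ∀ y : U, p y) (y : U) : ∀ᶠ z in 𝓝 (y : M), p z := by
  filter_upwards [U.isOpen.mem_nhds y.2] with z hz using h ⟨z, hz⟩

variable (m U) in
/-- The smooth functions on an open set, as a subring of all functions. -/
def smoothSubring : Subring (U → ℝ) where
  carrier := {f | ContMDiffOn (𝓡 (2 * m + 1)) 𝓘(ℝ) ∞ (zeroExt f) U}
  mul_mem' {f g} hf hg := (ContMDiffOn.mul hf hg).congr fun y hy ↦ by
    simp [zeroExt, SetLike.mem_coe.1 hy]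
  one_mem' := contMDiffOn_const (c := (1 : ℝ)).congr fun y hy ↦ by
    simp [zeroExt, SetLike.mem_coe.1 hy]
  add_mem' {f g} hf hg := (ContMDiffOn.add hf hg).congr fun y hy ↦ by
    simp [zeroExt, SetLike.mem_coe.1 hy]
  zero_mem' := contMDiffOn_const (c := (0 : ℝ)).congr fun y hy ↦ by simp [zeroExt]
  neg_mem' {f} hf := (ContMDiffOn.neg hf).congr fun y hy ↦ by
    simp [zeroExt, SetLike.mem_coe.1 hy]

variable (m U) in
/-- The ring of smooth functions on an open set. -/
def SmoothFn : Type _ := smoothSubring m U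

instance : CommRing (SmoothFn m U) := inferInstanceAs (CommRing (smoothSubring m U))

namespace SmoothFn

lemma add_apply (f f' : SmoothFn m U) (y : U) : (f + f').1 y = f.1 y + f'.1 y := rfl

lemma mul_apply (f f' : SmoothFn m U) (y : U) : (f * f').1 y = f.1 y * f'.1 y := rfl

/-- The extension by zero of a smooth function. -/
def ext (f : SmoothFn m U) : M → ℝ := zeroExt f.1

lemma ext_apply (f : SmoothFn m U) (y : U) : ext f y = f.1 y := zeroExt_apply f.1 y

lemma ext_add (f f' : SmoothFn m U) : ext (f + f') = fun y ↦ ext f y + ext f' y := by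
  ext1 y
  by_cases hy : y ∈ U <;> simp [ext, zeroExt, hy, add_apply]

lemma ext_mul (f f' : SmoothFn m U) : ext (f * f') = fun y ↦ ext f y * ext f' y := by
  ext1 y
  by_cases hy : y ∈ U <;> simp [ext, zeroExt, hy, mul_apply]

lemma eq_of_apply {f f' : SmoothFn m U} (h : ∀ y, f.1 y = f'.1 y) : f = f' :=
  Subtype.ext (funext h)

lemma ext_eventuallyEq {f : SmoothFn m U} {f' : M → ℝ} (h : ∀ y : U, f.1 y = f' y) (y : U) :
    ext f =ᶠ[𝓝 (y : M)] f' :=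
  eventually_of_opens (p := fun z ↦ ext f z = f' z) (fun z ↦ by rw [ext_apply, h]) y

lemma smooth (f : SmoothFn m U) : ContMDiffOn (𝓡 (2 * m + 1)) 𝓘(ℝ) ∞ (ext f) U := f.2

lemma mdifferentiableAt (f : SmoothFn m U) (y : U) :
    MDifferentiableAt (𝓡 (2 * m + 1)) 𝓘(ℝ) (ext f) y :=
  ((smooth f).contMDiffAt (U.isOpen.mem_nhds y.2)).mdifferentiableAt (by simp)

/-- The restriction of a function which is smooth on `U`. -/
def restr (f : M → ℝ) (hf : ContMDiffOn (𝓡 (2 * m + 1)) 𝓘(ℝ) ∞ f U) : SmoothFn m U :=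
  ⟨fun y ↦ f y, hf.congr fun y hy ↦ by simp [zeroExt, SetLike.mem_coe.1 hy]⟩

@[simp] lemma restr_apply (f : M → ℝ) (hf : ContMDiffOn (𝓡 (2 * m + 1)) 𝓘(ℝ) ∞ f U) (y : U) :
    (restr f hf).1 y = f y := rfl

end SmoothFn

variable [IsManifold (𝓡 (2 * m + 1)) ∞ M]

/-- The vector field `X` is smooth on `U`. -/
def SmoothOn (X : VField m M) (U : Set M) : Prop :=
  ContMDiffOn (𝓡 (2 * m + 1)) (𝓡 (2 * m + 1)).tangent ∞
    (fun y ↦ (⟨y, X y⟩ : TangentBundle (𝓡 (2 * m + 1)) M)) U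

lemma SmoothOn.smoothAt {X : VField m M} {U : Opens M} (h : SmoothOn X U) (y : U) :
    SmoothAt X y := h.contMDiffAt (U.isOpen.mem_nhds y.2)

lemma smoothOn_of_smoothAt {X : VField m M} {U : Opens M} (h : ∀ y : U, SmoothAt X y) :
    SmoothOn X U := fun y hy ↦ ContMDiffAt.contMDiffWithinAt (h ⟨y, hy⟩)

lemma SmoothOn.congr' {X Y : VField m M} {U : Opens M} (h : SmoothOn X U)
    (hXY : ∀ y : U, Y y = X y) : SmoothOn Y U :=
  ContMDiffOn.congr h fun y hy ↦ congrArg (TotalSpace.mk y) (hXY ⟨y, hy⟩)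

instance isManifold_minSmoothness : IsManifold (𝓡 (2 * m + 1)) (minSmoothness ℝ 3) M := by
  rw [minSmoothness_of_isRCLikeNormedField]
  infer_instance

lemma SmoothAt.bracket {X Y : VField m M} {x : M} (hX : SmoothAt X x) (hY : SmoothAt Y x) :
    SmoothAt (bracket X Y) x := by
  have : IsManifold (𝓡 (2 * m + 1)) ((⊤ : ℕ∞) + 1) M := by simpa
  exact ContMDiffAt.mlieBracket_vectorField (m := ⊤) (n := ⊤) hX hY (by simp)

/-- `X(f)` is the fibre component of the tangent map of `f` composed with the section `X`. -/
lemma contMDiffOn_dirDeriv {X : VField m M} {f : M → ℝ} {U : Opens M} (hX : SmoothOn X U)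
    (hf : ContMDiffOn (𝓡 (2 * m + 1)) 𝓘(ℝ) ∞ f U) :
    ContMDiffOn (𝓡 (2 * m + 1)) 𝓘(ℝ) ∞ (dirDeriv X f) U := by
  have h1 := hf.contMDiffOn_tangentMapWithin (m := ∞) (by simp) U.isOpen.uniqueMDiffOn
  have h2 : ContMDiffOn (𝓡 (2 * m + 1)) 𝓘(ℝ).tangent ∞
      (fun y ↦ tangentMapWithin (𝓡 (2 * m + 1)) 𝓘(ℝ) f U ⟨y, X y⟩) U :=
    h1.comp hX (fun y hy ↦ hy)
  intro y hy
  have h3 := h2 y hy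
  rw [contMDiffWithinAt_totalSpace] at h3
  refine h3.2.congr_of_mem (fun z hz ↦ ?_) hy
  simp [tangentMapWithin, dirDeriv, mvfderiv, mfderivWithin_of_isOpen U.isOpen hz]
  rfl

variable (m U) in
/-- The smooth vector fields on an open set, as a submodule of all vector fields. -/
def smoothSubmodule : Submodule (smoothSubring m U)
    ((y : U) → TangentSpace (𝓡 (2 * m + 1)) (y : M)) where
  carrier := {X | SmoothOn (zeroExtField X) U}
  add_mem' {X Y} hX hY := SmoothOn.congr' (ContMDiffOn.add_section hX hY) fun y ↦ by
    simp [zeroExtField_apply]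
  zero_mem' := SmoothOn.congr' (X := fun _ ↦ 0) (contMDiff_zeroSection ℝ _).contMDiffOn fun y ↦ by
    simp [zeroExtField_apply]
  smul_mem' f X hX := SmoothOn.congr' (ContMDiffOn.smul_section f.2 hX) fun y ↦ by
    simp [zeroExtField_apply, zeroExt_apply]
    rfl

variable (m U) in
/-- The module of smooth vector fields on an open set. -/
def SmoothField : Type _ := smoothSubmodule m U

instance : AddCommGroup (SmoothField m U) := inferInstanceAs (AddCommGroup (smoothSubmodule m U))

instance : Module (SmoothFn m U) (SmoothField m U) :=
  inferInstanceAs (Module (smoothSubring m U) (smoothSubmodule m U))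

namespace SmoothField

lemma add_apply (X Y : SmoothField m U) (y : U) : (X + Y).1 y = X.1 y + Y.1 y := rfl

lemma smul_apply (f : SmoothFn m U) (X : SmoothField m U) (y : U) :
    (f • X).1 y = f.1 y • X.1 y := rfl

/-- The extension by zero of a smooth vector field. -/
def ext (X : SmoothField m U) : VField m M := zeroExtField X.1

lemma ext_apply (X : SmoothField m U) (y : U) : ext X y = X.1 y := zeroExtField_apply X.1 y

lemma eq_of_apply {X Y : SmoothField m U} (h : ∀ y, X.1 y = Y.1 y) : X = Y :=
  Subtype.ext (funext h)

lemma ext_eventuallyEq {X : SmoothField m U} {Y : VField m M} (h : ∀ y : U, X.1 y = Y y) (y : U) :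
    ext X =ᶠ[𝓝 (y : M)] Y :=
  eventually_of_opens (p := fun z ↦ ext X z = Y z) (fun z ↦ by rw [ext_apply, h]) y

lemma ext_add (X Y : SmoothField m U) : ext (X + Y) = ext X + ext Y := by
  ext1 y
  by_cases hy : y ∈ U <;> simp [ext, zeroExtField, hy, add_apply]

lemma ext_smul (a : SmoothFn m U) (X : SmoothField m U) :
    ext (a • X) = SmoothFn.ext a • ext X := by
  ext1 y
  by_cases hy : y ∈ U
  · simp only [ext, zeroExtField, hy, smul_apply, Pi.smul_apply', SmoothFn.ext, zeroExt, dite_true]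
  · simp [ext, zeroExtField, hy]

lemma smooth (X : SmoothField m U) : SmoothOn (ext X) U := X.2

lemma smoothAt (X : SmoothField m U) (y : U) : SmoothAt (ext X) y := (smooth X).smoothAt y

/-- The restriction of a vector field which is smooth on `U`. -/
def restr (X : VField m M) (hX : SmoothOn X U) : SmoothField m U :=
  ⟨fun y ↦ X y, hX.congr' fun y ↦ by simp [zeroExtField_apply]⟩

@[simp] lemma restr_apply (X : VField m M) (hX : SmoothOn X U) (y : U) :
    (restr X hX).1 y = X y := rfl

end SmoothField

end

/-! ### Lie bracket and derivations on an open set -/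

section

variable {m : ℕ} {M : Type*} [TopologicalSpace M]
  [ChartedSpace (EuclideanSpace ℝ (Fin (2 * m + 1))) M] {U : Opens M}

lemma dirDeriv_congr (X : VField m M) {f f' : M → ℝ} {x : M} (h : f =ᶠ[𝓝 x] f') :
    dirDeriv X f x = dirDeriv X f' x := by
  rw [dirDeriv, dirDeriv, mvfderiv, mvfderiv, h.mfderiv_eq, h.self_of_nhds]

lemma bracket_congr {X X' Y Y' : VField m M} {x : M} (hX : X =ᶠ[𝓝 x] X') (hY : Y =ᶠ[𝓝 x] Y') :
    bracket X Y x = bracket X' Y' x := hX.mlieBracket_vectorField_eq hY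

variable [IsManifold (𝓡 (2 * m + 1)) ∞ M]

lemma SmoothAt.mdifferentiableAt' {X : VField m M} {x : M} (h : SmoothAt X x) :
    MDifferentiableAt (𝓡 (2 * m + 1)) (𝓡 (2 * m + 1)).tangent
      (fun y ↦ (⟨y, X y⟩ : TangentBundle (𝓡 (2 * m + 1)) M)) x :=
  ContMDiffAt.mdifferentiableAt h (by simp)

lemma SmoothOn.bracket {X Y : VField m M} {U : Opens M} (hX : SmoothOn X U) (hY : SmoothOn Y U) :
    SmoothOn (bracket X Y) U :=
  smoothOn_of_smoothAt fun y ↦ (hX.smoothAt y).bracket (hY.smoothAt y)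

lemma jacobi_bracket {X Y Z : VField m M} {x : M} (hX : SmoothAt X x) (hY : SmoothAt Y x)
    (hZ : SmoothAt Z x) : bracket X (bracket Y Z) x =
      bracket (bracket X Y) Z x + bracket Y (bracket X Z) x := by
  have h {X : VField m M} (hX : SmoothAt X x) : ContMDiffAt (𝓡 (2 * m + 1))
      (𝓡 (2 * m + 1)).tangent (minSmoothness ℝ 2)
      (fun y ↦ (⟨y, X y⟩ : TangentBundle (𝓡 (2 * m + 1)) M)) x := by
    rw [minSmoothness_of_isRCLikeNormedField]
    exact ContMDiffAt.of_le hX ENat.LEInfty.out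
  exact leibniz_identity_mlieBracket_apply (h hX) (h hY) (h hZ)

namespace SmoothField

/-- The Lie bracket of smooth vector fields on an open set. -/
def br : SmoothField m U →+ SmoothField m U →+ SmoothField m U :=
  AddMonoidHom.mk' (fun X ↦ AddMonoidHom.mk'
    (fun Y ↦ restr (bracket (ext X) (ext Y)) ((smooth X).bracket (smooth Y)))
    (fun Y Y' ↦ by
      refine eq_of_apply fun y ↦ ?_
      rw [add_apply, restr_apply, restr_apply, restr_apply, ext_add]
      exact mlieBracket_add_right (smoothAt Y y).mdifferentiableAt'
        (smoothAt Y' y).mdifferentiableAt'))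
    (fun X X' ↦ by
      refine AddMonoidHom.ext fun Y ↦ eq_of_apply fun y ↦ ?_
      change bracket _ _ _ = bracket _ _ _ + bracket _ _ _
      rw [ext_add]
      exact mlieBracket_add_left (smoothAt X y).mdifferentiableAt'
        (smoothAt X' y).mdifferentiableAt')

lemma br_apply (X Y : SmoothField m U) (y : U) : (br X Y).1 y = bracket (ext X) (ext Y) y := rfl

/-- The derivative of a smooth function along a smooth vector field, on an open set. -/
def D : SmoothField m U →ₗ[SmoothFn m U] Derivation ℤ (SmoothFn m U) (SmoothFn m U) where
  toFun X := Derivation.mk'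
    (AddMonoidHom.toIntLinearMap (AddMonoidHom.mk' (fun f ↦ SmoothFn.restr
      (dirDeriv (ext X) (SmoothFn.ext f)) (contMDiffOn_dirDeriv (smooth X) (SmoothFn.smooth f)))
      (fun f f' ↦ by
        refine SmoothFn.eq_of_apply fun y ↦ ?_
        change dirDeriv _ _ _ = dirDeriv _ _ _ + dirDeriv _ _ _
        rw [SmoothFn.ext_add]
        simp [dirDeriv, mvfderiv_fun_add (SmoothFn.mdifferentiableAt f y)
          (SmoothFn.mdifferentiableAt f' y)])))
    (fun f f' ↦ by
      refine SmoothFn.eq_of_apply fun y ↦ ?_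
      change dirDeriv _ _ _ = f.1 y * dirDeriv _ _ _ + f'.1 y * dirDeriv _ _ _
      rw [SmoothFn.ext_mul]
      simp [dirDeriv, mvfderiv_fun_mul (SmoothFn.mdifferentiableAt f y)
          (SmoothFn.mdifferentiableAt f' y), SmoothFn.ext_apply])
  map_add' X X' := by
    refine Derivation.ext fun f ↦ SmoothFn.eq_of_apply fun y ↦ ?_
    change dirDeriv _ _ _ = dirDeriv _ _ _ + dirDeriv _ _ _
    simp only [dirDeriv, ext_apply, add_apply, map_add]
  map_smul' a X := by
    refine Derivation.ext fun f ↦ SmoothFn.eq_of_apply fun y ↦ ?_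
    change dirDeriv _ _ _ = a.1 y * dirDeriv _ _ _
    simp only [dirDeriv, ext_apply, smul_apply, map_smul, smul_eq_mul]

lemma br_swap (X Y : SmoothField m U) : br X Y = - br Y X := by
  refine eq_of_apply fun y ↦ ?_
  exact mlieBracket_swap_apply

lemma br_smul (a : SmoothFn m U) (X Y : SmoothField m U) :
    br X (a • Y) = a • br X Y + D X a • Y := by
  refine eq_of_apply fun y ↦ ?_
  have h := mlieBracket_smul_right (I := 𝓡 (2 * m + 1)) (V := ext X) (W := ext Y)
    (SmoothFn.mdifferentiableAt a y) (smoothAt Y y).mdifferentiableAt'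
  have e1 : (br X (a • Y)).1 y = bracket (ext X) (SmoothFn.ext a • ext Y) y := by
    rw [br_apply, ext_smul]
  have e2 : (a • br X Y + D X a • Y).1 y =
      a.1 y • bracket (ext X) (ext Y) y + dirDeriv (ext X) (SmoothFn.ext a) y • Y.1 y := rfl
  rw [e1, e2, ← SmoothFn.ext_apply, ← ext_apply Y]
  exact h.trans (add_comm _ _)

lemma jacobi (X Y Z : SmoothField m U) :
    br X (br Y Z) = br (br X Y) Z + br Y (br X Z) := by
  refine eq_of_apply fun y ↦ ?_
  have h (X Y : SmoothField m U) : ext (br X Y) =ᶠ[𝓝 (y : M)] bracket (ext X) (ext Y) :=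
    ext_eventuallyEq (br_apply X Y) y
  rw [add_apply, br_apply X, br_apply _ Z, br_apply Y (br X Z)]
  exact ((bracket_congr (.refl _ _) (h Y Z)).trans
    (jacobi_bracket (smoothAt X y) (smoothAt Y y) (smoothAt Z y))).trans
    (congrArg₂ (· + ·) (bracket_congr (h X Y) (.refl _ _)).symm
      (bracket_congr (.refl _ _) (h X Z)).symm)

end SmoothField

end

/-! ### Pointwise tensors and local frames -/

section

variable {m : ℕ} {M : Type*} [TopologicalSpace M]
  [ChartedSpace (EuclideanSpace ℝ (Fin (2 * m + 1))) M] {U : Opens M}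
  [IsManifold (𝓡 (2 * m + 1)) ∞ M]

namespace PseudoHermitian

variable (S : PseudoHermitian m M)

/-- The projection to `ker θ` along `T`, as a linear map. -/
def projHom (x : M) : TangentSpace (𝓡 (2 * m + 1)) x →ₗ[ℝ] TangentSpace (𝓡 (2 * m + 1)) x where
  toFun := S.proj x
  map_add' u v := by simp only [proj, map_add]; module
  map_smul' c v := by simp only [proj, map_smul, smul_eq_mul, RingHom.id_apply]; module

lemma projHom_apply (x : M) (v : TangentSpace (𝓡 (2 * m + 1)) x) : S.projHom x v = S.proj x v := rfl

lemma θ_T (x : M) : S.θ x (S.T x) = 1 := (S.T_spec x).1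

@[simp] lemma θ_proj (x : M) (v : TangentSpace (𝓡 (2 * m + 1)) x) : S.θ x (S.proj x v) = 0 := by
  simp [proj, S.θ_T]

@[simp] lemma proj_T (x : M) : S.proj x (S.T x) = 0 := by simp [proj, S.θ_T]

@[simp] lemma proj_proj (x : M) (v : TangentSpace (𝓡 (2 * m + 1)) x) :
    S.proj x (S.proj x v) = S.proj x v := S.proj_of_hor (S.θ_proj x v)

/-- The `2`-form `dθ` at a point, as a bilinear map. -/
def dθHom (x : M) : TangentSpace (𝓡 (2 * m + 1)) x →ₗ[ℝ] TangentSpace (𝓡 (2 * m + 1)) x →ₗ[ℝ] ℝ :=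
  LinearMap.mk₂ ℝ (S.dθ x)
    (fun u u' v ↦ by simp [dθ, ← extDerivOneHom_apply S.smooth_θ])
    (fun c u v ↦ by simp [dθ, ← extDerivOneHom_apply S.smooth_θ])
    (fun u v v' ↦ by simp [dθ, ← extDerivOneHom_apply S.smooth_θ])
    (fun c u v ↦ by simp [dθ, ← extDerivOneHom_apply S.smooth_θ])

lemma dθHom_apply (x : M) (u v : TangentSpace (𝓡 (2 * m + 1)) x) :
    S.dθHom x u v = S.dθ x u v := rfl

/-- The metric at a point, as a bilinear map. -/
def gHom (x : M) : TangentSpace (𝓡 (2 * m + 1)) x →ₗ[ℝ] TangentSpace (𝓡 (2 * m + 1)) x →ₗ[ℝ] ℝ :=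
  (1 / 2 : ℝ) • (S.dθHom x).compl₂ ((S.J x).toLinearMap ∘ₗ S.projHom x)

lemma gHom_apply (x : M) (u v : TangentSpace (𝓡 (2 * m + 1)) x) : S.gHom x u v = S.g x u v := rfl

lemma dθ_T_left (x : M) (v : TangentSpace (𝓡 (2 * m + 1)) x) : S.dθ x (S.T x) v = 0 :=
  (S.T_spec x).2 v

lemma dθ_swap (x : M) (u v : TangentSpace (𝓡 (2 * m + 1)) x) : S.dθ x u v = - S.dθ x v u :=
  extDerivOneAt_swap ..

lemma dθ_proj_left (x : M) (u v : TangentSpace (𝓡 (2 * m + 1)) x) :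
    S.dθ x (S.proj x u) v = S.dθ x u v := by
  rw [← dθHom_apply, proj, map_sub, map_smul]
  simp [dθHom_apply, dθ_T_left]

lemma dθ_proj_right (x : M) (u v : TangentSpace (𝓡 (2 * m + 1)) x) :
    S.dθ x u (S.proj x v) = S.dθ x u v := by
  rw [dθ_swap, dθ_proj_left, ← dθ_swap]

lemma g_proj_left (x : M) (u v : TangentSpace (𝓡 (2 * m + 1)) x) :
    S.g x (S.proj x u) v = S.g x u v := by
  rw [g, g, dθ_proj_left]

lemma g_proj_right (x : M) (u v : TangentSpace (𝓡 (2 * m + 1)) x) :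
    S.g x u (S.proj x v) = S.g x u v := by
  rw [g, g, proj_proj]

lemma SmoothOn_θ {X : VField m M} (hX : SmoothOn X U) :
    ContMDiffOn (𝓡 (2 * m + 1)) 𝓘(ℝ) ∞ (fun y ↦ S.θ y (X y)) U :=
  fun y hy ↦ (S.smooth_θapply (hX.smoothAt ⟨y, hy⟩)).contMDiffWithinAt

lemma SmoothOn_hpart (hT : SmoothOn S.T U) {X : VField m M} (hX : SmoothOn X U) :
    SmoothOn (S.hpart X) U :=
  ContMDiffOn.sub_section hX (ContMDiffOn.smul_section (S.SmoothOn_θ hX) hT)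

lemma SmoothOn_J {X : VField m M} (hX : SmoothOn X U) :
    SmoothOn (fun y ↦ S.J y (X y)) U :=
  smoothOn_of_smoothAt fun y ↦ S.smooth_Japply (hX.smoothAt y)

lemma SmoothOn_Jf (hT : SmoothOn S.T U) {X : VField m M} (hX : SmoothOn X U) :
    SmoothOn (S.Jf X) U := S.SmoothOn_J (S.SmoothOn_hpart hT hX)

/-- The contact form on smooth vector fields on an open set. -/
def θField : SmoothField m U →ₗ[SmoothFn m U] SmoothFn m U where
  toFun X := SmoothFn.restr (fun y ↦ S.θ y (X.ext y)) (S.SmoothOn_θ X.smooth)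
  map_add' X Y := SmoothFn.eq_of_apply fun y ↦ by
    rw [SmoothFn.add_apply]
    simp [SmoothField.ext_apply, SmoothField.add_apply]
  map_smul' a X := SmoothFn.eq_of_apply fun y ↦ by
    rw [RingHom.id_apply, smul_eq_mul, SmoothFn.mul_apply]
    simp [SmoothField.ext_apply, SmoothField.smul_apply]

lemma θField_apply (X : SmoothField m U) (y : U) : (S.θField X).1 y = S.θ y (X.1 y) := by
  rw [← SmoothField.ext_apply]; rfl

/-- A smooth frame of `ker θ` on an open set, together with its dual frame. -/
structure LocalFrame (U : Opens M) where
  e : Fin (2 * m) → VField m M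
  f : Fin (2 * m) → VField m M
  smooth_e : ∀ i, SmoothOn (e i) U
  smooth_f : ∀ i, SmoothOn (f i) U
  smooth_T : SmoothOn S.T U
  θ_e : ∀ i (y : U), S.θ y (e i y) = 0
  θ_f : ∀ i (y : U), S.θ y (f i y) = 0
  dual : ∀ i k (y : U), S.g y (e i y) (f k y) = if i = k then 1 else 0
  expand : ∀ (y : U) v, S.proj y v = ∑ i, S.g y v (f i y) • e i y

namespace LocalFrame

variable {S} (F : S.LocalFrame U)

/-- Restriction of a local frame to a smaller open set. -/
def mono {V : Opens M} (hV : V ≤ U) : S.LocalFrame V where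
  e := F.e
  f := F.f
  smooth_e i := (F.smooth_e i).mono hV
  smooth_f i := (F.smooth_f i).mono hV
  smooth_T := F.smooth_T.mono hV
  θ_e i y := F.θ_e i ⟨y, hV y.2⟩
  θ_f i y := F.θ_f i ⟨y, hV y.2⟩
  dual i k y := F.dual i k ⟨y, hV y.2⟩
  expand y v := F.expand ⟨y, hV y.2⟩ v

/-- The characteristic vector field on an open set. -/
def T : SmoothField m U := SmoothField.restr S.T F.smooth_T

lemma T_apply (y : U) : F.T.1 y = S.T y := rfl

lemma θ_T : S.θField F.T = 1 := SmoothFn.eq_of_apply fun y ↦ by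
  rw [θField_apply, T_apply, S.θ_T]; rfl

/-- The complex structure on smooth vector fields on an open set. -/
def J : SmoothField m U →ₗ[SmoothFn m U] SmoothField m U where
  toFun X := SmoothField.restr (S.Jf X.ext) (S.SmoothOn_Jf F.smooth_T X.smooth)
  map_add' X Y := SmoothField.eq_of_apply fun y ↦ by
    rw [SmoothField.add_apply]
    simp [Jf, SmoothField.ext_apply, SmoothField.add_apply, ← projHom_apply]
  map_smul' a X := SmoothField.eq_of_apply fun y ↦ by
    rw [RingHom.id_apply, SmoothField.smul_apply]
    simp [Jf, SmoothField.ext_apply, SmoothField.smul_apply, ← projHom_apply]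

lemma J_apply (X : SmoothField m U) (y : U) : (F.J X).1 y = S.J y (S.proj y (X.1 y)) := by
  rw [← SmoothField.ext_apply X]; rfl

/-- The algebra of smooth vector fields on an open set. -/
def vectorFieldAlgebra : VectorFieldAlgebra (SmoothFn m U) (SmoothField m U) where
  half := SmoothFn.restr (fun _ ↦ 1 / 2) contMDiffOn_const
  half_add_half := SmoothFn.eq_of_apply fun y ↦ by
    rw [SmoothFn.add_apply, SmoothFn.restr_apply]
    change (1 / 2 + 1 / 2 : ℝ) = 1
    norm_num
  D := SmoothField.D
  br := SmoothField.br
  br_swap := SmoothField.br_swap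
  br_smul := SmoothField.br_smul
  jacobi := SmoothField.jacobi
  D_br := derivation_bracket_of_jacobi _ _ SmoothField.br_smul SmoothField.jacobi S.θField F.T F.θ_T

end LocalFrame
end PseudoHermitian

end

/-! ### The pseudo-Hermitian algebra of a local frame -/

section

variable {m : ℕ} {M : Type*} [TopologicalSpace M]
  [ChartedSpace (EuclideanSpace ℝ (Fin (2 * m + 1))) M] {U : Opens M}

lemma SmoothFn.sub_apply (f f' : SmoothFn m U) (y : U) : (f - f').1 y = f.1 y - f'.1 y := rfl

lemma SmoothFn.neg_apply (f : SmoothFn m U) (y : U) : (-f).1 y = -f.1 y := rfl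

lemma SmoothFn.sum_apply {ι : Type*} (s : Finset ι) (f : ι → SmoothFn m U) (y : U) :
    (∑ i ∈ s, f i).1 y = ∑ i ∈ s, (f i).1 y := by
  classical
  induction s using Finset.induction_on with
  | empty => rfl
  | insert a s ha h => rw [Finset.sum_insert ha, Finset.sum_insert ha, SmoothFn.add_apply, h]

variable [IsManifold (𝓡 (2 * m + 1)) ∞ M]

lemma SmoothField.sub_apply (X Y : SmoothField m U) (y : U) : (X - Y).1 y = X.1 y - Y.1 y := rfl

lemma SmoothField.sum_apply {ι : Type*} (s : Finset ι) (X : ι → SmoothField m U) (y : U) :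
    (∑ i ∈ s, X i).1 y = ∑ i ∈ s, (X i).1 y := by
  classical
  induction s using Finset.induction_on with
  | empty => rfl
  | insert a s ha h => rw [Finset.sum_insert ha, Finset.sum_insert ha, SmoothField.add_apply, h]

namespace PseudoHermitian

variable {S : PseudoHermitian m M}

lemma SmoothHorizontalAt_ext {X : SmoothField m U} (hX : S.θField X = 0) (y : U) :
    SmoothHorizontalAt S.θ X.ext y := by
  refine ⟨X.smoothAt y, eventually_of_opens (p := fun z ↦ S.θ z (X.ext z) = 0) (fun z ↦ ?_) y⟩
  rw [SmoothField.ext_apply, ← S.θField_apply, hX]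
  rfl

namespace LocalFrame

variable (F : S.LocalFrame U)

lemma dOne_apply (X Y : SmoothField m U) (y : U) :
    (F.vectorFieldAlgebra.dOne S.θField X Y).1 y = S.dθ y (X.1 y) (Y.1 y) := by
  have h (X : SmoothField m U) : SmoothFn.ext (S.θField X) =ᶠ[𝓝 (y : M)]
      fun z ↦ S.θ z (X.ext z) :=
    SmoothFn.ext_eventuallyEq (fun z ↦ by rw [S.θField_apply, SmoothField.ext_apply]) y
  have h1 := extDerivOneAt_field S.smooth_θ (X.smoothAt y) (Y.smoothAt y)
  rw [SmoothField.ext_apply, SmoothField.ext_apply] at h1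
  rw [VectorFieldAlgebra.dOne_apply, SmoothFn.sub_apply, SmoothFn.sub_apply, S.θField_apply, dθ,
    h1, extDerivOne, ← dirDeriv_congr _ (h X), ← dirDeriv_congr _ (h Y)]
  rfl

lemma J_hor {X : SmoothField m U} (hX : S.θField X = 0) (y : U) :
    (F.J X).1 y = S.J y (X.1 y) := by
  have : S.θ y (X.1 y) = 0 := by rw [← S.θField_apply, hX]; rfl
  rw [J_apply, S.proj_of_hor this]

lemma ext_J {X : SmoothField m U} (hX : S.θField X = 0) (y : U) :
    (F.J X).ext =ᶠ[𝓝 (y : M)] fun z ↦ S.J z (X.ext z) :=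
  SmoothField.ext_eventuallyEq (fun z ↦ by rw [F.J_hor hX, SmoothField.ext_apply]) y

/-- The pseudo-Hermitian algebra of smooth vector fields on an open set carrying a frame. -/
def algebra : PseudoHermitianAlgebra (SmoothFn m U) (SmoothField m U) (Fin (2 * m)) where
  toVectorFieldAlgebra := F.vectorFieldAlgebra
  θ := S.θField
  T := F.T
  J := F.J
  θ_T := F.θ_T
  θ_J X := SmoothFn.eq_of_apply fun y ↦ by
    rw [S.θField_apply, J_apply, S.J_mem _ _ (S.θ_proj _ _)]; rfl
  J_T := SmoothField.eq_of_apply fun y ↦ by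
    rw [J_apply, T_apply, S.proj_T, map_zero]; rfl
  J_J X := SmoothField.eq_of_apply fun y ↦ by
    rw [J_apply, J_apply, S.proj_of_hor (S.J_mem _ _ (S.θ_proj _ _)), S.J_sq _ _ (S.θ_proj _ _),
      SmoothField.sub_apply, SmoothField.smul_apply, S.θField_apply, T_apply, proj, neg_sub]
  dθ_T X := SmoothFn.eq_of_apply fun y ↦ by
    rw [dOne_apply, T_apply, S.dθ_T_left]; rfl
  dθ_J_J X Y := SmoothFn.eq_of_apply fun y ↦ by
    rw [dOne_apply, dOne_apply, J_apply, J_apply, S.dθ_J_J (S.θ_proj _ _) (S.θ_proj _ _),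
      S.dθ_proj_left, S.dθ_proj_right]
  integrable X Y hX hY := SmoothField.eq_of_apply fun y ↦ by
    have hX' := SmoothHorizontalAt_ext hX y
    have hY' := SmoothHorizontalAt_ext hY y
    have h1 := S.partially_integrable y X.ext Y.ext hX' hY'
    have h2 := S.integrable y X.ext Y.ext hX' hY'
    rw [← bracket_congr (F.ext_J hX y) (.refl _ Y.ext),
      ← bracket_congr (.refl _ X.ext) (F.ext_J hY y)] at h1 h2
    rw [← bracket_congr (F.ext_J hX y) (F.ext_J hY y)] at h2
    -- Partial integrability says that the argument of `J` is horizontal, so the projection built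
    -- into `F.J` does nothing.
    rw [SmoothField.add_apply, SmoothField.sub_apply, J_apply, SmoothField.add_apply,
      S.proj_of_hor (by exact h1)]
    exact h2
  e i := SmoothField.restr (F.e i) (F.smooth_e i)
  f i := SmoothField.restr (F.f i) (F.smooth_f i)
  θ_e i := SmoothFn.eq_of_apply fun y ↦ by rw [S.θField_apply]; exact F.θ_e i y
  θ_f i := SmoothFn.eq_of_apply fun y ↦ by rw [S.θField_apply]; exact F.θ_f i y
  dual i k := SmoothFn.eq_of_apply fun y ↦ by
    rw [SmoothFn.mul_apply, dOne_apply, J_apply]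
    refine (F.dual i k y).trans ?_
    split_ifs <;> rfl
  expand X := SmoothField.eq_of_apply fun y ↦ by
    rw [SmoothField.sub_apply, SmoothField.smul_apply, S.θField_apply, SmoothField.sum_apply]
    refine (F.expand y (X.1 y)).trans (Finset.sum_congr rfl fun i _ ↦ ?_)
    rw [SmoothField.smul_apply, SmoothFn.mul_apply, dOne_apply, J_apply]
    rfl

end LocalFrame
end PseudoHermitian

end

/-! ### Pointwise and algebraic operations: metric, bracket, traces -/

section

variable {m : ℕ} {M : Type*} [TopologicalSpace M]
  [ChartedSpace (EuclideanSpace ℝ (Fin (2 * m + 1))) M] {U : Opens M}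

/-- Constant functions. -/
def SmoothFn.const (c : ℝ) : SmoothFn m U := SmoothFn.restr (fun _ ↦ c) contMDiffOn_const

lemma SmoothFn.const_apply (c : ℝ) (y : U) : (SmoothFn.const c : SmoothFn m U).1 y = c := rfl

/-- Evaluation of functions at a point. -/
def SmoothFn.eval (y : U) : SmoothFn m U →+ ℝ where
  toFun a := a.1 y
  map_zero' := rfl
  map_add' _ _ := rfl

lemma SmoothFn.eval_apply (y : U) (a : SmoothFn m U) : SmoothFn.eval y a = a.1 y := rfl

lemma SmoothFn.eval_smul (y : U) (a b : SmoothFn m U) :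
    SmoothFn.eval y (a • b) = a.1 y • SmoothFn.eval y b := rfl

lemma dirDeriv_congr_of_eq {X X' : VField m M} {f f' : M → ℝ} {x : M} (hX : X x = X' x)
    (h : f =ᶠ[𝓝 x] f') : dirDeriv X f x = dirDeriv X' f' x := by
  rw [dirDeriv_congr X h, dirDeriv, dirDeriv, hX]

variable [IsManifold (𝓡 (2 * m + 1)) ∞ M]

/-- Evaluation of vector fields at a point. -/
def SmoothField.eval (y : U) : SmoothField m U →+ TangentSpace (𝓡 (2 * m + 1)) (y : M) where
  toFun X := X.1 y
  map_zero' := rfl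
  map_add' _ _ := rfl

lemma SmoothField.eval_apply (y : U) (X : SmoothField m U) : SmoothField.eval y X = X.1 y := rfl

lemma SmoothField.eval_smul (y : U) (a : SmoothFn m U) (X : SmoothField m U) :
    SmoothField.eval y (a • X) = a.1 y • SmoothField.eval y X := rfl

namespace PseudoHermitian.LocalFrame

variable {S : PseudoHermitian m M} (F : S.LocalFrame U)

lemma g_apply (X Y : SmoothField m U) (y : U) :
    (F.algebra.g X Y).1 y = S.g y (X.1 y) (Y.1 y) := by
  rw [PseudoHermitianAlgebra.g_apply]
  change 1 / 2 * (F.vectorFieldAlgebra.dOne S.θField X (F.J Y)).1 y = _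
  rw [dOne_apply, J_apply]
  rfl

lemma dθ_apply (X Y : SmoothField m U) (y : U) :
    (F.algebra.dθ X Y).1 y = S.dθ y (X.1 y) (Y.1 y) := F.dOne_apply X Y y

lemma P_apply (X : SmoothField m U) (y : U) : (F.algebra.P X).1 y = S.proj y (X.1 y) := by
  rw [PseudoHermitianAlgebra.P_apply, SmoothField.sub_apply, SmoothField.smul_apply]
  change _ - (S.θField X).1 y • F.T.1 y = _
  rw [S.θField_apply, T_apply, proj]

lemma hpart_eventuallyEq {X : SmoothField m U} {X' : VField m M} {y : U}
    (hX : X' =ᶠ[𝓝 (y : M)] X.ext) : S.hpart X' =ᶠ[𝓝 (y : M)] (F.algebra.P X).ext := by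
  have h := SmoothField.ext_eventuallyEq (X := F.algebra.P X) (Y := S.hpart X.ext)
    (fun z ↦ by rw [P_apply, hpart, SmoothField.ext_apply]) y
  filter_upwards [hX, h] with z h1 h2
  rw [h2, hpart, hpart, h1]

lemma Jf_eventuallyEq {X : SmoothField m U} {X' : VField m M} {y : U}
    (hX : X' =ᶠ[𝓝 (y : M)] X.ext) : S.Jf X' =ᶠ[𝓝 (y : M)] (F.J X).ext := by
  have h := SmoothField.ext_eventuallyEq (X := F.J X) (Y := S.Jf X.ext)
    (fun z ↦ by rw [J_apply, Jf, SmoothField.ext_apply]) y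
  filter_upwards [hX, h] with z h1 h2
  rw [h2, Jf, Jf, h1]

lemma T_eventuallyEq (y : U) : S.T =ᶠ[𝓝 (y : M)] F.T.ext :=
  (SmoothField.ext_eventuallyEq F.T_apply y).symm

lemma br_apply {X Y : SmoothField m U} {X' Y' : VField m M} {y : U}
    (hX : X' =ᶠ[𝓝 (y : M)] X.ext) (hY : Y' =ᶠ[𝓝 (y : M)] Y.ext) :
    bracket X' Y' y = (F.algebra.br X Y).1 y := bracket_congr hX hY

lemma br_eventuallyEq {X Y : SmoothField m U} {X' Y' : VField m M} {y : U}
    (hX : X' =ᶠ[𝓝 (y : M)] X.ext) (hY : Y' =ᶠ[𝓝 (y : M)] Y.ext) :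
    bracket X' Y' =ᶠ[𝓝 (y : M)] (F.algebra.br X Y).ext := by
  filter_upwards [hX.eventually_nhds, hY.eventually_nhds, U.isOpen.mem_nhds y.2] with z h1 h2 h3
  exact (F.br_apply (y := ⟨z, h3⟩) h1 h2).trans (SmoothField.ext_apply _ ⟨z, h3⟩).symm

lemma dirDeriv_g {X Y Z : SmoothField m U} {X' Y' Z' : VField m M} {y : U}
    (hX : X' =ᶠ[𝓝 (y : M)] X.ext) (hY : Y' =ᶠ[𝓝 (y : M)] Y.ext) (hZ : Z' =ᶠ[𝓝 (y : M)] Z.ext) :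
    dirDeriv X' (fun z ↦ S.g z (Y' z) (Z' z)) y = (F.algebra.D X (F.algebra.g Y Z)).1 y := by
  refine dirDeriv_congr_of_eq hX.eq_of_nhds ?_
  have h := SmoothFn.ext_eventuallyEq (f := F.algebra.g Y Z)
    (f' := fun z ↦ S.g z (Y.ext z) (Z.ext z))
    (fun z ↦ by rw [g_apply, SmoothField.ext_apply, SmoothField.ext_apply]) y
  filter_upwards [hY, hZ, h] with z h1 h2 h3
  rw [h3, h1, h2]

lemma eq_apply {X : SmoothField m U} {X' : VField m M} {y : U}
    (hX : X' =ᶠ[𝓝 (y : M)] X.ext) : X' y = X.1 y := by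
  rw [hX.eq_of_nhds, SmoothField.ext_apply]

lemma koszul_apply {X Y Z : SmoothField m U} {X' Y' Z' : VField m M} {y : U}
    (hX : X' =ᶠ[𝓝 (y : M)] X.ext) (hY : Y' =ᶠ[𝓝 (y : M)] Y.ext) (hZ : Z' =ᶠ[𝓝 (y : M)] Z.ext) :
    S.koszul X' Y' Z' y = (F.algebra.koszul X Y Z).1 y := by
  rw [koszul, PseudoHermitianAlgebra.koszul, SmoothFn.sub_apply, SmoothFn.sub_apply,
    SmoothFn.add_apply, SmoothFn.sub_apply, SmoothFn.add_apply, F.dirDeriv_g hX hY hZ,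
    F.dirDeriv_g hY hX hZ, F.dirDeriv_g hZ hX hY, g_apply, g_apply, g_apply, hpart, hpart, hpart,
    S.g_proj_left, S.g_proj_left, S.g_proj_left, F.br_apply hX hY, F.br_apply hX hZ,
    F.br_apply hY hZ, eq_apply hX, eq_apply hY, eq_apply hZ]

section Tensor

variable {N E : Type*} [AddCommGroup N] [Module (SmoothFn m U) N] [AddCommGroup E] [Module ℝ E]

/-- A linear operation on vector fields is pointwise. -/
lemma apply_congr {S : PseudoHermitian m M} (F : S.LocalFrame U) {y : U} {ev : N →+ E}
    (hev : ∀ (a : SmoothFn m U) n, ev (a • n) = a.1 y • ev n)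
    (φ : SmoothField m U →ₗ[SmoothFn m U] N) {X X' : SmoothField m U} (h : X.1 y = X'.1 y) :
    ev (φ X) = ev (φ X') := by
  have key (X : SmoothField m U) : ev (φ X) = ∑ i, S.g y (X.1 y) (F.f i y) •
      ev (φ (F.algebra.e i)) + S.θ y (X.1 y) • ev (φ F.T) := by
    conv_lhs => rw [F.algebra.eq_P_add X, F.algebra.P_expand]
    rw [map_add, map_sum, map_add, map_sum, map_smul, hev]
    congr 1
    · refine Finset.sum_congr rfl fun i _ ↦ ?_
      rw [map_smul, hev, g_apply]
      rfl
    · rw [← S.θField_apply]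
      rfl
  rw [key X, key X', h]

lemma apply_congr₂ {S : PseudoHermitian m M} (F : S.LocalFrame U) {y : U} {ev : N →+ E}
    (hev : ∀ (a : SmoothFn m U) n, ev (a • n) = a.1 y • ev n)
    (φ : SmoothField m U →ₗ[SmoothFn m U] SmoothField m U →ₗ[SmoothFn m U] N)
    {X X' Y Y' : SmoothField m U} (hX : X.1 y = X'.1 y) (hY : Y.1 y = Y'.1 y) :
    ev (φ X Y) = ev (φ X' Y') :=
  (F.apply_congr hev (φ.flip Y) hX).trans (F.apply_congr hev (φ X') hY)

lemma apply_congr₃ {S : PseudoHermitian m M} (F : S.LocalFrame U) {y : U} {ev : N →+ E}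
    (hev : ∀ (a : SmoothFn m U) n, ev (a • n) = a.1 y • ev n)
    (φ : SmoothField m U →ₗ[SmoothFn m U] SmoothField m U →ₗ[SmoothFn m U]
      SmoothField m U →ₗ[SmoothFn m U] N)
    {X X' Y Y' Z Z' : SmoothField m U} (hX : X.1 y = X'.1 y) (hY : Y.1 y = Y'.1 y)
    (hZ : Z.1 y = Z'.1 y) : ev (φ X Y Z) = ev (φ X' Y' Z') :=
  (F.apply_congr hev ((φ.flip Y).flip Z) hX).trans (F.apply_congr₂ hev (φ X') hY hZ)

/-- The sum over an orthonormal basis of a bilinear operation is its trace in any frame. -/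
lemma frame_sum {y : U} {ev : N →+ E} (hev : ∀ (a : SmoothFn m U) n, ev (a • n) = a.1 y • ev n)
    (B : SmoothField m U →ₗ[SmoothFn m U] SmoothField m U →ₗ[SmoothFn m U] N)
    (W W' : Fin (2 * m) → SmoothField m U) (hW : ∀ l, (W l).1 y = S.frame y l)
    (hW' : ∀ l, (W' l).1 y = S.frame y l) :
    ∑ l, ev (B (W l) (W' l)) = ∑ i, ev (B (F.algebra.e i) (F.algebra.f i)) := by
  have hfr := S.frame_spec y
  have hP (l) (X : SmoothField m U) (hX : X.1 y = S.frame y l) : (F.algebra.P X).1 y = X.1 y := by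
    rw [P_apply, hX, S.proj_of_hor (hfr.1 l)]
  let a : Matrix (Fin (2 * m)) (Fin (2 * m)) ℝ := fun l i ↦ S.g y (S.frame y l) (F.f i y)
  let b : Matrix (Fin (2 * m)) (Fin (2 * m)) ℝ := fun l i ↦ S.g y (S.frame y l) (F.e i y)
  have hab : a * b.transpose = 1 := by
    ext l k
    have h1 := congrArg (fun a ↦ a.1 y) (F.algebra.sum_g_mul (F.algebra.g (W k)) (W l))
    simp only [SmoothFn.sum_apply, SmoothFn.mul_apply, g_apply, hP l _ (hW l), hW] at h1
    rw [hfr.2] at h1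
    rw [Matrix.mul_apply, Matrix.one_apply]
    simp only [eq_comm (a := l)]
    exact h1
  -- Orthonormality gives only `a * bᵀ = 1`; there are as many frame vectors as basis vectors, so
  -- the matrices are square and the inverse is two-sided. The second relation is the one that
  -- contracts the sum over `l`.
  have hba : b.transpose * a = 1 := mul_eq_one_comm.1 hab
  have h1 (l) : ev (B (W l) (W' l)) =
      ∑ i, ∑ k, (a l i * b l k) • ev (B (F.algebra.e i) (F.algebra.f k)) := by
    rw [F.apply_congr hev (B (W l)) (X' := F.algebra.P (W' l)) (by rw [hP l _ (hW' l)]),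
      F.algebra.P_expand']
    have h2 (Z) : ev (B (W l) Z) = ev (B (F.algebra.P (W l)) Z) :=
      F.apply_congr hev (B.flip Z) (by rw [hP l _ (hW l)])
    rw [h2, F.algebra.P_expand]
    simp only [map_sum, map_smul, LinearMap.sum_apply, LinearMap.smul_apply, hev, smul_smul,
      Finset.smul_sum]
    rw [Finset.sum_comm]
    refine Finset.sum_congr rfl fun i _ ↦ Finset.sum_congr rfl fun k _ ↦ ?_
    rw [mul_comm, SmoothFn.mul_apply, F.g_apply, F.g_apply, hW, hW']
    rfl
  simp only [h1]
  rw [Finset.sum_comm]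
  refine Finset.sum_congr rfl fun i _ ↦ ?_
  rw [Finset.sum_comm]
  have h3 (k) : ∑ l, a l i * b l k = if i = k then 1 else 0 := by
    have := congrFun (congrFun hba k) i
    rw [Matrix.mul_apply, Matrix.one_apply] at this
    simp only [eq_comm (a := i), ← this, Matrix.transpose_apply]
    exact Finset.sum_congr rfl fun l _ ↦ mul_comm _ _
  simp [← Finset.sum_smul, h3]

end Tensor

end PseudoHermitian.LocalFrame

end

/-! ### Pointwise and algebraic operations: connection and torsion -/

section

namespace PseudoHermitianAlgebra

variable {A L : Type*} [CommRing A] [AddCommGroup L] [Module A L] {ι : Type*} [Fintype ι]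
  [DecidableEq ι] (S : PseudoHermitianAlgebra A L ι)

/-- The bilinear map whose trace is `∇_{X^H} Y^H`. -/
def koszulSMul (X Y : L) : L →ₗ[A] L →ₗ[A] L :=
  LinearMap.mk₂ A (fun Z Z' ↦ (S.half * S.koszulHom (S.P X) (S.P Y) Z') • Z)
    (fun Z Z' W ↦ smul_add ..) (fun a Z W ↦ smul_comm ..)
    (fun Z W W' ↦ by rw [map_add, mul_add, add_smul])
    (fun a Z W ↦ by rw [map_smul, smul_smul, smul_eq_mul, mul_left_comm])

lemma koszulSMul_apply (X Y Z Z' : L) :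
    S.koszulSMul X Y Z Z' = (S.half * S.koszul (S.P X) (S.P Y) Z') • Z := rfl

lemma nablaH_eq_sum (X Y : L) : S.nablaH X Y = ∑ i, S.koszulSMul X Y (S.e i) (S.f i) := rfl

end PseudoHermitianAlgebra

variable {m : ℕ} {M : Type*} [TopologicalSpace M]
  [ChartedSpace (EuclideanSpace ℝ (Fin (2 * m + 1))) M] {U : Opens M}
  [IsManifold (𝓡 (2 * m + 1)) ∞ M]

/-- `ext v` has constant coordinates in the trivialization at `x`, so it is smooth on the whole base
set, which does not depend on `v`. -/
lemma exists_smoothOn_ext (x : M) : ∃ V : Opens M, x ∈ V ∧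
    ∀ v : TangentSpace (𝓡 (2 * m + 1)) x, SmoothOn (ext v) V := by
  set t := trivializationAt (EuclideanSpace ℝ (Fin (2 * m + 1)))
    (fun x : M ↦ TangentSpace (𝓡 (2 * m + 1)) x) x with ht
  refine ⟨⟨t.baseSet, t.open_baseSet⟩, FiberBundle.mem_baseSet_trivializationAt' x, fun v ↦ ?_⟩
  intro y hy
  rw [t.contMDiffWithinAt_section _ hy]
  exact contMDiffWithinAt_const (c := (t ⟨x, v⟩).2) |>.congr_of_mem
    (fun z hz ↦ by
      have hz' : z ∈ t.baseSet := hz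
      simp [ext, FiberBundle.extend, ← ht, hz']) hy

namespace SmoothField

/-- Restriction to a smaller open set. -/
def res {V : Opens M} (hV : V ≤ U) (X : SmoothField m U) : SmoothField m V :=
  restr X.ext (X.smooth.mono hV)

lemma ext_res {V : Opens M} (hV : V ≤ U) (X : SmoothField m U) (y : V) :
    X.ext =ᶠ[𝓝 (y : M)] (X.res hV).ext :=
  (ext_eventuallyEq (fun _ ↦ rfl) y).symm

lemma res_apply {V : Opens M} (hV : V ≤ U) (X : SmoothField m U) (y : V) :
    (X.res hV).1 y = X.1 ⟨y, hV y.2⟩ := ext_apply X ⟨y, hV y.2⟩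

end SmoothField

namespace PseudoHermitian.LocalFrame

variable {S : PseudoHermitian m M} (F : S.LocalFrame U)

lemma exists_field {S : PseudoHermitian m M} (F : S.LocalFrame U) (y : U)
    (v : TangentSpace (𝓡 (2 * m + 1)) (y : M)) :
    ∃ X : SmoothField m U, X.1 y = v := by
  refine ⟨∑ i, (SmoothFn.const (S.g y v (F.f i y)) : SmoothFn m U) • F.algebra.e i +
    (SmoothFn.const (S.θ y v) : SmoothFn m U) • F.T, ?_⟩
  rw [SmoothField.add_apply, SmoothField.sum_apply, SmoothField.smul_apply, T_apply,
    SmoothFn.const_apply]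
  simp only [SmoothField.smul_apply, SmoothFn.const_apply]
  have := F.expand y v
  rw [proj, sub_eq_iff_eq_add] at this
  exact this.symm

/-- `ext u` need not be smooth on all of `U`. After shrinking `U`, it and `Z` both belong to the
algebra, and linearity of `koszul` in the last slot leaves only their common value at `y`. -/
lemma koszul_ext {X Y Z : SmoothField m U} {X' Y' : VField m M} {y : U}
    (hX : X' =ᶠ[𝓝 (y : M)] X.ext) (hY : Y' =ᶠ[𝓝 (y : M)] Y.ext)
    {u : TangentSpace (𝓡 (2 * m + 1)) (y : M)} (hZ : Z.1 y = u) :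
    S.koszul (S.hpart X') (S.hpart Y') (S.hpart (CR.ext u)) y =
      (F.algebra.koszul (F.algebra.P X) (F.algebra.P Y) (F.algebra.P Z)).1 y := by
  obtain ⟨V₀, hy₀, hu⟩ := exists_smoothOn_ext (m := m) (y : M)
  let V := U ⊓ V₀
  have hV : V ≤ U := inf_le_left
  let y' : V := ⟨y, y.2, hy₀⟩
  let F' := F.mono hV
  let W : SmoothField m V := SmoothField.restr (CR.ext u) ((hu u).mono inf_le_right)
  have hX' := F'.hpart_eventuallyEq (y := y') (hX.trans (X.ext_res hV y'))
  have hY' := F'.hpart_eventuallyEq (y := y') (hY.trans (Y.ext_res hV y'))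
  have hZ' := F'.hpart_eventuallyEq (y := y') (Z.ext_res hV y')
  have hW := F'.hpart_eventuallyEq (y := y')
    (SmoothField.ext_eventuallyEq (fun _ ↦ rfl) y' : W.ext =ᶠ[𝓝 (y' : M)] CR.ext u).symm
  rw [← F.koszul_apply (F.hpart_eventuallyEq hX) (F.hpart_eventuallyEq hY)
    (F.hpart_eventuallyEq (.refl _ Z.ext)), F'.koszul_apply hX' hY' hZ',
    F'.koszul_apply hX' hY' hW]
  refine F'.apply_congr (ev := SmoothFn.eval y') (SmoothFn.eval_smul y')
    (F'.algebra.koszulHom _ _) ?_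
  rw [P_apply, P_apply, SmoothField.res_apply]
  exact congrArg _ ((ext_self u).trans hZ.symm)

/-- The defining sum over the chosen orthonormal basis is a trace of `koszulSMul`, hence it may be
computed in the smooth frame. -/
lemma nablaH_apply {X Y : SmoothField m U} {X' Y' : VField m M} {y : U}
    (hX : X' =ᶠ[𝓝 (y : M)] X.ext) (hY : Y' =ᶠ[𝓝 (y : M)] Y.ext) :
    S.nablaH X' Y' y = (F.algebra.nablaH X Y).1 y := by
  choose W hW using fun l ↦ F.exists_field y (S.frame y l)
  have hPW (l) : (F.algebra.P (W l)).1 y = S.frame y l := by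
    rw [P_apply, hW, S.proj_of_hor ((S.frame_spec y).1 l)]
  have h := F.frame_sum (SmoothField.eval_smul y) (F.algebra.koszulSMul X Y) _ _ hPW hPW
  rw [PseudoHermitianAlgebra.nablaH_eq_sum, SmoothField.sum_apply]
  refine Eq.trans (Finset.sum_congr rfl fun l _ ↦ ?_) h
  rw [F.koszul_ext hX hY (hW l), SmoothField.eval_apply, PseudoHermitianAlgebra.koszulSMul_apply,
    SmoothField.smul_apply, SmoothFn.mul_apply, hPW]
  rfl

lemma nablaT_apply {Y : SmoothField m U} {Y' : VField m M} {y : U}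
    (hY : Y' =ᶠ[𝓝 (y : M)] Y.ext) : S.nablaT Y' y = (F.algebra.nablaT Y).1 y := by
  have hT := F.T_eventuallyEq y
  rw [PseudoHermitianAlgebra.nablaT, SmoothField.smul_apply, SmoothField.sub_apply, nablaT,
    F.br_apply hT (F.hpart_eventuallyEq hY), F.br_apply hT (F.Jf_eventuallyEq hY)]
  -- The definition applies `S.J` without projecting first; it agrees with `F.J` because the bracket
  -- of `T` with a horizontal field is horizontal.
  have h := F.J_hor (F.algebra.θ_br_T (F.algebra.θ_J Y)) y
  exact congrArg (fun v ↦ (1 / 2 : ℝ) • ((F.algebra.br F.T (F.algebra.P Y)).1 y - v)) h.symm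

lemma nabla_apply {X Y : SmoothField m U} {X' Y' : VField m M} {y : U}
    (hX : X' =ᶠ[𝓝 (y : M)] X.ext) (hY : Y' =ᶠ[𝓝 (y : M)] Y.ext) :
    S.nabla X' Y' y = (F.algebra.nabla X Y).1 y := by
  have h : SmoothFn.ext (S.θField Y) =ᶠ[𝓝 (y : M)] fun z ↦ S.θ z (Y.ext z) :=
    SmoothFn.ext_eventuallyEq (fun z ↦ by rw [S.θField_apply, SmoothField.ext_apply]) y
  have h' : (fun z ↦ S.θ z (Y' z)) =ᶠ[𝓝 (y : M)] SmoothFn.ext (S.θField Y) := by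
    filter_upwards [hY, h] with z h1 h2
    rw [h1, h2]
  rw [PseudoHermitianAlgebra.nabla_apply, SmoothField.add_apply, SmoothField.add_apply,
    SmoothField.smul_apply, SmoothField.smul_apply, nabla, F.nablaH_apply hX hY,
    F.nablaT_apply hY, dirDeriv_congr_of_eq hX.eq_of_nhds h', eq_apply hX, ← S.θField_apply]
  rfl

lemma nabla_eventuallyEq {X Y : SmoothField m U} {X' Y' : VField m M} {y : U}
    (hX : X' =ᶠ[𝓝 (y : M)] X.ext) (hY : Y' =ᶠ[𝓝 (y : M)] Y.ext) :
    S.nabla X' Y' =ᶠ[𝓝 (y : M)] (F.algebra.nabla X Y).ext := by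
  filter_upwards [hX.eventually_nhds, hY.eventually_nhds, U.isOpen.mem_nhds y.2] with z h1 h2 h3
  exact (F.nabla_apply (y := ⟨z, h3⟩) h1 h2).trans (SmoothField.ext_apply _ ⟨z, h3⟩).symm

lemma curvature_apply {X Y Z : SmoothField m U} {X' Y' Z' : VField m M} {y : U}
    (hX : X' =ᶠ[𝓝 (y : M)] X.ext) (hY : Y' =ᶠ[𝓝 (y : M)] Y.ext) (hZ : Z' =ᶠ[𝓝 (y : M)] Z.ext) :
    S.curvature X' Y' Z' y = (F.algebra.curvature X Y Z).1 y := by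
  rw [PseudoHermitianAlgebra.curvature_apply, SmoothField.sub_apply, SmoothField.sub_apply,
    curvature, F.nabla_apply hX (F.nabla_eventuallyEq hY hZ),
    F.nabla_apply hY (F.nabla_eventuallyEq hX hZ), F.nabla_apply (F.br_eventuallyEq hX hY) hZ]

lemma tau_apply {Y : SmoothField m U} {Y' : VField m M} {y : U}
    (hY : Y' =ᶠ[𝓝 (y : M)] Y.ext) : S.tau Y' y = (F.algebra.tau Y).1 y := by
  have hT := F.T_eventuallyEq y
  have hP := F.hpart_eventuallyEq hY
  have h0 : (F.algebra.nabla (F.algebra.P Y) F.T).1 y = 0 := by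
    have : F.algebra.nabla (F.algebra.P Y) F.T = 0 := F.algebra.nabla_T_right _
    rw [this]
    rfl
  rw [PseudoHermitianAlgebra.tau_apply, SmoothField.sub_apply, tau, torsion,
    F.nabla_apply hT hP, F.nabla_apply hP hT, F.br_apply hT hP, h0, sub_zero]
  rfl

lemma tau_eventuallyEq {Y : SmoothField m U} {Y' : VField m M} {y : U}
    (hY : Y' =ᶠ[𝓝 (y : M)] Y.ext) : S.tau Y' =ᶠ[𝓝 (y : M)] (F.algebra.tau Y).ext := by
  filter_upwards [hY.eventually_nhds, U.isOpen.mem_nhds y.2] with z h2 h3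
  exact (F.tau_apply (y := ⟨z, h3⟩) h2).trans (SmoothField.ext_apply _ ⟨z, h3⟩).symm

lemma nablaTau_apply {X Y : SmoothField m U} {X' Y' : VField m M} {y : U}
    (hX : X' =ᶠ[𝓝 (y : M)] X.ext) (hY : Y' =ᶠ[𝓝 (y : M)] Y.ext) :
    S.nablaTau X' Y' y = (F.algebra.nablaTau X Y).1 y := by
  rw [PseudoHermitianAlgebra.nablaTau_apply, SmoothField.sub_apply, nablaTau,
    F.nabla_apply hX (F.tau_eventuallyEq hY),
    F.tau_apply (F.nabla_eventuallyEq hX hY)]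

end PseudoHermitian.LocalFrame

end

/-! ### Pointwise and algebraic operations: curvature, Ricci, divergence -/

section

variable {m : ℕ} {M : Type*} [TopologicalSpace M]
  [ChartedSpace (EuclideanSpace ℝ (Fin (2 * m + 1))) M] {U : Opens M}
  [IsManifold (𝓡 (2 * m + 1)) ∞ M]

namespace PseudoHermitianAlgebra

lemma curvature_P {A L : Type*} [CommRing A] [AddCommGroup L] [Module A L] {ι : Type*} [Fintype ι]
    [DecidableEq ι] (S : PseudoHermitianAlgebra A L ι) (X Y Z : L) :
    S.curvature X Y (S.P Z) = S.curvature X Y Z := by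
  conv_rhs => rw [S.eq_P_add Z]
  simp

end PseudoHermitianAlgebra

namespace PseudoHermitian.LocalFrame

variable {S : PseudoHermitian m M} (F : S.LocalFrame U)

/-- On a neighbourhood where the extensions `ext` are smooth, they and the given fields have the
same values at `y`, and the curvature is linear over functions in all three slots. -/
lemma curvatureAt_eq (y : U) (X Y Z : SmoothField m U) :
    S.curvatureAt y (X.1 y) (Y.1 y) (Z.1 y) = (F.algebra.curvature X Y Z).1 y := by
  obtain ⟨V₁, hy₁, h₁⟩ := exists_smoothOn_ext (m := m) (y : M)
  let V := U ⊓ V₁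
  have hV : V ≤ U := inf_le_left
  let y' : V := ⟨y, y.2, hy₁⟩
  let F' := F.mono hV
  have key {u : TangentSpace (𝓡 (2 * m + 1)) (y : M)} (X : SmoothField m U) (hu : X.1 y = u) :
      ∃ W : SmoothField m V,
        CR.ext u =ᶠ[𝓝 (y' : M)] W.ext ∧ W.1 y' = (X.res hV).1 y' :=
    ⟨SmoothField.restr (CR.ext u) ((h₁ u).mono inf_le_right),
      (SmoothField.ext_eventuallyEq (fun _ ↦ rfl) y').symm, by
      rw [SmoothField.res_apply]; exact (ext_self u).trans hu.symm⟩
  obtain ⟨X', hX, hX'⟩ := key X rfl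
  obtain ⟨Y', hY, hY'⟩ := key Y rfl
  obtain ⟨Z', hZ, hZ'⟩ := key Z rfl
  rw [curvatureAt, F'.curvature_apply hX hY hZ,
    ← F.curvature_apply (.refl _ X.ext) (.refl _ Y.ext) (.refl _ Z.ext),
    F'.curvature_apply (X.ext_res hV y') (Y.ext_res hV y') (Z.ext_res hV y')]
  exact F'.apply_congr₃ (SmoothField.eval_smul y') F'.algebra.curvature hX' hY' hZ'

lemma nablaTau_ext (y : U) (X : SmoothField m U) :
    S.nablaTau (S.hpart (CR.ext (X.1 y))) (S.hpart (CR.ext (X.1 y))) y =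
      (F.algebra.nablaTau (F.algebra.P X) (F.algebra.P X)).1 y := by
  obtain ⟨V₁, hy₁, h₁⟩ := exists_smoothOn_ext (m := m) (y : M)
  let V := U ⊓ V₁
  have hV : V ≤ U := inf_le_left
  let y' : V := ⟨y, y.2, hy₁⟩
  let F' := F.mono hV
  let W : SmoothField m V := SmoothField.restr (CR.ext (X.1 y)) ((h₁ _).mono inf_le_right)
  have hW : W.1 y' = (X.res hV).1 y' := by
    rw [SmoothField.res_apply]; exact ext_self (X.1 y)
  have hPW : (F'.algebra.P W).1 y' = (F'.algebra.P (X.res hV)).1 y' := by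
    rw [P_apply, P_apply, hW]
  have h := F'.hpart_eventuallyEq (y := y')
    (SmoothField.ext_eventuallyEq (fun _ ↦ rfl) y' : W.ext =ᶠ[𝓝 (y' : M)] CR.ext (X.1 y)).symm
  have hX := F'.hpart_eventuallyEq (y := y') (X.ext_res hV y')
  have hX' := F.hpart_eventuallyEq (y := y) (.refl _ X.ext)
  rw [F'.nablaTau_apply h h, ← F.nablaTau_apply hX' hX', F'.nablaTau_apply hX hX]
  exact F'.apply_congr₂ (SmoothField.eval_smul y') F'.algebra.nablaTau hPW hPW

lemma divTau_eq (y : U) : S.divTau y = F.algebra.divTau.1 y := by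
  choose W hW using fun l ↦ F.exists_field y (S.frame y l)
  have hPW (l) : (F.algebra.P (W l)).1 y = S.frame y l := by
    rw [P_apply, hW, S.proj_of_hor ((S.frame_spec y).1 l)]
  have h := F.frame_sum (SmoothField.eval_smul y) F.algebra.nablaTau _ _ hPW hPW
  rw [PseudoHermitianAlgebra.divTau, SmoothField.sum_apply]
  refine Eq.trans (Finset.sum_congr rfl fun l _ ↦ ?_) h
  rw [← hW, F.nablaTau_ext, SmoothField.eval_apply]

lemma ricci_eq (y : U) (X : SmoothField m U) : S.ricci y (X.1 y) = (F.algebra.ricci X).1 y := by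
  choose W hW using fun l ↦ F.exists_field y (S.frame y l)
  have h := F.frame_sum (SmoothField.eval_smul y) (F.algebra.curvature X) _ _ hW hW
  rw [PseudoHermitianAlgebra.ricci, SmoothField.sum_apply]
  refine Eq.trans (Finset.sum_congr rfl fun l _ ↦ ?_) h
  rw [← hW, F.curvatureAt_eq, SmoothField.eval_apply]

lemma ricciForm_eq (y : U) (X Y : SmoothField m U) :
    S.ricciForm y (X.1 y) (Y.1 y) = (F.algebra.ricciForm X Y).1 y := by
  choose W hW using fun l ↦ F.exists_field y (S.frame y l)
  have hJW (l) : (F.J (W l)).1 y = S.J y (S.frame y l) := by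
    rw [J_apply, hW, S.proj_of_hor ((S.frame_spec y).1 l)]
  let B : SmoothField m U →ₗ[SmoothFn m U] SmoothField m U →ₗ[SmoothFn m U] SmoothFn m U :=
    ((F.algebra.curvature.comp F.algebra.J).compr₂ (LinearMap.applyₗ X)).compr₂
      (F.algebra.g.flip Y)
  have h := F.frame_sum (SmoothFn.eval_smul y) B _ _ hW hW
  rw [PseudoHermitianAlgebra.ricciForm, SmoothFn.mul_apply, SmoothFn.sum_apply, ricciForm]
  refine congrArg ((1 / 2 : ℝ) * ·) (Eq.trans (Finset.sum_congr rfl fun l _ ↦ ?_) h)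
  rw [← F.P_apply, ← F.P_apply, ← hJW, ← hW, F.curvatureAt_eq, ← F.g_apply, SmoothFn.eval_apply,
    PseudoHermitianAlgebra.g_P_right, PseudoHermitianAlgebra.curvature_P]
  rfl

end PseudoHermitian.LocalFrame

end

/-! ### Existence of local frames and smoothness of `T` -/

section

variable {m : ℕ} {M : Type*} [TopologicalSpace M]
  [ChartedSpace (EuclideanSpace ℝ (Fin (2 * m + 1))) M] {U : Opens M}

lemma contMDiffOn_det {ι : Type*} [Fintype ι] [DecidableEq ι] {G : M → Matrix ι ι ℝ}
    (hG : ∀ i j, ContMDiffOn (𝓡 (2 * m + 1)) 𝓘(ℝ) ∞ (fun y ↦ G y i j) U) :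
    ContMDiffOn (𝓡 (2 * m + 1)) 𝓘(ℝ) ∞ (fun y ↦ (G y).det) U := by
  simp only [Matrix.det_apply']
  exact contMDiffOn_finsetSum fun σ _ ↦ contMDiffOn_const.mul
    (contMDiffOn_finsetProd fun i _ ↦ hG _ _)

/-- Cramer's rule: entries of the inverse are quotients of determinants. -/
lemma contMDiffOn_nonsing_inv {ι : Type*} [Fintype ι] [DecidableEq ι] {G : M → Matrix ι ι ℝ}
    (hG : ∀ i j, ContMDiffOn (𝓡 (2 * m + 1)) 𝓘(ℝ) ∞ (fun y ↦ G y i j) U)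
    (hdet : ∀ y : U, (G y).det ≠ 0) (i j : ι) :
    ContMDiffOn (𝓡 (2 * m + 1)) 𝓘(ℝ) ∞ (fun y ↦ (G y)⁻¹ i j) U := by
  have h1 : ContMDiffOn (𝓡 (2 * m + 1)) 𝓘(ℝ) ∞
      (fun y ↦ ((G y).updateRow j (Pi.single i 1)).det) U := by
    refine contMDiffOn_det fun k l ↦ ?_
    by_cases hk : k = j
    · subst hk
      simpa using contMDiffOn_const
    · simpa [Matrix.updateRow_ne hk] using hG k l
  refine ((contMDiffOn_det hG).inv₀ fun y hy ↦ hdet ⟨y, hy⟩).mul h1 |>.congr fun y hy ↦ ?_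
  simp [Matrix.inv_def, Matrix.adjugate_apply, Ring.inverse_eq_inv']

variable [IsManifold (𝓡 (2 * m + 1)) ∞ M]

lemma SmoothOn.smul {a : M → ℝ} {X : VField m M}
    (ha : ContMDiffOn (𝓡 (2 * m + 1)) 𝓘(ℝ) ∞ a U) (hX : SmoothOn X U) :
    SmoothOn (fun y ↦ a y • X y) U := ContMDiffOn.smul_section ha hX

lemma SmoothOn.sub {X Y : VField m M} (hX : SmoothOn X U) (hY : SmoothOn Y U) :
    SmoothOn (fun y ↦ X y - Y y) U := ContMDiffOn.sub_section hX hY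

lemma SmoothOn.sum {ι : Type*} [Fintype ι] {X : ι → VField m M} (hX : ∀ i, SmoothOn (X i) U) :
    SmoothOn (fun y ↦ ∑ i, X i y) U := ContMDiffOn.sum_section fun i _ ↦ hX i

namespace PseudoHermitian

variable (S : PseudoHermitian m M)

lemma contMDiffOn_dθ {X Y : VField m M} (hX : SmoothOn X U) (hY : SmoothOn Y U) :
    ContMDiffOn (𝓡 (2 * m + 1)) 𝓘(ℝ) ∞ (fun y ↦ S.dθ y (X y) (Y y)) U := by
  refine ((contMDiffOn_dirDeriv hX (S.SmoothOn_θ hY)).sub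
    (contMDiffOn_dirDeriv hY (S.SmoothOn_θ hX))).sub (S.SmoothOn_θ (hX.bracket hY)) |>.congr
      fun y hy ↦ ?_
  exact extDerivOneAt_field S.smooth_θ (hX.smoothAt ⟨y, hy⟩) (hY.smoothAt ⟨y, hy⟩)

lemma contMDiffOn_g {X Y : VField m M} (hX : SmoothOn X U) (hY : SmoothOn Y U)
    (h : ∀ y : U, S.θ y (Y y) = 0) :
    ContMDiffOn (𝓡 (2 * m + 1)) 𝓘(ℝ) ∞ (fun y ↦ S.g y (X y) (Y y)) U := by
  refine (contMDiffOn_const (c := (1 / 2 : ℝ))).mul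
    (S.contMDiffOn_dθ hX (S.SmoothOn_J hY)) |>.congr fun y hy ↦ ?_
  rw [g, S.proj_of_hor (h ⟨y, hy⟩)]
  rfl

/-- A smooth horizontal frame has a smooth dual frame. -/
lemma nonempty_localFrame {A : VField m M} {h : Fin (2 * m) → VField m M} (hA : SmoothOn A U)
    (hA0 : ∀ y : U, S.θ y (A y) ≠ 0) (hh : ∀ i, SmoothOn (h i) U)
    (hθ : ∀ i (y : U), S.θ y (h i y) = 0)
    (hdet : ∀ y : U, (Matrix.of fun i j ↦ S.g y (h i y) (h j y)).det ≠ 0) :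
    Nonempty (S.LocalFrame U) := by
  let G : M → Matrix (Fin (2 * m)) (Fin (2 * m)) ℝ :=
    fun y ↦ Matrix.of fun i j ↦ S.g y (h i y) (h j y)
  have hG (i j) : ContMDiffOn (𝓡 (2 * m + 1)) 𝓘(ℝ) ∞ (fun y ↦ G y i j) U :=
    S.contMDiffOn_g (hh i) (hh j) (hθ j)
  -- The inverse Gram matrix produces the dual frame.
  let f : Fin (2 * m) → VField m M := fun k y ↦ ∑ j, (G y)⁻¹ j k • h j y
  have hf (k) : SmoothOn (f k) U :=
    SmoothOn.sum fun j ↦ SmoothOn.smul (contMDiffOn_nonsing_inv hG hdet j k) (hh j)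
  have hθf (k) (y : U) : S.θ y (f k y) = 0 := by simp [f, map_sum, hθ]
  have hdual (i k) (y : U) : S.g y (h i y) (f k y) = if i = k then 1 else 0 := by
    have h1 := congrFun (congrFun (Matrix.mul_nonsing_inv (G y) (isUnit_iff_ne_zero.2 (hdet y))) i) k
    rw [Matrix.mul_apply, Matrix.one_apply] at h1
    rw [← h1, ← gHom_apply]
    simp only [f, map_sum, map_smul, smul_eq_mul]
    exact Finset.sum_congr rfl fun j _ ↦ mul_comm _ _
  have hexp (y : U) (v) : S.proj y v = ∑ i, S.g y v (f i y) • h i y := by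
    let b : Fin (2 * m) → S.hor (y : M) := fun i ↦ ⟨h i y, hθ i y⟩
    have key (c : Fin (2 * m) → ℝ) (k) : S.g y (∑ i, c i • h i y) (f k y) = c k := by
      rw [← gHom_apply]
      simp [gHom_apply, hdual]
    -- Pairing with the dual frame recovers coefficients, hence independence; since `ker θ` has rank
    -- `2m`, the `h i y` form a basis of it.
    have hb : LinearIndependent ℝ b := by
      rw [Fintype.linearIndependent_iff]
      intro c hc k
      have h2 : ∑ i, c i • h i y = 0 := by simpa [b] using congrArg Subtype.val hc
      have h3 := key c k
      rw [h2, ← gHom_apply] at h3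
      simpa using h3.symm
    have := finite_tangent (m := m) (y : M)
    let B := Module.Basis.mk hb
      (hb.span_eq_top_of_card_eq_finrank' (by rw [S.finrank_hor]; simp)).ge
    have h4 : S.proj y v = ∑ i, B.repr ⟨S.proj y v, S.θ_proj y v⟩ i • h i y := by
      have := congrArg Subtype.val (B.sum_repr ⟨S.proj y v, S.θ_proj y v⟩)
      simpa [B, b] using this.symm
    have h5 (k) : S.g y v (f k y) = B.repr ⟨S.proj y v, S.θ_proj y v⟩ k := by
      rw [← S.g_proj_left]
      exact (congrArg (fun w ↦ S.g y w (f k y)) h4).trans (key _ k)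
    simp only [h5]
    exact h4
  -- `T` was chosen pointwise. The frame expansion gives `A - ∑ g(A, f_i) h_i = θ(A) T`, whose
  -- left-hand side is smooth, so `T` is smooth after division by `θ(A)`.
  have hT : SmoothOn S.T U := by
    refine (SmoothOn.smul ((S.SmoothOn_θ hA).inv₀ fun y hy ↦ hA0 ⟨y, hy⟩)
      (hA.sub (SmoothOn.sum fun i ↦ SmoothOn.smul (S.contMDiffOn_g hA (hf i) (hθf i)) (hh i)))).congr'
      fun y ↦ ?_
    rw [← hexp, proj, sub_sub_cancel, smul_smul, inv_mul_cancel₀ (hA0 y), one_smul]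
  exact ⟨⟨h, f, hh, hf, hT, hθ, hθf, hdual, hexp⟩⟩

/-- Extend the orthonormal basis at `x` and project to `ker θ` along `ext (S.T x)`, since `T` itself
is not yet known to be smooth. Two shrinkings keep `θ` of this field and the Gram determinant
nonzero; both equal `1` at `x`. -/
lemma exists_localFrame (x : M) : ∃ U : Opens M, x ∈ U ∧ Nonempty (S.LocalFrame U) := by
  obtain ⟨V, hx, hV⟩ := exists_smoothOn_ext (m := m) x
  let a : M → ℝ := fun y ↦ S.θ y (ext (S.T x) y)
  have ha : ContMDiffOn (𝓡 (2 * m + 1)) 𝓘(ℝ) ∞ a V := S.SmoothOn_θ (hV (S.T x))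
  have hax : a x = 1 := by simp [a, S.θ_T]
  let V₁ : Opens M := ⟨V ∩ a ⁻¹' {0}ᶜ,
    ha.continuousOn.isOpen_inter_preimage V.isOpen isOpen_compl_singleton⟩
  have hV₁ : V₁ ≤ V := fun y hy ↦ hy.1
  let h : Fin (2 * m) → VField m M := fun i y ↦ ext (S.frame x i) y -
    (S.θ y (ext (S.frame x i) y) * (a y)⁻¹) • ext (S.T x) y
  have hh (i) : SmoothOn (h i) V₁ := by
    have h1 : SmoothOn (ext (S.frame x i)) V₁ := (hV _).mono hV₁
    exact h1.sub (SmoothOn.smul ((S.SmoothOn_θ h1).mul ((ha.mono hV₁).inv₀ fun y hy ↦ hy.2))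
      ((hV _).mono hV₁))
  have hθ (i) (y : V₁) : S.θ y (h i y) = 0 := by
    have : a y ≠ 0 := y.2.2
    change S.θ y (_ - _ • _) = 0
    rw [map_sub, map_smul, smul_eq_mul, mul_assoc]
    change _ - _ * ((a y)⁻¹ * a y) = 0
    rw [inv_mul_cancel₀ this, mul_one, sub_self]
  have hhx (i) : h i x = S.frame x i := by
    simp [h, (S.frame_spec x).1 i]
  let d : M → ℝ := fun y ↦ (Matrix.of fun i j ↦ S.g y (h i y) (h j y)).det
  have hd : ContMDiffOn (𝓡 (2 * m + 1)) 𝓘(ℝ) ∞ d V₁ :=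
    contMDiffOn_det fun i j ↦ S.contMDiffOn_g (hh i) (hh j) (hθ j)
  have hdx : d x = 1 := by
    have : (Matrix.of fun i j ↦ S.g x (h i x) (h j x)) = 1 := by
      ext i j
      rw [Matrix.of_apply, hhx, hhx, (S.frame_spec x).2, Matrix.one_apply]
    simp only [d]
    rw [this, Matrix.det_one]
  let U : Opens M := ⟨V₁ ∩ d ⁻¹' {0}ᶜ,
    hd.continuousOn.isOpen_inter_preimage V₁.isOpen isOpen_compl_singleton⟩
  have hU : U ≤ V₁ := fun y hy ↦ hy.1
  refine ⟨U, ⟨⟨hx, ?_⟩, ?_⟩, S.nonempty_localFrame ((hV (S.T x)).mono (hU.trans hV₁))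
    (fun y ↦ y.2.1.2) (fun i ↦ (hh i).mono hU) (fun i y ↦ hθ i ⟨y, hU y.2⟩) (fun y ↦ y.2.2)⟩
  · simp [hax]
  · simp [hdx]

end PseudoHermitian

end

/-! ### Tensoriality of the exterior derivative of a `2`-form -/

section

variable {m : ℕ} {M : Type*} [TopologicalSpace M]
  [ChartedSpace (EuclideanSpace ℝ (Fin (2 * m + 1))) M]

lemma mdifferentiableAt_sum {ι : Type*} (s : Finset ι) {f : ι → M → ℝ} {x : M}
    (hf : ∀ i, MDifferentiableAt (𝓡 (2 * m + 1)) 𝓘(ℝ) (f i) x) :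
    MDifferentiableAt (𝓡 (2 * m + 1)) 𝓘(ℝ) (fun y ↦ ∑ i ∈ s, f i y) x := by
  classical
  induction s using Finset.induction_on with
  | empty => simpa using mdifferentiableAt_const
  | insert a s ha h => simp only [Finset.sum_insert ha]; exact (hf a).add h

lemma dirDeriv_neg (X : VField m M) (f : M → ℝ) (x : M) :
    dirDeriv X (fun y ↦ - f y) x = - dirDeriv X f x := by
  have : mvfderiv (𝓡 (2 * m + 1)) (-f) x = - mvfderiv (𝓡 (2 * m + 1)) f x := mfderiv_neg
  exact congrArg (· (X x)) this

variable [IsManifold (𝓡 (2 * m + 1)) ∞ M]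

/-- Differentiability of a vector field at a point. -/
def DiffAt (X : VField m M) (x : M) : Prop :=
  MDifferentiableAt (𝓡 (2 * m + 1)) (𝓡 (2 * m + 1)).tangent
    (fun y ↦ (⟨y, X y⟩ : TangentBundle (𝓡 (2 * m + 1)) M)) x

/-- Coefficients of merely differentiable fields are included because `TensorialAt` tests
differentiable, not smooth, vector fields. -/
lemma exists_coordinates (x : M) : ∃ (V : Opens M) (E : Fin (2 * m + 1) → VField m M)
    (c : Fin (2 * m + 1) → (y : M) → TangentSpace (𝓡 (2 * m + 1)) y →ₗ[ℝ] ℝ),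
    x ∈ V ∧ (∀ i, SmoothOn (E i) V) ∧ (∀ y ∈ V, ∀ v, v = ∑ i, c i y v • E i y) ∧
    (∀ X, SmoothAt X x → ∀ i,
      ContMDiffAt (𝓡 (2 * m + 1)) 𝓘(ℝ) ∞ (fun y ↦ c i y (X y)) x) ∧
    (∀ X, DiffAt X x → ∀ i,
      MDifferentiableAt (𝓡 (2 * m + 1)) 𝓘(ℝ) (fun y ↦ c i y (X y)) x) := by
  let t := trivializationAt (EuclideanSpace ℝ (Fin (2 * m + 1)))
    (fun x : M ↦ TangentSpace (𝓡 (2 * m + 1)) x) x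
  let b := (EuclideanSpace.basisFun (Fin (2 * m + 1)) ℝ).toBasis
  have hx : x ∈ t.baseSet := FiberBundle.mem_baseSet_trivializationAt' x
  refine ⟨⟨t.baseSet, t.open_baseSet⟩, t.localFrame b, t.localFrameCoeff (𝓡 (2 * m + 1)) b, hx,
    fun i ↦ t.contMDiffOn_localFrame_baseSet _ b i, fun y hy v ↦ ?_,
    fun X hX i ↦ contMDiffAt_localFrameCoeff b hx hX i,
    fun X hX i ↦ mdifferentiableAt_localFrameCoeff b hx hX i⟩
  have := t.eq_sum_localFrameCoeff_smul (I := 𝓡 (2 * m + 1)) (b := b) (s := ext v) (x' := y) hy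
  rwa [ext_self] at this

/-- Smooth `2`-forms. -/
structure SmoothTwoForm (β : TwoTensor m M) : Prop where
  add_left : ∀ x u u' v, β x (u + u') v = β x u v + β x u' v
  smul_left : ∀ x (c : ℝ) u v, β x (c • u) v = c * β x u v
  swap : ∀ x u v, β x u v = - β x v u
  smooth : ∀ (V : Opens M) (X Y : VField m M), SmoothOn X V → SmoothOn Y V →
    ContMDiffOn (𝓡 (2 * m + 1)) 𝓘(ℝ) ∞ (fun y ↦ β y (X y) (Y y)) V

lemma extDerivTwo_swap_left {β : TwoTensor m M} (h : SmoothTwoForm β) (X Y Z : VField m M) (x : M) :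
    extDerivTwo β X Y Z x = - extDerivTwo β Y X Z x := by
  have h1 : (fun y ↦ β y (Y y) (X y)) = fun y ↦ - β y (X y) (Y y) := funext fun y ↦ h.swap ..
  have h2 : bracket Y X x = (-1 : ℝ) • bracket X Y x := by
    rw [neg_smul, one_smul]; exact mlieBracket_swap_apply
  rw [extDerivTwo, extDerivTwo, h1, dirDeriv_neg, h2, h.smul_left]
  ring

lemma extDerivTwo_swap_right {β : TwoTensor m M} (h : SmoothTwoForm β) (X Y Z : VField m M)
    (x : M) : extDerivTwo β X Y Z x = - extDerivTwo β X Z Y x := by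
  have h1 : (fun y ↦ β y (Z y) (Y y)) = fun y ↦ - β y (Y y) (Z y) := funext fun y ↦ h.swap ..
  have h2 : bracket Z Y x = (-1 : ℝ) • bracket Y Z x := by
    rw [neg_smul, one_smul]; exact mlieBracket_swap_apply
  rw [extDerivTwo, extDerivTwo, h1, dirDeriv_neg, h2, h.smul_left]
  ring

namespace SmoothTwoForm

variable {β : TwoTensor m M}

lemma add_right (h : SmoothTwoForm β) (x : M) (u v v') : β x u (v + v') = β x u v + β x u v' := by
  rw [h.swap, h.add_left, h.swap x v, h.swap x v']; ring

lemma smul_right (h : SmoothTwoForm β) (x : M) (c : ℝ) (u v) : β x u (c • v) = c * β x u v := by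
  rw [h.swap, h.smul_left, h.swap x v]; ring

lemma sum_left (h : SmoothTwoForm β) (x : M) {ι : Type*} [Fintype ι] (c : ι → ℝ)
    (u : ι → TangentSpace (𝓡 (2 * m + 1)) x)
    (v) : β x (∑ i, c i • u i) v = ∑ i, c i * β x (u i) v := by
  let B : TangentSpace (𝓡 (2 * m + 1)) x →ₗ[ℝ] ℝ :=
    { toFun := fun u ↦ β x u v, map_add' := fun u u' ↦ h.add_left x u u' v,
      map_smul' := fun c u ↦ h.smul_left x c u v }
  exact (map_sum B _ _).trans (Finset.sum_congr rfl fun i _ ↦ map_smul B _ _)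

lemma sum_right (h : SmoothTwoForm β) (x : M) {ι : Type*} [Fintype ι] (c : ι → ℝ)
    (v : ι → TangentSpace (𝓡 (2 * m + 1)) x) (u) :
    β x u (∑ i, c i • v i) = ∑ i, c i * β x u (v i) := by
  rw [h.swap, h.sum_left, ← Finset.sum_neg_distrib]
  exact Finset.sum_congr rfl fun i _ ↦ by rw [h.swap x u, mul_neg]

lemma eventuallyEq_sum (h : SmoothTwoForm β) {V : Opens M} {x : M} (hx : x ∈ V) {ι : Type*} [Fintype ι]
    {E : ι → VField m M} {c : ι → (y : M) → TangentSpace (𝓡 (2 * m + 1)) y →ₗ[ℝ] ℝ}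
    (hc : ∀ y ∈ V, ∀ v, v = ∑ i, c i y v • E i y) (X Y : VField m M) :
    (fun y ↦ β y (X y) (Y y)) =ᶠ[𝓝 x]
      fun y ↦ ∑ i, ∑ j, c i y (X y) * (c j y (Y y) * β y (E i y) (E j y)) := by
  filter_upwards [V.isOpen.mem_nhds hx] with y hy
  conv_lhs => rw [hc y hy (X y), h.sum_left]
  refine Finset.sum_congr rfl fun i _ ↦ ?_
  conv_lhs => rw [hc y hy (Y y), h.sum_right, Finset.mul_sum]

lemma contMDiffAt (h : SmoothTwoForm β) {X Y : VField m M} {x : M} (hX : SmoothAt X x) (hY : SmoothAt Y x) :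
    ContMDiffAt (𝓡 (2 * m + 1)) 𝓘(ℝ) ∞ (fun y ↦ β y (X y) (Y y)) x := by
  obtain ⟨V, E, c, hx, hE, hc, hs, -⟩ := exists_coordinates (m := m) x
  refine ContMDiffAt.congr_of_eventuallyEq ?_ (h.eventuallyEq_sum hx hc X Y)
  exact contMDiffAt_finsetSum fun i _ ↦ contMDiffAt_finsetSum fun j _ ↦
    (hs X hX i).mul ((hs Y hY j).mul
      ((h.smooth V _ _ (hE i) (hE j)).contMDiffAt (V.isOpen.mem_nhds hx)))

lemma mdifferentiableAt (h : SmoothTwoForm β) {X Y : VField m M} {x : M} (hX : DiffAt X x) (hY : DiffAt Y x) :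
    MDifferentiableAt (𝓡 (2 * m + 1)) 𝓘(ℝ) (fun y ↦ β y (X y) (Y y)) x := by
  obtain ⟨V, E, c, hx, hE, hc, -, hs⟩ := exists_coordinates (m := m) x
  refine MDifferentiableAt.congr_of_eventuallyEq ?_ (h.eventuallyEq_sum hx hc X Y)
  exact mdifferentiableAt_sum _ fun i ↦ mdifferentiableAt_sum _ fun j ↦
    (hs X hX i).mul ((hs Y hY j).mul
      (((h.smooth V _ _ (hE i) (hE j)).contMDiffAt (V.isOpen.mem_nhds hx)).mdifferentiableAt
        (by simp)))

lemma tensorialAt (h : SmoothTwoForm β) {Y Z : VField m M} {x : M} (hY : DiffAt Y x) (hZ : DiffAt Z x) :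
    TensorialAt (𝓡 (2 * m + 1)) (EuclideanSpace ℝ (Fin (2 * m + 1)))
      (fun X : VField m M ↦ extDerivTwo β X Y Z x) x where
  smul {f X} hf hX := by
    have e (W : VField m M) : (fun y ↦ β y ((f • X) y) (W y)) = fun y ↦ f y * β y (X y) (W y) :=
      funext fun y ↦ h.smul_left ..
    have e2 (W : VField m M) : bracket (f • X) W x =
        f x • bracket X W x + (- dirDeriv W f x) • X x := by
      rw [bracket, mlieBracket_smul_left hf hX, dirDeriv]
      module
    simp only [extDerivTwo, e, e2, h.add_left, h.smul_left, smul_eq_mul]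
    rw [show (f • X) x = f x • X x from rfl, h.smul_right]
    simp only [dirDeriv, mvfderiv_fun_mul hf (h.mdifferentiableAt hX hZ),
      mvfderiv_fun_mul hf (h.mdifferentiableAt hX hY)]
    simp
    ring
  add {X X'} hX hX' := by
    have e (W : VField m M) : (fun y ↦ β y ((X + X') y) (W y)) =
        fun y ↦ β y (X y) (W y) + β y (X' y) (W y) := funext fun y ↦ h.add_left ..
    have e2 (W : VField m M) : bracket (X + X') W x = bracket X W x + bracket X' W x :=
      mlieBracket_add_left hX hX'
    simp only [extDerivTwo, e, e2, h.add_left]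
    rw [show (X + X') x = X x + X' x from rfl, h.add_right]
    simp only [dirDeriv, mvfderiv_fun_add (h.mdifferentiableAt hX hZ) (h.mdifferentiableAt hX' hZ),
      mvfderiv_fun_add (h.mdifferentiableAt hX hY) (h.mdifferentiableAt hX' hY)]
    simp
    ring

/-- Tensoriality in the first slot suffices: the alternating property carries it to the other two.
-/
lemma extDerivTwo_congr (h : SmoothTwoForm β) {X X' Y Y' Z Z' : VField m M} {x : M} (hX : DiffAt X x)
    (hX' : DiffAt X' x) (hY : DiffAt Y x) (hY' : DiffAt Y' x) (hZ : DiffAt Z x)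
    (hZ' : DiffAt Z' x) (eX : X x = X' x) (eY : Y x = Y' x) (eZ : Z x = Z' x) :
    extDerivTwo β X Y Z x = extDerivTwo β X' Y' Z' x := by
  rw [(h.tensorialAt hY hZ).pointwise hX hX' eX, extDerivTwo_swap_left h,
    (h.tensorialAt hX' hZ).pointwise hY hY' eY, ← extDerivTwo_swap_left h,
    extDerivTwo_swap_right h, extDerivTwo_swap_left h,
    (h.tensorialAt hX' hY').pointwise hZ hZ' eZ, ← extDerivTwo_swap_left h,
    ← extDerivTwo_swap_right h]

end SmoothTwoForm

end

/-! ### The Ricci form on the manifold and injectivity of the wedge with `dθ` -/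

section

namespace PseudoHermitianAlgebra

variable {A L : Type*} [CommRing A] [AddCommGroup L] [Module A L] {ι : Type*} [Fintype ι]
  [DecidableEq ι] (S : PseudoHermitianAlgebra A L ι)

lemma ricciForm_add_left (X X' Y : L) :
    S.ricciForm (X + X') Y = S.ricciForm X Y + S.ricciForm X' Y := by
  simp [ricciForm, Finset.sum_add_distrib, mul_add]

lemma ricciForm_smul_left (a : A) (X Y : L) :
    S.ricciForm (a • X) Y = a * S.ricciForm X Y := by
  simp only [ricciForm, map_smul, LinearMap.smul_apply, smul_eq_mul, ← Finset.mul_sum]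
  ring

lemma ricciForm_T_left (Y : L) : S.ricciForm S.T Y = 0 := by
  simp [ricciForm]

lemma θ_ricci (X : L) : S.θ (S.ricci X) = 0 := by
  simp [ricci, θ_curvature]

end PseudoHermitianAlgebra

variable {m : ℕ} {M : Type*} [TopologicalSpace M]
  [ChartedSpace (EuclideanSpace ℝ (Fin (2 * m + 1))) M] {U : Opens M}
  [IsManifold (𝓡 (2 * m + 1)) ∞ M]

namespace PseudoHermitian

variable {S : PseudoHermitian m M}

namespace LocalFrame

variable (F : S.LocalFrame U)

lemma ricciForm_eventuallyEq {X Y : SmoothField m U} {X' Y' : VField m M} {y : U}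
    (hX : X' =ᶠ[𝓝 (y : M)] X.ext) (hY : Y' =ᶠ[𝓝 (y : M)] Y.ext) :
    (fun z ↦ S.ricciForm z (X' z) (Y' z)) =ᶠ[𝓝 (y : M)] (F.algebra.ricciForm X Y).ext := by
  have h := SmoothFn.ext_eventuallyEq (f := F.algebra.ricciForm X Y)
    (f' := fun z ↦ S.ricciForm z (X.ext z) (Y.ext z))
    (fun z ↦ by rw [SmoothField.ext_apply, SmoothField.ext_apply, F.ricciForm_eq]) y
  filter_upwards [hX, hY, h] with z h1 h2 h3
  rw [h3, h1, h2]

lemma extDerivTwo_ricciForm (X Y Z : SmoothField m U) (y : U) :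
    extDerivTwo S.ricciForm X.ext Y.ext Z.ext y =
      (F.algebra.dTwo F.algebra.ricciForm X Y Z).1 y := by
  have hX : X.ext =ᶠ[𝓝 (y : M)] X.ext := .refl _ _
  have hY : Y.ext =ᶠ[𝓝 (y : M)] Y.ext := .refl _ _
  have hZ : Z.ext =ᶠ[𝓝 (y : M)] Z.ext := .refl _ _
  rw [extDerivTwo, dirDeriv_congr _ (F.ricciForm_eventuallyEq hY hZ),
    dirDeriv_congr _ (F.ricciForm_eventuallyEq hX hZ),
    dirDeriv_congr _ (F.ricciForm_eventuallyEq hX hY), F.br_apply hX hY, F.br_apply hX hZ,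
    F.br_apply hY hZ, SmoothField.ext_apply, SmoothField.ext_apply, SmoothField.ext_apply,
    F.ricciForm_eq, F.ricciForm_eq, F.ricciForm_eq, VectorFieldAlgebra.dTwo, SmoothFn.sub_apply,
    SmoothFn.add_apply, SmoothFn.sub_apply, SmoothFn.add_apply, SmoothFn.sub_apply]
  rfl

end LocalFrame

variable (S)

lemma smoothTwoForm_ricciForm : SmoothTwoForm S.ricciForm where
  add_left x u u' v := by
    obtain ⟨U, hx, ⟨F⟩⟩ := S.exists_localFrame x
    obtain ⟨X, rfl⟩ := F.exists_field ⟨x, hx⟩ u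
    obtain ⟨X', rfl⟩ := F.exists_field ⟨x, hx⟩ u'
    obtain ⟨Y, rfl⟩ := F.exists_field ⟨x, hx⟩ v
    have h := F.ricciForm_eq ⟨x, hx⟩
    exact (h (X + X') Y).trans ((congrArg (fun a ↦ a.1 ⟨x, hx⟩)
      (F.algebra.ricciForm_add_left X X' Y)).trans (congrArg₂ (· + ·) (h X Y) (h X' Y)).symm)
  smul_left x c u v := by
    obtain ⟨U, hx, ⟨F⟩⟩ := S.exists_localFrame x
    obtain ⟨X, rfl⟩ := F.exists_field ⟨x, hx⟩ u
    obtain ⟨Y, rfl⟩ := F.exists_field ⟨x, hx⟩ v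
    have h := F.ricciForm_eq ⟨x, hx⟩
    exact (h ((SmoothFn.const c : SmoothFn m U) • X) Y).trans ((congrArg (fun a ↦ a.1 ⟨x, hx⟩)
      (F.algebra.ricciForm_smul_left (SmoothFn.const c) X Y)).trans (congrArg (c * ·) (h X Y)).symm)
  swap x u v := by
    obtain ⟨U, hx, ⟨F⟩⟩ := S.exists_localFrame x
    obtain ⟨X, rfl⟩ := F.exists_field ⟨x, hx⟩ u
    obtain ⟨Y, rfl⟩ := F.exists_field ⟨x, hx⟩ v
    have h := F.ricciForm_eq ⟨x, hx⟩
    exact (h X Y).trans ((congrArg (fun a ↦ a.1 ⟨x, hx⟩)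
      (F.algebra.ricciForm_swap X Y)).trans (congrArg (- ·) (h Y X)).symm)
  smooth V X Y hX hY x hx := by
    obtain ⟨U, hx', ⟨F⟩⟩ := S.exists_localFrame x
    let W := U ⊓ V
    let F' := F.mono (inf_le_left : W ≤ U)
    let y : W := ⟨x, hx', hx⟩
    have h {X : VField m M} (hX : SmoothOn X V) : X =ᶠ[𝓝 (y : M)]
        (SmoothField.restr X (hX.mono (inf_le_right : W ≤ V))).ext :=
      (SmoothField.ext_eventuallyEq (fun _ ↦ rfl) y).symm
    exact ((((F'.algebra.ricciForm _ _).smooth).contMDiffAt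
      (W.isOpen.mem_nhds y.2)).congr_of_eventuallyEq
        (F'.ricciForm_eventuallyEq (h hX) (h hY))).contMDiffWithinAt

lemma ricciForm_T_left (x : M) (v : TangentSpace (𝓡 (2 * m + 1)) x) :
    S.ricciForm x (S.T x) v = 0 := by
  obtain ⟨U, hx, ⟨F⟩⟩ := S.exists_localFrame x
  obtain ⟨Y, rfl⟩ := F.exists_field ⟨x, hx⟩ v
  exact (F.ricciForm_eq ⟨x, hx⟩ F.T Y).trans (congrArg (fun a ↦ a.1 ⟨x, hx⟩)
    (F.algebra.ricciForm_T_left Y))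

/-- The Ricci form is a smooth horizontal `2`-form. -/
theorem isHorizontalTwoForm_ricciForm : S.IsHorizontalTwoForm S.ricciForm where
  add_left := S.smoothTwoForm_ricciForm.add_left
  smul_left := S.smoothTwoForm_ricciForm.smul_left
  swap := S.smoothTwoForm_ricciForm.swap
  smooth _ _ _ hX hY := S.smoothTwoForm_ricciForm.contMDiffAt hX hY
  T_contract := S.ricciForm_T_left

lemma θ_ricci (x : M) (v : TangentSpace (𝓡 (2 * m + 1)) x) : S.θ x (S.ricci x v) = 0 := by
  obtain ⟨U, hx, ⟨F⟩⟩ := S.exists_localFrame x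
  obtain ⟨X, rfl⟩ := F.exists_field ⟨x, hx⟩ v
  rw [F.ricci_eq ⟨x, hx⟩ X]
  exact (S.θField_apply _ ⟨x, hx⟩).symm.trans (congrArg (fun a ↦ a.1 ⟨x, hx⟩)
    (F.algebra.θ_ricci X))

/-- The Ricci endomorphism sends `T` to the divergence of the torsion. -/
theorem ricci_T (x : M) : S.ricci x (S.T x) = S.divTau x := by
  obtain ⟨U, hx, ⟨F⟩⟩ := S.exists_localFrame x
  exact (F.ricci_eq ⟨x, hx⟩ F.T).trans ((congrArg (fun a ↦ a.1 ⟨x, hx⟩) F.algebra.ricci_T).trans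
    (F.divTau_eq ⟨x, hx⟩).symm)

lemma SmoothAt_hpart {X : VField m M} {x : M} (hX : SmoothAt X x) : SmoothAt (S.hpart X) x := by
  obtain ⟨U, hx, ⟨F⟩⟩ := S.exists_localFrame x
  exact ContMDiffAt.sub_section hX
    (ContMDiffAt.smul_section (S.smooth_θapply hX) (F.smooth_T.smoothAt ⟨x, hx⟩))

/-- The horizontal exterior differential of the Ricci form. -/
theorem dW_ricciForm {X Y Z : VField m M} {x : M} (hX : SmoothAt X x) (hY : SmoothAt Y x)
    (hZ : SmoothAt Z x) : S.dW S.ricciForm X Y Z x =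
      - wedge (fun v ↦ S.g x (S.J x (S.ricci x (S.T x))) v) (S.dθ x) (X x) (Y x) (Z x) := by
  obtain ⟨U, hx, ⟨F⟩⟩ := S.exists_localFrame x
  let y : U := ⟨x, hx⟩
  -- `W` need only agree with `X^H` at `x`; `extDerivTwo_congr` permits the replacement.
  have key {X : VField m M} (hX : SmoothAt X x) : ∃ W : SmoothField m U, S.θField W = 0 ∧
      W.1 y = S.proj x (X x) ∧ DiffAt (S.hpart X) x ∧ DiffAt W.ext x ∧ S.hpart X x = W.ext x := by
    obtain ⟨W, hW⟩ := F.exists_field y (X x)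
    have h1 : (F.algebra.P W).1 y = S.proj x (X x) := by rw [F.P_apply, hW]
    refine ⟨F.algebra.P W, F.algebra.θ_P W, h1, (S.SmoothAt_hpart hX).mdifferentiableAt',
      ((F.algebra.P W).smoothAt y).mdifferentiableAt', ?_⟩
    exact h1.symm.trans (SmoothField.ext_apply _ y).symm
  obtain ⟨X', hX1, hX2, hX3, hX4, hX5⟩ := key hX
  obtain ⟨Y', hY1, hY2, hY3, hY4, hY5⟩ := key hY
  obtain ⟨Z', hZ1, hZ2, hZ3, hZ4, hZ5⟩ := key hZ
  have hJ : (F.J (F.algebra.ricci F.T)).1 y = S.J x (S.ricci x (S.T x)) := by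
    rw [F.J_hor (F.algebra.θ_ricci F.T)]
    exact congrArg _ (F.ricci_eq y F.T).symm
  have hg {W : SmoothField m U} {X : VField m M} (h : W.1 y = S.proj x (X x)) :
      (F.algebra.g (F.J (F.algebra.ricci F.T)) W).1 y =
        S.g x (S.J x (S.ricci x (S.T x))) (X x) := by
    rw [F.g_apply, hJ, h, S.g_proj_right]
  have hd {W W' : SmoothField m U} {X X' : VField m M} (h : W.1 y = S.proj x (X x))
      (h' : W'.1 y = S.proj x (X' x)) : (F.algebra.dθ W W').1 y = S.dθ x (X x) (X' x) := by
    rw [F.dθ_apply, h, h', S.dθ_proj_left, S.dθ_proj_right]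
  rw [dW, S.smoothTwoForm_ricciForm.extDerivTwo_congr hX3 hX4 hY3 hY4 hZ3 hZ4 hX5 hY5 hZ5,
    F.extDerivTwo_ricciForm X' Y' Z' y, F.algebra.dTwo_ricciForm hX1 hY1 hZ1, wedge,
    SmoothFn.neg_apply, SmoothFn.add_apply, SmoothFn.sub_apply, SmoothFn.mul_apply,
    SmoothFn.mul_apply, SmoothFn.mul_apply]
  change -((F.algebra.g (F.J (F.algebra.ricci F.T)) X').1 y * _ -
    (F.algebra.g (F.J (F.algebra.ricci F.T)) Y').1 y * _ +
    (F.algebra.g (F.J (F.algebra.ricci F.T)) Z').1 y * _) = _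
  rw [hg hX2, hg hY2, hg hZ2, hd hY2 hZ2, hd hX2 hZ2, hd hX2 hY2]

lemma g_pos {x : M} {v : TangentSpace (𝓡 (2 * m + 1)) x} (hv : S.θ x v = 0) (h0 : v ≠ 0) :
    0 < S.g x v v := by
  rw [g, S.proj_of_hor hv]
  exact S.pos_def x v hv h0

lemma dθ_J_self_pos {x : M} {v : TangentSpace (𝓡 (2 * m + 1)) x} (hv : S.θ x v = 0)
    (h0 : v ≠ 0) : 0 < S.dθ x v (S.J x v) := by
  have := S.pos_def x v hv h0
  change 0 < 1 / 2 * S.dθ x v (S.J x v) at this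
  linarith

/-- In dimension at least `5`, the wedge product with `dθ` is injective on horizontal `1`-forms. -/
lemma eq_zero_of_wedge_eq_zero (hm : 2 ≤ m) {x : M} {a : TangentSpace (𝓡 (2 * m + 1)) x}
    (ha : S.θ x a = 0) (h : ∀ u v w, wedge (fun v ↦ S.g x a v) (S.dθ x) u v w = 0) : a = 0 := by
  by_contra h0
  have := finite_tangent (m := m) x
  -- Since `2m > 2`, some nonzero horizontal `v` is orthogonal to both `a` and `J a`; the latter
  -- condition means `dθ(a, v) = 0`.
  let φ : S.hor x →ₗ[ℝ] ℝ × ℝ :=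
    ((S.gHom x a).prod (S.gHom x (S.J x a))) ∘ₗ (S.hor x).subtype
  have hker : LinearMap.ker φ ≠ ⊥ := by
    apply LinearMap.ker_ne_bot_of_finrank_lt
    rw [S.finrank_hor, Module.finrank_prod, Module.finrank_self]
    omega
  obtain ⟨v, hv, hv0⟩ := (Submodule.ne_bot_iff _).1 hker
  have hv1 : S.g x a v = 0 := congrArg Prod.fst (LinearMap.mem_ker.1 hv)
  have hv2 : S.g x (S.J x a) v = 0 := congrArg Prod.snd (LinearMap.mem_ker.1 hv)
  have hvθ : S.θ x v = 0 := v.2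
  have hd : S.dθ x a v = 0 := by
    rw [g, S.proj_of_hor hvθ, S.dθ_J_J ha hvθ] at hv2
    linarith
  -- On `(a, v, Jv)` only the first wedge term survives: it is `g(a, a) dθ(v, Jv)`, a product of
  -- positive numbers.
  have h1 := h a v (S.J x v)
  have h2 : S.g x a a * S.dθ x v (S.J x v) = 0 := by
    simpa [wedge, hv1, hd] using h1
  have h3 := mul_pos (S.g_pos ha h0) (S.dθ_J_self_pos hvθ fun h ↦ hv0 (Subtype.ext h))
  linarith

end PseudoHermitian

end

end CR

end

/-! ### Conclusion -/

theorem mainTheorem8 {m : ℕ} (hm : 1 ≤ m) {M : Type*} [TopologicalSpace M]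
    [ChartedSpace (EuclideanSpace ℝ (Fin (2 * m + 1))) M] [IsManifold (𝓡 (2 * m + 1)) ∞ M]
    (S : CR.PseudoHermitian m M) :
    S.IsHorizontalTwoForm S.ricciForm ∧
    (∀ (x : M) (X Y Z : CR.VField m M),
      CR.SmoothAt X x → CR.SmoothAt Y x → CR.SmoothAt Z x →
      S.dW S.ricciForm X Y Z x =
        - CR.wedge (fun v ↦ S.g x (S.J x (S.ricci x (S.T x))) v) (S.dθ x) (X x) (Y x) (Z x)) ∧
    ((∀ x, S.divTau x = 0) → S.IsDWClosed S.ricciForm) ∧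
    (2 ≤ m → (S.IsDWClosed S.ricciForm ↔ ∀ x, S.divTau x = 0)) := by
  have closed (h : ∀ x, S.divTau x = 0) : S.IsDWClosed S.ricciForm := by
    intro x X Y Z hX hY hZ
    rw [S.dW_ricciForm hX hY hZ, S.ricci_T, h, map_zero]
    simp [CR.wedge, ← S.gHom_apply]
  refine ⟨S.isHorizontalTwoForm_ricciForm, fun x X Y Z hX hY hZ ↦ S.dW_ricciForm hX hY hZ, closed,
    fun hm' ↦ ⟨fun h x ↦ ?_, closed⟩⟩
  have hθ := S.θ_ricci x (S.T x)
  have hJ : S.J x (S.ricci x (S.T x)) = 0 := by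
    refine S.eq_zero_of_wedge_eq_zero hm' (S.J_mem x _ hθ) fun u v w ↦ ?_
    have h1 := S.dW_ricciForm (CR.smoothAt_ext u) (CR.smoothAt_ext v) (CR.smoothAt_ext w)
    rw [h x _ _ _ (CR.smoothAt_ext u) (CR.smoothAt_ext v) (CR.smoothAt_ext w), CR.ext_self,
      CR.ext_self, CR.ext_self] at h1
    exact neg_eq_zero.1 h1.symm
  -- `J` is injective on `ker θ`, so `J Ric(T) = 0` forces `Ric(T) = div τ = 0`.
  have h2 := S.J_sq x _ hθ
  rw [hJ, map_zero] at h2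
  rw [← S.ricci_T, neg_eq_zero.1 h2.symm]
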